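/- Let $k$ be an algebraically closed field, $n\ge 0$ an integer, and $G=GL_n\times\mathbb{G}_m\times\mathbb{G}_m$. Let $G$ act on $\mathfrak{gl}_n\oplus\mathfrak{gl}_n$ by $(h,t_1,t_2)\cdot(X,Y)=(t_1hXh^{-1},\,t_2hYh^{-1})$, and let $Comm_n\subset \mathfrak{gl}_n\oplus\mathfrak{gl}_n$ be the $G$-stable closed subscheme of commuting pairs, defined by the entries of $XY-YX$. For a $G$-scheme $Z$ let $K^G(Z)$ be the Grothendieck group of $G$-equivariant coherent sheaves on $Z$. Let $p:Comm_n\to\mathfrak{gl}_n\oplus\mathfrak{gl}_n$ be the inclusion and $p_*$ the push-forward on $K^G$. Let $r_0:\mathrm{Spec}(k)\to\mathfrak{gl}_n\oplus\mathfrak{gl}_n$ be the inclusion of the origin and $$r_0^*:K^G(\mathfrak{gl}_n\oplus\mathfrak{gl}_n)\to K^G(\mathrm{Spec}\,k),\qquad r_0^*[\mathcal F]=\sum_{i\ge 0}(-1)^i\,[\mathrm{Tor}_i^{\mathcal O_{\mathfrak{gl}_n\oplus\mathfrak{gl}_n}}(k,\mathcal F)],$$ the (well-defined) Gysin pull-back.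 Taking characters of the maximal torus $T_n\times\mathbb{G}_m\times\mathbb{G}_m$, where $T_n\subset GL_n$ is the group of diagonal matrices, identifies $$K^G(\mathrm{Spec}\,k)=\mathbb{Z}[q_1^{\pm1},q_2^{\pm1}][z_1^{\pm1},\dots,z_n^{\pm1}]^{Sym},$$ where $z_1,\dots,z_n$ are the coordinate characters of $T_n$, $q_1,q_2$ are those of the two factors $\mathbb{G}_m$, and $Sym$ denotes invariants under permutations of $z_1,\dots,z_n$. Let $$I_n=\bigcap_{i,j,l\in\{1,\dots,n\}\text{ pairwise distinct}}(z_l-q_2z_j,\;z_j-q_1z_i)\subset\mathbb{Z}[q_1^{\pm1},q_2^{\pm1}][z_1^{\pm1},\dots,z_n^{\pm1}],$$ and let $I_n^{Sym}$ be the set of elements of $I_n$ invariant under permutations of the $z_i$. Then the image of $$r_0^*\circ p_*:K^G(Comm_n)\to K^G(\mathrm{Spec}\,k)=\mathbb{Z}[q_1^{\pm1},q_2^{\pm1}][z_1^{\pm1},\dots,z_n^{\pm1}]^{Sym}$$ is contained in $I_n^{Sym}$. -/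

import Mathlib

open scoped TensorProduct

universe u

namespace WheelComm

/-! ### The group and its rational representations -/

/-- The `k`-points of `GL_n × G_m × G_m`. -/
abbrev Grp (n : ℕ) (k : Type u) [Field k] : Type u :=
  Matrix.GeneralLinearGroup (Fin n) k × kˣ × kˣ

/-- The two factors `G_m`, as scalars: `scal g 0 = t₁` and `scal g 1 = t₂`. -/
def scal {n : ℕ} {k : Type u} [Field k] (g : Grp n k) (l : Fin 2) : kˣ :=
  if l = 0 then g.2.1 else g.2.2

/-- The coordinate ring of `GL_n × G_m × G_m` over an algebraically closed field, as functions on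
`k`-points: generated by the entries of `h` and `h⁻¹` and by `t₁^{±1}`, `t₂^{±1}`. -/
def regularFunctions (n : ℕ) (k : Type u) [Field k] : Subalgebra k (Grp n k → k) :=
  Algebra.adjoin k
    {f | (∃ i j, f = fun g => (g.1 : Matrix (Fin n) (Fin n) k) i j) ∨
      (∃ i j, f = fun g => ((g.1⁻¹ : Matrix.GeneralLinearGroup (Fin n) k) :
        Matrix (Fin n) (Fin n) k) i j) ∨
      (∃ l, f = fun g => (scal g l : k)) ∨
      (∃ l, f = fun g => (((scal g l)⁻¹ : kˣ) : k))}

/-- A representation of `G = GL_n × G_m × G_m` is rational if every orbit map `g ↦ g • v` is given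
by a coaction element `∑ fᵢ ⊗ wᵢ ∈ k[G] ⊗ V`. -/
def IsRational {n : ℕ} {k : Type u} [Field k] {V : Type u} [AddCommGroup V] [Module k V]
    (ρ : Representation k (Grp n k) V) : Prop :=
  ∀ v : V, ∃ (m : ℕ) (f : Fin m → Grp n k → k) (w : Fin m → V),
    (∀ i, f i ∈ regularFunctions n k) ∧ ∀ g, ρ g v = ∑ i, f i g • w i

/-- Finite dimensional rational representations of `GL_n × G_m × G_m`, that is, equivariant
coherent sheaves on a point. -/
structure RatRep (n : ℕ) (k : Type u) [Field k] : Type (u + 1) where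
  carrier : Type u
  [addCommGroup : AddCommGroup carrier]
  [module : Module k carrier]
  [finite : Module.Finite k carrier]
  ρ : Representation k (Grp n k) carrier
  rational : IsRational ρ

attribute [instance] RatRep.addCommGroup RatRep.module RatRep.finite

/-! ### Equivariant sheaves on affine schemes -/

/-- A (not necessarily finitely generated) module over `A` with a compatible linear action of
`G = GL_n × G_m × G_m`, where `G` acts on the `k`-algebra `A` through `act`. -/
structure EqMod {n : ℕ} {k : Type u} [Field k] {A : Type u} [CommRing A] [Algebra k A]
    (act : Grp n k →* (A →ₐ[k] A)) : Type (u + 1) where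
  carrier : Type u
  [addCommGroup : AddCommGroup carrier]
  [moduleBase : Module k carrier]
  [module : Module A carrier]
  [tower : IsScalarTower k A carrier]
  ρ : Representation k (Grp n k) carrier
  semilinear : ∀ g (a : A) (m : carrier), ρ g (a • m) = act g a • ρ g m

attribute [instance] EqMod.addCommGroup EqMod.moduleBase EqMod.module EqMod.tower

/-- Equivariant coherent sheaves on the affine `G`-scheme `Spec A`: finitely generated `A`-modules
with a compatible rational action of `G`. -/
structure EqCoh {n : ℕ} {k : Type u} [Field k] {A : Type u} [CommRing A] [Algebra k A]
    (act : Grp n k →* (A →ₐ[k] A)) : Type (u + 1) extends EqMod act where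
  finite : Module.Finite A carrier
  rational : IsRational ρ

/-! ### Grothendieck groups -/

/-- The abelian group generated by `Obj` with a relation `[F] = [F'] + [F'']` for each short exact
sequence `0 → F' → F → F'' → 0`. -/
abbrev KGroup (Obj : Type (u + 1)) (SES : Obj → Obj → Obj → Prop) : Type (u + 1) :=
  FreeAbelianGroup Obj ⧸ AddSubgroup.closure
    {x | ∃ F' F F'' : Obj, SES F' F F'' ∧ x = FreeAbelianGroup.of F -
      (FreeAbelianGroup.of F' + FreeAbelianGroup.of F'')}

section

variable {n : ℕ} {k : Type u} [Field k]

/-- There is a short exact sequence `0 → V' → V → V'' → 0` of representations. -/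
def RatRep.ShortExact (V' V V'' : RatRep n k) : Prop :=
  ∃ (i : V'.carrier →ₗ[k] V.carrier) (p : V.carrier →ₗ[k] V''.carrier),
    (∀ g x, i (V'.ρ g x) = V.ρ g (i x)) ∧ (∀ g x, p (V.ρ g x) = V''.ρ g (p x)) ∧
    Function.Injective i ∧ Function.Exact i p ∧ Function.Surjective p

variable {A : Type u} [CommRing A] [Algebra k A] {act : Grp n k →* (A →ₐ[k] A)}

/-- There is a short exact sequence `0 → F' → F → F'' → 0` of equivariant coherent sheaves. -/
def EqCoh.ShortExact (F' F F'' : EqCoh act) : Prop :=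
  ∃ (i : F'.carrier →ₗ[A] F.carrier) (p : F.carrier →ₗ[A] F''.carrier),
    (∀ g x, i (F'.ρ g x) = F.ρ g (i x)) ∧ (∀ g x, p (F.ρ g x) = F''.ρ g (p x)) ∧
    Function.Injective i ∧ Function.Exact i p ∧ Function.Surjective p

end

/-- The representation group `Rep(G) = K^G(pt)` of `G = GL_n × G_m × G_m`. -/
abbrev RepGroup (n : ℕ) (k : Type u) [Field k] : Type (u + 1) :=
  KGroup (RatRep n k) RatRep.ShortExact

/-- The class of a representation in `K^G(pt)`. -/
def RatRep.cls {n : ℕ} {k : Type u} [Field k] (V : RatRep n k) : RepGroup n k :=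
  QuotientAddGroup.mk (FreeAbelianGroup.of V)

/-- The equivariant K-group `K^G(Spec A)` of equivariant coherent sheaves. -/
abbrev EqK {n : ℕ} {k : Type u} [Field k] {A : Type u} [CommRing A] [Algebra k A]
    (act : Grp n k →* (A →ₐ[k] A)) : Type (u + 1) :=
  KGroup (EqCoh act) EqCoh.ShortExact

/-- The class of an equivariant coherent sheaf in `K^G(Spec A)`. -/
def EqCoh.cls {n : ℕ} {k : Type u} [Field k] {A : Type u} [CommRing A] [Algebra k A]
    {act : Grp n k →* (A →ₐ[k] A)} (F : EqCoh act) : EqK act :=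
  QuotientAddGroup.mk (FreeAbelianGroup.of F)

/-! ### Push-forward along equivariant closed embeddings -/

section Push

variable {n : ℕ} {k : Type u} [Field k] {A B : Type u} [CommRing A] [Algebra k A]
  [CommRing B] [Algebra k B] {actA : Grp n k →* (A →ₐ[k] A)} {actB : Grp n k →* (B →ₐ[k] B)}

/-- Push-forward of an equivariant coherent sheaf along the closed embedding `Spec B → Spec A`
given by an equivariant surjection `φ : A → B`: the same module, viewed over `A`. -/
def pushObj (φ : A →ₐ[k] B) (hφ : Function.Surjective φ)
    (hact : ∀ g a, φ (actA g a) = actB g (φ a)) (F : EqCoh actB) : EqCoh actA :=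
  letI : Module A F.carrier := Module.compHom F.carrier φ.toRingHom
  { carrier := F.carrier
    tower := ⟨fun c a m => by
      change φ (c • a) • m = c • (φ a • m)
      rw [map_smul, smul_assoc]⟩
    ρ := F.ρ
    semilinear := fun g a m => by
      change F.ρ g (φ a • m) = φ (actA g a) • F.ρ g m
      rw [F.semilinear, hact]
    finite := by
      obtain ⟨s, hs⟩ := F.finite.fg_top
      refine ⟨⟨s, ?_⟩⟩
      rw [eq_top_iff]
      intro m _
      have hm : m ∈ Submodule.span B (s : Set F.carrier) := by rw [hs]; trivial
      induction hm using Submodule.span_induction with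
      | mem x hx => exact Submodule.subset_span hx
      | zero => exact Submodule.zero_mem _
      | add x y _ _ hx hy => exact Submodule.add_mem _ (hx trivial) (hy trivial)
      | smul b x _ hx =>
        obtain ⟨a, rfl⟩ := hφ b
        exact Submodule.smul_mem (Submodule.span A (s : Set F.carrier)) a (hx trivial)
    rational := F.rational }

/-- Push-forward on equivariant K-groups along an equivariant closed embedding. -/
def pushK (φ : A →ₐ[k] B) (hφ : Function.Surjective φ)
    (hact : ∀ g a, φ (actA g a) = actB g (φ a)) : EqK actB →+ EqK actA :=
  QuotientAddGroup.lift _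
    (FreeAbelianGroup.lift fun F : EqCoh actB => (pushObj φ hφ hact F).cls) (by
      rw [AddSubgroup.closure_le]
      rintro x ⟨F', F, F'', ⟨i, p, hi, hp, h1, h2, h3⟩, rfl⟩
      have key : (pushObj φ hφ hact F).cls =
          (pushObj φ hφ hact F').cls + (pushObj φ hφ hact F'').cls := by
        refine (QuotientAddGroup.eq_iff_sub_mem).2 (AddSubgroup.subset_closure ?_)
        exact ⟨pushObj φ hφ hact F', pushObj φ hφ hact F, pushObj φ hφ hact F'',
          ⟨{ toFun := i, map_add' := i.map_add, map_smul' := fun a m => i.map_smul (φ a) m },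
            { toFun := p, map_add' := p.map_add, map_smul' := fun a m => p.map_smul (φ a) m },
            hi, hp, h1, h2, h3⟩, rfl⟩
      simp [key])

end Push

/-! ### Tor with its group action -/

section Tor

variable {n : ℕ} {k : Type u} [Field k] {A : Type u} [CommRing A] [Algebra k A]
  {act : Grp n k →* (A →ₐ[k] A)}

/-- The action of `G` on `A`, as a representation. -/
def ringRep (act : Grp n k →* (A →ₐ[k] A)) : Representation k (Grp n k) A where
  toFun g := (act g).toLinearMap
  map_one' := by ext; simp
  map_mul' g h := by ext; simp

/-- The free `A`-module `A ⊗ₖ M` with the diagonal action of `G`. -/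
noncomputable def EqMod.free (M : EqMod act) : EqMod act where
  carrier := A ⊗[k] M.carrier
  ρ := (ringRep act).tprod M.ρ
  semilinear g a m := by
    induction m using TensorProduct.induction_on with
    | zero => simp
    | tmul b m => simp [ringRep, TensorProduct.smul_tmul']
    | add x y hx hy => rw [smul_add, map_add, hx, hy, map_add, smul_add]

/-- The equivariant surjection `A ⊗ₖ M → M`, `a ⊗ m ↦ a m`. -/
noncomputable def EqMod.counit (M : EqMod act) : M.free.carrier →ₗ[A] M.carrier :=
  LinearMap.liftBaseChange A (LinearMap.id : M.carrier →ₗ[k] M.carrier)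

lemma EqMod.counit_equivariant (M : EqMod act) (g : Grp n k) (x : M.free.carrier) :
    M.counit (M.free.ρ g x) = M.ρ g (M.counit x) := by
  change A ⊗[k] M.carrier at x
  induction x using TensorProduct.induction_on with
  | zero => exact (by simp : M.counit (M.free.ρ g 0) = M.ρ g (M.counit 0))
  | tmul a m =>
    change (LinearMap.liftBaseChange A (LinearMap.id : M.carrier →ₗ[k] M.carrier))
      ((act g a) ⊗ₜ M.ρ g m) = M.ρ g
      ((LinearMap.liftBaseChange A (LinearMap.id : M.carrier →ₗ[k] M.carrier)) (a ⊗ₜ m))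
    simp [M.semilinear]
  | add x y hx hy =>
    have h1 : M.free.ρ g (x + y) = M.free.ρ g x + M.free.ρ g y := map_add _ _ _
    have h2 : M.counit (x + y) = M.counit x + M.counit y := map_add _ _ _
    refine (congrArg M.counit h1).trans ((map_add _ _ _).trans ?_)
    refine Eq.trans ?_ (congrArg (M.ρ g) h2.symm)
    rw [map_add, hx, hy]

/-- The kernel of `A ⊗ₖ M → M` with its action of `G`. -/
noncomputable def EqMod.syz (M : EqMod act) : EqMod act where
  carrier := LinearMap.ker M.counit
  tower := ⟨fun c a x => Subtype.ext (smul_assoc c a x.1)⟩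
  ρ := M.free.ρ.subrepresentation ((LinearMap.ker M.counit).restrictScalars k) (by
    intro g x hx
    have hx' : M.counit x = 0 := hx
    change M.counit (M.free.ρ g x) = 0
    rw [M.counit_equivariant, hx', map_zero])
  semilinear g a m := Subtype.ext (M.free.semilinear g a m)

/-- The iterated syzygies `Ωⁱ M`, where `Ω M = ker (A ⊗ₖ M → M)`. -/
noncomputable def EqMod.syzIter (M : EqMod act) : ℕ → EqMod act
  | 0 => M
  | i + 1 => (M.syzIter i).syz

/-- The `i`-th term `Pᵢ = A ⊗ₖ Ωⁱ M` of the standard equivariant resolution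
`⋯ → P₂ → P₁ → P₀ → M → 0` of `M` by free `A`-modules. -/
noncomputable abbrev EqMod.res (M : EqMod act) (i : ℕ) : EqMod act := (M.syzIter i).free

/-- The differential `Pᵢ₊₁ = A ⊗ₖ Ωⁱ⁺¹ M → Ωⁱ⁺¹ M ⊆ A ⊗ₖ Ωⁱ M = Pᵢ`. -/
noncomputable def EqMod.diff (M : EqMod act) (i : ℕ) : (M.res (i + 1)).carrier →ₗ[A] (M.res i).carrier :=
  (LinearMap.ker (M.syzIter i).counit).subtype ∘ₗ (M.syzIter (i + 1)).counit

/-- The terms of the resolution are free `A`-modules. -/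
lemma EqMod.res_free (M : EqMod act) (i : ℕ) : Module.Free A (M.res i).carrier :=
  inferInstanceAs (Module.Free A (A ⊗[k] (M.syzIter i).carrier))

lemma EqMod.counit_surjective (M : EqMod act) : Function.Surjective M.counit := fun m =>
  ⟨(1 : A) ⊗ₜ[k] m, by
    change (LinearMap.liftBaseChange A (LinearMap.id : M.carrier →ₗ[k] M.carrier)) _ = _
    simp⟩

/-- The resolution is exact at `P₀`. -/
lemma EqMod.exact_diff_zero (M : EqMod act) : Function.Exact (M.diff 0) M.counit := by
  intro x
  constructor
  · intro hx
    obtain ⟨y, hy⟩ := M.syz.counit_surjective ⟨x, hx⟩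
    exact ⟨y, congrArg Subtype.val hy⟩
  · rintro ⟨y, rfl⟩
    exact (M.syz.counit y).2

/-- The resolution is exact at `Pᵢ₊₁`. -/
lemma EqMod.exact_diff (M : EqMod act) (i : ℕ) :
    Function.Exact (M.diff (i + 1)) (M.diff i) := by
  intro x
  refine Iff.trans ?_ ((M.syzIter (i + 1)).exact_diff_zero x)
  exact ⟨fun h => Subtype.ext h, fun h => congrArg Subtype.val h⟩

lemma EqMod.diff_equivariant (M : EqMod act) (i : ℕ) (g : Grp n k) (x : (M.res (i + 1)).carrier) :
    M.diff i ((M.res (i + 1)).ρ g x) = (M.res i).ρ g (M.diff i x) :=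
  congrArg Subtype.val ((M.syzIter (i + 1)).counit_equivariant g x)

variable (J : Ideal A)

/-- The cycles of degree `i` of the complex `P / J P`, as a subspace of `Pᵢ`. -/
noncomputable def EqMod.torCycles (M : EqMod act) : (i : ℕ) → Submodule k (M.res i).carrier
  | 0 => ⊤
  | i + 1 => ((J • ⊤ : Submodule A (M.res i).carrier).comap (M.diff i)).restrictScalars k

/-- The boundaries of degree `i` of the complex `P / J P`, as a subspace of `Pᵢ`. -/
noncomputable def EqMod.torBoundaries (M : EqMod act) (i : ℕ) : Submodule k (M.res i).carrier :=
  ((J • ⊤ : Submodule A (M.res i).carrier) ⊔ LinearMap.range (M.diff i)).restrictScalars k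

variable {J}

lemma EqMod.smul_top_stable (hJ : ∀ g, ∀ a ∈ J, act g a ∈ J) (M : EqMod act) (g : Grp n k)
    {x : M.carrier} (hx : x ∈ (J • ⊤ : Submodule A M.carrier)) :
    M.ρ g x ∈ (J • ⊤ : Submodule A M.carrier) := by
  induction hx using Submodule.smul_induction_on' with
  | smul a ha m _ =>
    rw [M.semilinear]
    exact Submodule.smul_mem_smul (hJ g a ha) trivial
  | add x _ y _ hx hy => rw [map_add]; exact Submodule.add_mem _ hx hy

lemma EqMod.torCycles_stable (hJ : ∀ g, ∀ a ∈ J, act g a ∈ J) (M : EqMod act) (i : ℕ)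
    (g : Grp n k) : M.torCycles J i ≤ (M.torCycles J i).comap ((M.res i).ρ g) := by
  intro x hx
  cases i with
  | zero => trivial
  | succ i =>
    have hx' : M.diff i x ∈ (J • ⊤ : Submodule A (M.res i).carrier) := hx
    change M.diff i ((M.res (i + 1)).ρ g x) ∈ (J • ⊤ : Submodule A (M.res i).carrier)
    rw [M.diff_equivariant]
    exact (M.res i).smul_top_stable hJ g hx'

lemma EqMod.torBoundaries_stable (hJ : ∀ g, ∀ a ∈ J, act g a ∈ J) (M : EqMod act) (i : ℕ)
    (g : Grp n k) : M.torBoundaries J i ≤ (M.torBoundaries J i).comap ((M.res i).ρ g) := by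
  intro x hx
  obtain ⟨y, hy, z, ⟨w, rfl⟩, rfl⟩ := Submodule.mem_sup.1
    (show x ∈ (J • ⊤ : Submodule A (M.res i).carrier) ⊔ LinearMap.range (M.diff i) from hx)
  change (M.res i).ρ g (y + M.diff i w) ∈
    (J • ⊤ : Submodule A (M.res i).carrier) ⊔ LinearMap.range (M.diff i)
  rw [map_add, ← M.diff_equivariant]
  exact Submodule.add_mem_sup ((M.res i).smul_top_stable hJ g hy) ⟨_, rfl⟩

/-- `Tor_i^A(A / J, M)`, computed as the `i`-th homology `Hᵢ(P / J P)` for the standard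
resolution `P` of `M` by free `A`-modules. -/
abbrev EqMod.TorSpace (J : Ideal A) (M : EqMod act) (i : ℕ) : Type u :=
  (M.torCycles J i) ⧸ (M.torBoundaries J i).submoduleOf (M.torCycles J i)

/-- The action of `G` on `Tor_i^A(A / J, M)` for a `G`-stable ideal `J`. -/
noncomputable def EqMod.torRep (hJ : ∀ g, ∀ a ∈ J, act g a ∈ J) (M : EqMod act) (i : ℕ) :
    Representation k (Grp n k) (M.TorSpace J i) :=
  ((M.res i).ρ.subrepresentation (M.torCycles J i) (M.torCycles_stable hJ i)).quotient
    ((M.torBoundaries J i).submoduleOf (M.torCycles J i))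
    (fun g _ hx => M.torBoundaries_stable hJ i g hx)

/-- `T` is isomorphic to `Tor_i^A(A / J, M)` as a representation of `G`. -/
def IsTor (hJ : ∀ g, ∀ a ∈ J, act g a ∈ J) (M : EqMod act) (i : ℕ) (T : RatRep n k) : Prop :=
  ∃ e : T.carrier ≃ₗ[k] M.TorSpace J i, ∀ g x, e (T.ρ g x) = M.torRep hJ i g (e x)

/-- Let `J` be the ideal of a `G`-fixed `k`-point `r : Spec k → Spec A`. The homomorphism `φ` is the
Gysin pull-back `r^* : K^G(Spec A) → K^G(pt)`, `[F] ↦ ∑ᵢ (-1)ⁱ [Tor_i^A(k, F)]`; part of the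
condition is that the `Tor_i` are finite dimensional rational representations, almost all zero. -/
def IsGysin (hJ : ∀ g, ∀ a ∈ J, act g a ∈ J) (φ : EqK act →+ RepGroup n k) : Prop :=
  ∀ F : EqCoh act, ∃ (T : ℕ → RatRep n k) (N : ℕ), (∀ i, IsTor hJ F.toEqMod i (T i)) ∧
    (∀ i, N ≤ i → Subsingleton (T i).carrier) ∧
    φ F.cls = ∑ i ∈ Finset.range N, (-1 : ℤ) ^ i • (T i).cls

lemma RatRep.cls_eq_zero {V : RatRep n k} (hV : Subsingleton V.carrier) : V.cls = 0 := by
  have h : V.cls = V.cls + V.cls := by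
    refine (QuotientAddGroup.eq_iff_sub_mem).2 (AddSubgroup.subset_closure ?_)
    exact ⟨V, V, V, ⟨0, 0, fun _ _ => Subsingleton.elim _ _, fun _ _ => Subsingleton.elim _ _,
      Function.injective_of_subsingleton _,
      fun y => ⟨fun _ => ⟨0, Subsingleton.elim _ _⟩, fun _ => Subsingleton.elim _ _⟩,
      fun y => ⟨0, Subsingleton.elim _ _⟩⟩, rfl⟩
  simpa using h

/-- Isomorphic representations have the same class. -/
lemma RatRep.cls_eq_of_iso {V W : RatRep n k} (e : V.carrier ≃ₗ[k] W.carrier)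
    (he : ∀ g x, e (V.ρ g x) = W.ρ g (e x)) : V.cls = W.cls := by
  let Z : RatRep n k :=
    { carrier := PUnit
      ρ := 1
      rational := fun v => ⟨0, Fin.elim0, Fin.elim0, fun i => i.elim0,
        fun _ => Subsingleton.elim _ _⟩ }
  have hZ : Z.cls = 0 := RatRep.cls_eq_zero (inferInstanceAs (Subsingleton PUnit))
  have h : W.cls = V.cls + Z.cls := by
    refine (QuotientAddGroup.eq_iff_sub_mem).2 (AddSubgroup.subset_closure ?_)
    refine ⟨V, W, Z, ⟨e.toLinearMap, 0, he, fun _ _ => rfl, e.injective, ?_, ?_⟩, rfl⟩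
    · exact fun y => ⟨fun _ => ⟨e.symm y, e.apply_symm_apply y⟩, fun _ => rfl⟩
    · exact fun y => ⟨0, rfl⟩
  rw [h, hZ, add_zero]

/-- The Gysin pull-back is determined by its defining formula. -/
lemma IsGysin.unique {hJ : ∀ g, ∀ a ∈ J, act g a ∈ J} {φ ψ : EqK act →+ RepGroup n k}
    (hφ : IsGysin hJ φ) (hψ : IsGysin hJ ψ) : φ = ψ := by
  have key : ∀ F : EqCoh act, φ F.cls = ψ F.cls := by
    intro F
    obtain ⟨T, N, hT, hN, h1⟩ := hφ F
    obtain ⟨T', N', hT', hN', h2⟩ := hψ F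
    have hext : ∀ (U : ℕ → RatRep n k) (a b : ℕ), a ≤ b →
        (∀ i, a ≤ i → Subsingleton (U i).carrier) →
        ∑ i ∈ Finset.range a, (-1 : ℤ) ^ i • (U i).cls =
          ∑ i ∈ Finset.range b, (-1 : ℤ) ^ i • (U i).cls := by
      intro U a b hab hU
      refine Finset.sum_subset (Finset.range_mono hab) ?_
      intro i _ hi
      rw [RatRep.cls_eq_zero (hU i (by simpa using hi)), smul_zero]
    rw [h1, h2, hext T N (max N N') (le_max_left _ _) hN,
      hext T' N' (max N N') (le_max_right _ _) hN']
    refine Finset.sum_congr rfl fun i _ => ?_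
    congr 1
    obtain ⟨e, he⟩ := hT i
    obtain ⟨e', he'⟩ := hT' i
    refine RatRep.cls_eq_of_iso (e.trans e'.symm) fun g x => ?_
    rw [LinearEquiv.trans_apply, LinearEquiv.symm_apply_eq, he, he', LinearEquiv.trans_apply,
      LinearEquiv.apply_symm_apply]
  refine QuotientAddGroup.addMonoidHom_ext _ (FreeAbelianGroup.lift_ext _ _ fun F => ?_)
  exact key F

end Tor

/-! ### The space `gl_n ⊕ gl_n`, the commuting variety, and the origin -/

section Spaces

variable (n : ℕ) (k : Type u) [Field k]

/-- The coordinate ring of `gl_n ⊕ gl_n`; the variable `(l, i, j)` is the `(i, j)` entry of the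
first matrix for `l = 0`, and of the second matrix for `l = 1`. -/
abbrev CoordRing : Type u := MvPolynomial (Fin 2 × Fin n × Fin n) k

/-- The two universal matrices. -/
noncomputable def genMat (l : Fin 2) : Matrix (Fin n) (Fin n) (CoordRing n k) :=
  Matrix.of fun i j => MvPolynomial.X (l, i, j)

variable {n k}

/-- The matrix `g⁻¹ • X_l = t_l⁻¹ h⁻¹ X_l h` for `g = (h, t₁, t₂)`. -/
noncomputable def movedMat (g : Grp n k) (l : Fin 2) : Matrix (Fin n) (Fin n) (CoordRing n k) :=
  (MvPolynomial.C (((scal g l)⁻¹ : kˣ) : k) : CoordRing n k) •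
    (((g.1⁻¹ : Matrix.GeneralLinearGroup (Fin n) k) : Matrix (Fin n) (Fin n) k).map
        MvPolynomial.C * genMat n k l *
      (g.1 : Matrix (Fin n) (Fin n) k).map MvPolynomial.C)

/-- The translation of functions `(g • f)(X, Y) = f(g⁻¹ • (X, Y))`, where
`(h, t₁, t₂) • (X, Y) = (t₁ h X h⁻¹, t₂ h Y h⁻¹)`. -/
noncomputable def translate (g : Grp n k) : CoordRing n k →ₐ[k] CoordRing n k :=
  MvPolynomial.aeval fun p => movedMat g p.1 p.2.1 p.2.2

lemma map_genMat (g : Grp n k) (l : Fin 2) : (genMat n k l).map (translate g) = movedMat g l := by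
  ext1 i j
  simp [genMat, translate]

lemma map_const (g : Grp n k) (B : Matrix (Fin n) (Fin n) k) :
    (B.map (MvPolynomial.C : k →+* CoordRing n k)).map (translate g) = B.map MvPolynomial.C := by
  ext1 i j
  exact (translate g).commutes _

lemma scal_mul (g g' : Grp n k) (l : Fin 2) : scal (g * g') l = scal g l * scal g' l := by
  unfold scal; split_ifs <;> rfl

lemma scal_one (l : Fin 2) : scal (1 : Grp n k) l = 1 := by
  unfold scal; split_ifs <;> rfl

lemma map_movedMat (g g' : Grp n k) (l : Fin 2) :
    (movedMat g' l).map (translate g) = movedMat (g * g') l := by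
  have h1 : (movedMat g' l).map (translate g) =
      (MvPolynomial.C (((scal g' l)⁻¹ : kˣ) : k) : CoordRing n k) •
      (((g'.1⁻¹ : Matrix.GeneralLinearGroup (Fin n) k) : Matrix (Fin n) (Fin n) k).map
        MvPolynomial.C * movedMat g l * (g'.1 : Matrix (Fin n) (Fin n) k).map MvPolynomial.C) := by
    have e1 := map_const g g'.1.1
    have e2 := map_const g (g'.1⁻¹).1
    rw [← map_genMat g l]
    conv_rhs => rw [← e1, ← e2]
    rw [← Matrix.map_mul, ← Matrix.map_mul]
    ext1 i j
    have h2 : translate g (MvPolynomial.C (((scal g' l)⁻¹ : kˣ) : k)) =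
      MvPolynomial.C (((scal g' l)⁻¹ : kˣ) : k) := (translate g).commutes _
    simp only [movedMat, Matrix.map_apply, Matrix.smul_apply, smul_eq_mul, map_mul, h2]
  rw [h1, movedMat, movedMat, scal_mul]
  have h3 : ((g * g').1⁻¹).1 = (g'.1⁻¹).1 * (g.1⁻¹).1 := by simp [Prod.fst_mul, mul_inv_rev]
  have h4 : (g * g').1.1 = g.1.1 * g'.1.1 := rfl
  rw [h3, h4, Matrix.map_mul, Matrix.map_mul, mul_inv_rev, Units.val_mul, map_mul]
  simp only [Matrix.mul_smul, Matrix.smul_mul, smul_smul, Matrix.mul_assoc]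

lemma translate_one : translate (1 : Grp n k) = AlgHom.id k _ := by
  apply MvPolynomial.algHom_ext
  rintro ⟨l, i, j⟩
  have h : (1 : Matrix (Fin n) (Fin n) k).map (MvPolynomial.C : k →+* CoordRing n k) = 1 :=
    Matrix.map_one _ (map_zero _) (map_one _)
  simp [translate, movedMat, scal_one, genMat, h]

lemma translate_mul (g g' : Grp n k) : translate (g * g') = (translate g).comp (translate g') := by
  apply MvPolynomial.algHom_ext
  rintro ⟨l, i, j⟩
  have h := congrFun (congrFun (map_movedMat g g' l) i) j
  simp only [Matrix.map_apply] at h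
  simp only [AlgHom.comp_apply]
  rw [translate, MvPolynomial.aeval_X, ← h]
  congr 1
  simp [translate]

variable (n k)

/-- The action of `GL_n × G_m × G_m` on functions on `gl_n ⊕ gl_n`. -/
noncomputable def coordAct : Grp n k →* (CoordRing n k →ₐ[k] CoordRing n k) where
  toFun := translate
  map_one' := translate_one
  map_mul' := translate_mul

/-- The commutator `X Y - Y X` of the universal matrices. -/
noncomputable def commMat : Matrix (Fin n) (Fin n) (CoordRing n k) :=
  genMat n k 0 * genMat n k 1 - genMat n k 1 * genMat n k 0

/-- The ideal of `Comm_n` in `gl_n ⊕ gl_n`: the entries of `X Y - Y X`. -/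
noncomputable def commIdeal : Ideal (CoordRing n k) :=
  Ideal.span (Set.range fun p : Fin n × Fin n => commMat n k p.1 p.2)

/-- The coordinate ring of `Comm_n`. -/
abbrev CommVar : Type u := CoordRing n k ⧸ commIdeal n k

/-- The maximal ideal of the origin of `gl_n ⊕ gl_n`. -/
noncomputable def originIdeal : Ideal (CoordRing n k) :=
  RingHom.ker (MvPolynomial.aeval (fun _ => 0) : CoordRing n k →ₐ[k] k)

variable {n k}

lemma map_mul_map (B C D : Matrix (Fin n) (Fin n) (CoordRing n k)) (I : Ideal (CoordRing n k))
    (hC : ∀ i j, C i j ∈ I) (i j : Fin n) : (B * C * D) i j ∈ I := by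
  rw [Matrix.mul_apply]
  refine Ideal.sum_mem _ fun a _ => Ideal.mul_mem_right _ _ ?_
  rw [Matrix.mul_apply]
  exact Ideal.sum_mem _ fun b _ => Ideal.mul_mem_left _ _ (hC _ _)

lemma movedMat_mul (g : Grp n k) (l m : Fin 2) : movedMat g l * movedMat g m =
    (MvPolynomial.C (((scal g l)⁻¹ : kˣ) : k) * MvPolynomial.C (((scal g m)⁻¹ : kˣ) : k) :
      CoordRing n k) •
    (((g.1⁻¹ : Matrix.GeneralLinearGroup (Fin n) k) : Matrix (Fin n) (Fin n) k).map
      MvPolynomial.C * (genMat n k l * genMat n k m) *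
      (g.1 : Matrix (Fin n) (Fin n) k).map MvPolynomial.C) := by
  have h : (g.1 : Matrix (Fin n) (Fin n) k).map (MvPolynomial.C : k →+* CoordRing n k) *
      ((g.1⁻¹ : Matrix.GeneralLinearGroup (Fin n) k) : Matrix (Fin n) (Fin n) k).map
        (MvPolynomial.C : k →+* CoordRing n k) = 1 := by
    rw [← Matrix.map_mul, ← Units.val_mul, mul_inv_cancel]
    exact Matrix.map_one _ (map_zero _) (map_one _)
  rw [movedMat, movedMat, Matrix.smul_mul, Matrix.mul_smul, smul_smul]
  congr 1
  simp only [Matrix.mul_assoc]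
  rw [← Matrix.mul_assoc (Matrix.map g.1.1 _) (Matrix.map (g.1⁻¹).1 _), h, Matrix.one_mul]

lemma commIdeal_stable (g : Grp n k) (a : CoordRing n k) (ha : a ∈ commIdeal n k) :
    coordAct n k g a ∈ commIdeal n k := by
  change translate g a ∈ commIdeal n k
  suffices h : commIdeal n k ≤ (commIdeal n k).comap (translate g) from h ha
  rw [commIdeal, Ideal.span_le]
  rintro _ ⟨⟨i, j⟩, rfl⟩
  change translate g (commMat n k i j) ∈ commIdeal n k
  have h1 : (commMat n k).map (translate g) =
      movedMat g 0 * movedMat g 1 - movedMat g 1 * movedMat g 0 := by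
    rw [← map_genMat, ← map_genMat, ← Matrix.map_mul, ← Matrix.map_mul, commMat]
    exact Matrix.map_sub _ (map_sub _) _ _
  have h2 := congrFun (congrFun h1 i) j
  rw [Matrix.map_apply] at h2
  rw [h2, movedMat_mul, movedMat_mul, mul_comm (MvPolynomial.C (((scal g 1)⁻¹ : kˣ) : k)),
    ← smul_sub, ← Matrix.sub_mul, ← Matrix.mul_sub, Matrix.smul_apply]
  refine Ideal.mul_mem_left _ _ (map_mul_map _ _ _ _ ?_ i j)
  exact fun i j => Ideal.subset_span ⟨(i, j), rfl⟩

lemma originIdeal_stable (g : Grp n k) (a : CoordRing n k) (ha : a ∈ originIdeal n k) :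
    coordAct n k g a ∈ originIdeal n k := by
  have h : (MvPolynomial.aeval (fun _ => 0) : CoordRing n k →ₐ[k] k).comp (translate g) =
      MvPolynomial.aeval (fun _ => 0) := by
    apply MvPolynomial.algHom_ext
    rintro ⟨l, i, j⟩
    rw [AlgHom.comp_apply, translate, MvPolynomial.aeval_X, MvPolynomial.aeval_X]
    change movedMat g l i j ∈ originIdeal n k
    refine Ideal.mul_mem_left _ _ (map_mul_map _ _ _ _ ?_ i j)
    intro i j
    simp [originIdeal, genMat, RingHom.mem_ker]
  exact (DFunLike.congr_fun h a).trans ha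

variable (n k)

/-- The action of `GL_n × G_m × G_m` on functions on `Comm_n`. -/
noncomputable def commAct : Grp n k →* (CommVar n k →ₐ[k] CommVar n k) where
  toFun g := Ideal.quotientMapₐ _ (coordAct n k g) (fun a ha => commIdeal_stable g a ha)
  map_one' := by
    apply Ideal.Quotient.algHom_ext
    ext x
    simp
  map_mul' g g' := by
    apply Ideal.Quotient.algHom_ext
    refine AlgHom.ext fun x => ?_
    change Ideal.Quotient.mk _ (coordAct n k (g * g') x) =
      Ideal.Quotient.mk _ (coordAct n k g (coordAct n k g' x))
    rw [map_mul]
    rfl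

/-- The push-forward `p_* : K^G(Comm_n) → K^G(gl_n ⊕ gl_n)`. -/
noncomputable def pushComm : EqK (commAct n k) →+ EqK (coordAct n k) :=
  pushK (Ideal.Quotient.mkₐ k (commIdeal n k)) (Ideal.Quotient.mkₐ_surjective k _)
    (fun _ _ => rfl)

/-- `φ` is the pull-back `r₀^* : K^G(gl_n ⊕ gl_n) → K^G(pt)` to the origin. -/
def IsOriginPullback (φ : EqK (coordAct n k) →+ RepGroup n k) : Prop :=
  IsGysin (act := coordAct n k) (J := originIdeal n k) originIdeal_stable φ

end Spaces

/-! ### Characters: `K^G(pt)` as symmetric Laurent polynomials -/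

section Character

variable {n : ℕ} {k : Type u} [Field k]

/-- The character lattice `ℤⁿ × ℤ × ℤ` of the maximal torus `T_n × G_m × G_m`. -/
abbrev Wt (n : ℕ) : Type := (Fin n → ℤ) × ℤ × ℤ

/-- The inclusion of the `k`-points of `T_n × G_m × G_m` in those of `GL_n × G_m × G_m`. -/
def torus (n : ℕ) (k : Type u) [Field k] : (Fin n → kˣ) × kˣ × kˣ →* Grp n k where
  toFun t := (Units.map (Matrix.diagonalRingHom (Fin n) k).toMonoidHom
    (MulEquiv.piUnits.symm t.1), t.2)
  map_one' := by simp
  map_mul' s t := by simp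

/-- The character `∏ᵢ tᵢ^{aᵢ} · t₁^b · t₂^c` of the torus attached to the weight `(a, b, c)`. -/
def wtChar (k : Type u) [Field k] (w : Wt n) : (Fin n → kˣ) × kˣ × kˣ →* k where
  toFun t := (((∏ i, t.1 i ^ w.1 i) * t.2.1 ^ w.2.1 * t.2.2 ^ w.2.2 : kˣ) : k)
  map_one' := by simp
  map_mul' s t := by
    simp only [Prod.fst_mul, Prod.snd_mul, Pi.mul_apply, mul_zpow, Finset.prod_mul_distrib]
    push_cast
    ring

/-- The weight space of weight `w` of a representation. -/
def wtSpace {V : Type u} [AddCommGroup V] [Module k V] (ρ : Representation k (Grp n k) V)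
    (w : Wt n) : Submodule k V where
  carrier := {v | ∀ t, ρ (torus n k t) v = wtChar k w t • v}
  add_mem' := fun {x y} hx hy t => by rw [map_add, hx t, hy t, smul_add]
  zero_mem' := fun t => by simp
  smul_mem' := fun c x hx t => by rw [map_smul, hx t, smul_comm]

lemma wtChar_add (v w : Wt n) (t : (Fin n → kˣ) × kˣ × kˣ) :
    wtChar k (v + w) t = wtChar k v t * wtChar k w t := by
  simp only [wtChar, MonoidHom.coe_mk, OneHom.coe_mk, Prod.fst_add, Prod.snd_add, Pi.add_apply,
    zpow_add, Finset.prod_mul_distrib]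
  push_cast
  ring

lemma wtChar_zero : (wtChar k (0 : Wt n) : _ → k) = 1 := by
  ext t
  simp [wtChar]

lemma zpow_eq_one_forall [Infinite k] (a : ℤ) (h : ∀ x : kˣ, x ^ a = 1) : a = 0 := by
  by_contra ha
  have hpos : 0 < a.natAbs := Int.natAbs_pos.2 ha
  have h2 : ∀ x : kˣ, x ^ a.natAbs = 1 := by
    intro x
    rcases Int.natAbs_eq a with h' | h'
    · rw [← zpow_natCast, ← h', h]
    · rw [← zpow_natCast, ← inv_inj, ← zpow_neg, ← h', h, inv_one]
  have hfin : (Set.univ : Set k).Finite := by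
    classical
    refine ((Polynomial.nthRoots a.natAbs (1 : k)).toFinset.finite_toSet.union
      (Set.finite_singleton (0 : k))).subset fun x _ => ?_
    by_cases hx : x = 0
    · exact Or.inr hx
    · left
      have := congrArg Units.val (h2 (Units.mk0 x hx))
      simpa [Polynomial.mem_nthRoots hpos] using this
  exact Set.infinite_univ hfin

lemma wtChar_injective [Infinite k] :
    Function.Injective (fun w : Wt n => (wtChar k w : (Fin n → kˣ) × kˣ × kˣ →* k)) := by
  intro v w h
  have h0 : ∀ t, wtChar k v t = wtChar k w t := fun t => DFunLike.congr_fun h t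
  have key : ∀ (a b : ℤ), (∀ x : kˣ, x ^ a = x ^ b) → a = b := fun a b hab =>
    sub_eq_zero.1 (zpow_eq_one_forall (k := k) (a - b) fun x => by
      rw [zpow_sub, hab, mul_inv_cancel])
  refine Prod.ext (funext fun i => key _ _ fun x => ?_) (Prod.ext (key _ _ fun x => ?_)
    (key _ _ fun x => ?_))
  · have := h0 (Pi.mulSingle i x, 1, 1)
    simp only [wtChar, MonoidHom.coe_mk, OneHom.coe_mk, one_zpow, mul_one, Units.val_inj] at this
    rw [Finset.prod_eq_single i (by intro j _ hj; simp [Pi.mulSingle_eq_of_ne hj]) (by simp),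
      Finset.prod_eq_single i (by intro j _ hj; simp [Pi.mulSingle_eq_of_ne hj]) (by simp)] at this
    simpa using this
  · have := h0 (1, x, 1)
    simpa [wtChar, -Units.val_zpow_eq_zpow_val, -Units.val_mul, Units.val_inj] using this
  · have := h0 (1, 1, x)
    simpa [wtChar, -Units.val_zpow_eq_zpow_val, -Units.val_mul, Units.val_inj] using this

/-- Distinct characters are linearly independent, also with vector coefficients. -/
lemma wt_indep [Infinite k] {V : Type u} [AddCommGroup V] [Module k V] (s : Finset (Wt n))
    (u : Wt n → V) (h : ∀ t, ∑ w ∈ s, wtChar k w t • u w = 0) : ∀ w ∈ s, u w = 0 := by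
  intro w hw
  rw [← Module.forall_dual_apply_eq_zero_iff k]
  intro φ
  have hli := (linearIndependent_monoidHom ((Fin n → kˣ) × kˣ × kˣ) k).comp _
    (wtChar_injective (n := n) (k := k))
  refine linearIndependent_iff'.1 hli s (fun w => φ (u w)) ?_ w hw
  funext t
  have := congrArg φ (h t)
  simp only [map_sum, map_smul, smul_eq_mul, map_zero] at this
  simp only [Function.comp_apply, Finset.sum_apply, Pi.smul_apply, smul_eq_mul, Pi.zero_apply]
  rw [← this]
  exact Finset.sum_congr rfl fun w _ => mul_comm _ _

/-- Regular functions on `G` restrict to Laurent polynomials on the torus. -/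
lemma regular_torus (f : Grp n k → k) (hf : f ∈ regularFunctions n k) :
    f ∘ torus n k ∈ Submodule.span k (Set.range fun w : Wt n => (wtChar k w : _ → k)) := by
  have hmul : ∀ x y : (Fin n → kˣ) × kˣ × kˣ → k,
      x ∈ Submodule.span k (Set.range fun w : Wt n => (wtChar k w : _ → k)) →
      y ∈ Submodule.span k (Set.range fun w : Wt n => (wtChar k w : _ → k)) →
      x * y ∈ Submodule.span k (Set.range fun w : Wt n => (wtChar k w : _ → k)) := by
    intro x y hx hy
    have h := Submodule.mul_mem_mul hx hy
    rw [Submodule.span_mul_span] at h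
    refine Submodule.span_mono ?_ h
    rintro _ ⟨_, ⟨v, rfl⟩, _, ⟨w, rfl⟩, rfl⟩
    exact ⟨v + w, funext fun t => wtChar_add v w t⟩
  have hone : (1 : (Fin n → kˣ) × kˣ × kˣ → k) ∈
      Submodule.span k (Set.range fun w : Wt n => (wtChar k w : _ → k)) :=
    Submodule.subset_span ⟨0, wtChar_zero⟩
  induction hf using Algebra.adjoin_induction with
  | mem x hx =>
    rcases hx with ⟨i, j, rfl⟩ | ⟨i, j, rfl⟩ | ⟨l, rfl⟩ | ⟨l, rfl⟩
    · by_cases hij : i = j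
      · subst hij
        refine Submodule.subset_span ⟨(Pi.single i 1, 0, 0), funext fun t => ?_⟩
        simp [wtChar, torus, Pi.single_apply]
      · convert Submodule.zero_mem _
        funext t
        simp [torus, hij]
    · by_cases hij : i = j
      · subst hij
        refine Submodule.subset_span ⟨(Pi.single i (-1), 0, 0), funext fun t => ?_⟩
        have : ((torus n k t).1⁻¹ : Matrix.GeneralLinearGroup (Fin n) k) = (torus n k t⁻¹).1 := by
          rw [map_inv]; rfl
        simp only [Function.comp_apply, this]
        simp [wtChar, torus, Pi.single_apply]
      · convert Submodule.zero_mem _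
        funext t
        have : ((torus n k t).1⁻¹ : Matrix.GeneralLinearGroup (Fin n) k) = (torus n k t⁻¹).1 := by
          rw [map_inv]; rfl
        simp only [Function.comp_apply, this]
        simp [torus, hij]
    · refine Submodule.subset_span ⟨(0, if l = 0 then 1 else 0, if l = 0 then 0 else 1),
        funext fun t => ?_⟩
      by_cases hl : l = 0 <;> simp [wtChar, torus, scal, hl]
    · refine Submodule.subset_span ⟨(0, if l = 0 then -1 else 0, if l = 0 then 0 else -1),
        funext fun t => ?_⟩
      by_cases hl : l = 0 <;> simp [wtChar, torus, scal, hl]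
  | algebraMap r =>
    have := Submodule.smul_mem _ r hone
    convert this using 1
    funext t
    simp [Algebra.algebraMap_eq_smul_one]
  | add x y _ _ hx hy => exact Submodule.add_mem _ hx hy
  | mul x y _ _ hx hy => exact hmul _ _ hx hy

/-- Every vector of a rational representation is a sum of weight vectors. -/
lemma exists_wt_decomp [Infinite k] {V : Type u} [AddCommGroup V] [Module k V]
    {ρ : Representation k (Grp n k) V} (hρ : IsRational ρ) (v : V) :
    ∃ (s : Finset (Wt n)) (u : Wt n → V), (∀ w ∈ s, u w ∈ wtSpace ρ w) ∧ v = ∑ w ∈ s, u w := by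
  obtain ⟨m, f, w, hf, hv⟩ := hρ v
  have h1 : ∀ i, ∃ c : Wt n →₀ k, ∀ t, f i (torus n k t) = c.sum fun a r => r * wtChar k a t := by
    intro i
    obtain ⟨c, hc⟩ := (Finsupp.mem_span_range_iff_exists_finsupp).1 (regular_torus (f i) (hf i))
    refine ⟨c, fun t => ?_⟩
    have := congrFun hc t
    rw [Function.comp_apply] at this
    rw [← this, Finsupp.sum, Finsupp.sum, Finset.sum_apply]
    rfl
  choose c hc using h1
  classical
  let s : Finset (Wt n) := Finset.univ.biUnion fun i => (c i).support
  let u : Wt n → V := fun a => ∑ i, c i a • w i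
  have h2 : ∀ t, ρ (torus n k t) v = ∑ a ∈ s, wtChar k a t • u a := by
    intro t
    rw [hv]
    simp only [u, Finset.smul_sum]
    rw [Finset.sum_comm]
    refine Finset.sum_congr rfl fun i _ => ?_
    rw [hc, Finsupp.sum, Finset.sum_smul]
    refine Finset.sum_subset_zero_on_sdiff (Finset.subset_biUnion_of_mem (fun i => (c i).support)
      (Finset.mem_univ i)) ?_ ?_
    · intro a ha
      have : c i a = 0 := by simpa using (Finset.mem_sdiff.1 ha).2
      simp [this]
    · intro a _
      rw [smul_smul, mul_comm]
  refine ⟨s, u, ?_, ?_⟩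
  · intro a ha t
    have h3 : ∀ a ∈ s, ρ (torus n k t) (u a) - wtChar k a t • u a = 0 := by
      refine wt_indep (k := k) s
        (fun a => ρ (torus n k t) (u a) - wtChar k a t • u a) fun r => ?_
      have e1 : ρ (torus n k (t * r)) v = ρ (torus n k t) (ρ (torus n k r) v) := by
        rw [map_mul, map_mul]; rfl
      rw [h2, h2, map_sum] at e1
      simp only [smul_sub, Finset.sum_sub_distrib]
      rw [sub_eq_zero]
      simp only [map_smul] at e1
      rw [← e1]
      refine Finset.sum_congr rfl fun a _ => ?_
      rw [map_mul, smul_smul, mul_comm]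
    exact sub_eq_zero.1 (h3 a ha)
  · have := h2 1
    simp only [map_one, one_smul] at this
    exact this

/-- Only finitely many weights occur. -/
lemma finite_weights [Infinite k] (V : RatRep n k) :
    (Function.support fun w : Wt n => (Module.finrank k (wtSpace V.ρ w) : ℤ)).Finite := by
  classical
  have h1 : ∀ w : Function.support fun w : Wt n => (Module.finrank k (wtSpace V.ρ w) : ℤ),
      ∃ v : V.carrier, v ∈ wtSpace V.ρ w ∧ v ≠ 0 := by
    rintro ⟨w, hw⟩
    refine Submodule.exists_mem_ne_zero_of_ne_bot fun h => hw ?_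
    simp [h]
  choose v hv hv0 using h1
  have hli : LinearIndependent k v := by
    rw [linearIndependent_iff']
    intro s g hg w hw
    let u : Wt n → V.carrier := fun a => if h : a ∈ Function.support fun w : Wt n =>
      (Module.finrank k (wtSpace V.ρ w) : ℤ) then g ⟨a, h⟩ • v ⟨a, h⟩ else 0
    have hu : ∀ a, u a.1 = g a • v a := fun a => dif_pos a.2
    have := wt_indep (k := k) (s.map (Function.Embedding.subtype _)) u (fun t => by
      rw [Finset.sum_map]
      have := congrArg (V.ρ (torus n k t)) hg
      rw [map_sum, map_zero] at this
      rw [← this]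
      refine Finset.sum_congr rfl fun a _ => ?_
      rw [map_smul, hv a t, smul_comm]
      exact congrArg _ (hu a)) w.1 (Finset.mem_map.2 ⟨w, hw, rfl⟩)
    rw [hu] at this
    exact (smul_eq_zero.1 this).resolve_right (hv0 w)
  have := hli.finite
  exact Set.toFinite _

/-- The Laurent polynomial ring `ℤ[q₁^{±1}, q₂^{±1}][z₁^{±1}, …, z_n^{±1}]`, as the group ring of
the character lattice of `T_n × G_m × G_m`. -/
abbrev Laurent (n : ℕ) : Type := AddMonoidAlgebra ℤ (Wt n)

/-- The character `∑_w dim(V_w) e^w` of a representation. -/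
noncomputable def RatRep.ch [Infinite k] (V : RatRep n k) : Laurent n :=
  AddMonoidAlgebra.ofCoeff (Finsupp.ofSupportFinite
    (fun w : Wt n => (Module.finrank k (wtSpace V.ρ w) : ℤ)) (finite_weights V))

lemma RatRep.ch_add [Infinite k] {V' V V'' : RatRep n k} (h : RatRep.ShortExact V' V V'') :
    V.ch = V'.ch + V''.ch := by
  obtain ⟨i, p, hi, hp, hinj, hex, hsurj⟩ := h
  apply AddMonoidAlgebra.coeff_injective
  ext w
  change (Module.finrank k (wtSpace V.ρ w) : ℤ) =
    (Module.finrank k (wtSpace V'.ρ w) : ℤ) + (Module.finrank k (wtSpace V''.ρ w) : ℤ)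
  have hpm : ∀ (a : Wt n) (x : V.carrier), x ∈ wtSpace V.ρ a → p x ∈ wtSpace V''.ρ a :=
    fun a x hx t => by rw [← hp, hx t, map_smul]
  have him : ∀ x ∈ wtSpace V'.ρ w, i x ∈ wtSpace V.ρ w :=
    fun x hx t => by rw [← hi, hx t, map_smul]
  let pw : wtSpace V.ρ w →ₗ[k] wtSpace V''.ρ w := p.restrict (hpm w)
  let iw : wtSpace V'.ρ w →ₗ[k] wtSpace V.ρ w := i.restrict him
  have hpw : Function.Surjective pw := by
    rintro ⟨y, hy⟩
    obtain ⟨x, rfl⟩ := hsurj y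
    obtain ⟨s, u, hu, rfl⟩ := exists_wt_decomp V.rational x
    classical
    by_cases hw : w ∈ s
    · refine ⟨⟨u w, hu w hw⟩, Subtype.ext ?_⟩
      change p (u w) = p (∑ a ∈ s, u a)
      have h0 := wt_indep (k := k) s
        (fun a => p (u a) - if a = w then p (∑ a ∈ s, u a) else 0) (fun t => by
          simp only [smul_sub, Finset.sum_sub_distrib, smul_ite, smul_zero,
            Finset.sum_ite_eq' s w, if_pos hw]
          rw [← hy t, map_sum, map_sum, sub_eq_zero]
          exact Finset.sum_congr rfl fun a ha => (hpm a _ (hu a ha) t).symm) w hw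
      simpa [sub_eq_zero] using h0
    · have h0 : p (∑ a ∈ s, u a) = 0 := by
        have := wt_indep (k := k) (insert w s)
          (fun a => if a = w then p (∑ a ∈ s, u a) else - p (u a)) (fun t => by
            rw [Finset.sum_insert hw, if_pos rfl, ← hy t, map_sum, map_sum,
              ← Finset.sum_add_distrib]
            refine Finset.sum_eq_zero fun a ha => ?_
            have : a ≠ w := fun h => hw (h ▸ ha)
            rw [if_neg this, hpm a _ (hu a ha) t, smul_neg, add_neg_cancel]) w
            (Finset.mem_insert_self _ _)
        simpa using this
      exact ⟨0, Subtype.ext (by rw [map_zero]; exact h0.symm)⟩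
  have hiw : Function.Injective iw := fun x y hxy =>
    Subtype.ext (hinj (congrArg Subtype.val hxy))
  have hrange : LinearMap.range iw = LinearMap.ker pw := by
    ext x
    constructor
    · rintro ⟨y, rfl⟩
      exact Subtype.ext ((hex _).2 ⟨y.1, rfl⟩)
    · intro hx
      obtain ⟨y, hy⟩ := (hex x.1).1 (congrArg Subtype.val hx)
      refine ⟨⟨y, fun t => hinj ?_⟩, Subtype.ext hy⟩
      rw [hi, map_smul, hy, x.2 t]
  have e1 := LinearMap.finrank_range_add_finrank_ker pw
  rw [LinearMap.range_eq_top.2 hpw, finrank_top, ← hrange,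
    LinearMap.finrank_range_of_inj hiw] at e1
  omega

/-- The character homomorphism `K^G(pt) → ℤ[q₁^{±1}, q₂^{±1}][z₁^{±1}, …, z_n^{±1}]`, which
identifies `K^G(pt)` with the symmetric Laurent polynomials. -/
noncomputable def charHom (n : ℕ) (k : Type u) [Field k] [Infinite k] : RepGroup n k →+ Laurent n :=
  QuotientAddGroup.lift _ (FreeAbelianGroup.lift fun V : RatRep n k => V.ch) (by
    rw [AddSubgroup.closure_le]
    rintro x ⟨V', V, V'', h, rfl⟩
    simp [RatRep.ch_add h])

end Character

/-! ### The wheel ideal -/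

section Wheel

variable (n : ℕ)

/-- The variable `z_i`, the character `t ↦ t_i` of `T_n`. -/
noncomputable def zVar {n : ℕ} (i : Fin n) : Laurent n :=
  AddMonoidAlgebra.single (Pi.single i 1, 0, 0) 1

/-- The variable `q₁`. -/
noncomputable def q₁ : Laurent n := AddMonoidAlgebra.single (0, 1, 0) 1

/-- The variable `q₂`. -/
noncomputable def q₂ : Laurent n := AddMonoidAlgebra.single (0, 0, 1) 1

/-- The ideal `I_n`: the intersection of the ideals `(z_k - q₂ z_j, z_j - q₁ z_i)` over all
triples of distinct indices. -/
noncomputable def wheelIdeal : Ideal (Laurent n) :=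
  ⨅ (i : Fin n) (j : Fin n) (l : Fin n) (_ : i ≠ j ∧ j ≠ l ∧ i ≠ l),
    Ideal.span {zVar l - q₂ n * zVar j, zVar j - q₁ n * zVar i}

/-- The permutation action of `S_n` on Laurent polynomials, with `z_i ↦ z_{σ i}`. -/
noncomputable def permVars (σ : Equiv.Perm (Fin n)) : Laurent n →+ Laurent n :=
  (AddMonoidAlgebra.mapDomainRingHom ℤ
    (AddMonoidHom.prodMap (LinearMap.funLeft ℤ ℤ σ.symm).toAddMonoidHom
      (AddMonoidHom.id (ℤ × ℤ)))).toAddMonoidHom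

lemma permVars_zVar (σ : Equiv.Perm (Fin n)) (i : Fin n) :
    permVars n σ (zVar i) = zVar (σ i) := by
  simp only [permVars, zVar]
  change AddMonoidAlgebra.mapDomain _ _ = _
  rw [AddMonoidAlgebra.mapDomain_single]
  congr 1
  refine Prod.ext (funext fun j => ?_) rfl
  simp [LinearMap.funLeft, Pi.single_apply, Equiv.symm_apply_eq]

/-- The symmetric part `I_n^{Sym}` of `I_n`. -/
noncomputable def wheelIdealSym : AddSubgroup (Laurent n) where
  carrier := {f | f ∈ wheelIdeal n ∧ ∀ σ, permVars n σ f = f}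
  add_mem' := fun {x y} hx hy => ⟨Ideal.add_mem _ hx.1 hy.1, fun σ => by
    rw [map_add, hx.2, hy.2]⟩
  zero_mem' := ⟨Ideal.zero_mem _, fun σ => map_zero _⟩
  neg_mem' := fun {x} hx => ⟨neg_mem hx.1, fun σ => by rw [map_neg, hx.2]⟩

end Wheel

end WheelComm

namespace WheelComm

/-! ### Finiteness of the homology of `P / J P` -/

section Koszul

/-! Let `F` be an equivariant coherent sheaf on `gl_n ⊕ gl_n`. Every coordinate function has degree
one for a suitable one-parameter subgroup of the two factors `G_m`, so the weight spaces of `F` are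
finite dimensional and the degrees of its weights are bounded below. Thus `F` has a character `chr
F.ρ ⊤`, a function on the weight lattice with possibly infinite support, on which Laurent
polynomials act by convolution (`conv`). The Koszul identity `EqCoh.coeff_charHom_eulerTor` says
that the character of `∑ (-1)ⁱ Tor_i(k, F)` is `∏ (1 - e^c) * chr F`, with `c` running over the
weights of all coordinate functions.

Let `F` be killed by the entries of `XY - YX`, and fix `i ≠ j` and `l`. For a homogeneous
subquotient `N'/N` of `F` and a coordinate `a` of weight `c`, rank and nullity for multiplication by
`a` give `(1 - e^c) ch(N'/N) = ch(coker a) - e^c ch(ker a)`, and `a` kills both the kernel and the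
cokernel (`CharMem.insert`). This reduces the claim to subquotients killed by all coordinates except
`X_ij` and `Y_jl`. On these the `(i, l)` entry of `XY - YX` acts as `X_ij Y_jl`, hence `X_ij Y_jl =
0`. The image of `X_ij` is then killed by `Y_jl`, and the quotient by it is killed by `X_ij`, so the
remaining product has the form `(1 - z_j/(q₁ z_i)) f + (1 - z_l/(q₂ z_j)) g` with Laurent
polynomials `f` and `g` (`charMem_pair`). Both factors lie in the ideal `(z_l - q₂ z_j, z_j - q₁
z_i)`. Symmetry holds for every representation, because permutation matrices permute the weight
spaces.

The Gysin map itself also has to be constructed. The standard resolution `P` is functorial and exact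
in the sheaf, but its terms are not finitely generated in general. Finiteness and vanishing of `Tor`
come from adjoining the coordinates to `J` one at a time in `P / J P` (`relFG_cyc_bdry`). Additivity
on short exact sequences comes from the long exact homology sequence, in the form of two identities
between classes of subquotients (`clq_add_defect`, `clq_connecting`) whose alternating sum
telescopes. -/

lemma mem_smul_top_iff_repr {A M ι : Type*} [CommRing A] [AddCommGroup M] [Module A M]
    (b : Module.Basis ι A M) (I : Ideal A) (p : M) :
    p ∈ (I • ⊤ : Submodule A M) ↔ ∀ i, b.repr p i ∈ I := by
  constructor
  · intro hp i
    induction hp using Submodule.smul_induction_on' with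
    | smul a ha m _ => simpa using I.mul_mem_right _ ha
    | add x _ y _ hx hy => simpa using I.add_mem hx hy
  · intro h
    rw [← b.linearCombination_repr p, Finsupp.linearCombination_apply]
    exact Submodule.sum_mem _ fun i _ => Submodule.smul_mem_smul (h i) trivial

/-- A variable outside `s` is a nonzerodivisor modulo the ideal generated by the variables in `s`,
on every free module. -/
lemma mem_of_X_smul_mem {σ k M : Type*} [CommRing k] [AddCommGroup M]
    [Module (MvPolynomial σ k) M] [Module.Free (MvPolynomial σ k) M] {s : Set σ} {a : σ}
    (ha : a ∉ s) {p : M}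
    (hp : (MvPolynomial.X a : MvPolynomial σ k) • p ∈
      (Ideal.span (MvPolynomial.X '' s : Set (MvPolynomial σ k)) • ⊤ : Submodule (MvPolynomial σ k) M)) :
    p ∈ (Ideal.span (MvPolynomial.X '' s : Set (MvPolynomial σ k)) • ⊤ : Submodule (MvPolynomial σ k) M) := by
  classical
  have b : Module.Basis _ (MvPolynomial σ k) M := Module.Free.chooseBasis (MvPolynomial σ k) M
  rw [mem_smul_top_iff_repr b] at hp ⊢
  intro i
  have h := hp i
  rw [map_smul, Finsupp.smul_apply, smul_eq_mul, MvPolynomial.mem_ideal_span_X_image] at h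
  rw [MvPolynomial.mem_ideal_span_X_image]
  intro m hm
  -- A monomial `m` of a coefficient of `p` reappears as `m + a` after multiplication by `X a`. A
  -- variable of `s` dividing the latter differs from `a`, hence divides `m`.
  have hm' : m + Finsupp.single a 1 ∈
      ((MvPolynomial.X a : MvPolynomial σ k) * b.repr p i).support := by
    rw [MvPolynomial.mem_support_iff] at hm ⊢
    rwa [mul_comm, MvPolynomial.coeff_mul_X]
  obtain ⟨j, hj, hne⟩ := h _ hm'
  refine ⟨j, hj, ?_⟩
  have : a ≠ j := fun h => ha (h ▸ hj)
  simpa [Finsupp.single_apply, this] using hne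

variable {A : Type*} [CommRing A] {P : ℕ → Type*} [∀ i, AddCommGroup (P i)]
  [∀ i, Module A (P i)] (d : ∀ i, P (i + 1) →ₗ[A] P i)

/-- The cycles of the complex `P / J P`, as a submodule of `P i`. -/
def cyc (J : Ideal A) : ∀ i, Submodule A (P i)
  | 0 => ⊤
  | i + 1 => (J • ⊤ : Submodule A (P i)).comap (d i)

/-- The boundaries of the complex `P / J P`, as a submodule of `P i`. -/
def bdry (J : Ideal A) (i : ℕ) : Submodule A (P i) := J • ⊤ ⊔ LinearMap.range (d i)

/-- `N'` is finitely generated modulo `N`. -/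
def RelFG {R M : Type*} [Ring R] [AddCommGroup M] [Module R M] (N' N : Submodule R M) : Prop :=
  ∃ S : Submodule R M, S.FG ∧ N' ≤ S ⊔ N

/-- Intersecting the finitely generated `S` with `K` stays finitely generated by Noetherianity,
although the ambient module need not be. This is how an intermediate `N ≤ K ≤ N'` inherits finite
generation modulo `N`. -/
lemma RelFG.exists_span [IsNoetherianRing A] {M : Type*} [AddCommGroup M] [Module A M]
    {N' N K : Submodule A M} (h : RelFG N' N) (hNK : N ≤ K) (hK : K ≤ N') :
    ∃ t : Finset M, (∀ y ∈ t, y ∈ K) ∧ K ≤ Submodule.span A t ⊔ N := by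
  obtain ⟨S, hS, hle⟩ := h
  have h1 : (S ⊓ K).FG := hS.of_le inf_le_left
  obtain ⟨t, ht⟩ := h1
  refine ⟨t, fun y hy => ?_, ?_⟩
  · have : y ∈ S ⊓ K := ht ▸ Submodule.subset_span hy
    exact this.2
  · rw [ht]
    intro x hx
    obtain ⟨y, hy, z, hz, rfl⟩ := Submodule.mem_sup.1 (hle (hK hx))
    refine Submodule.add_mem_sup ⟨hy, ?_⟩ hz
    simpa using K.sub_mem hx (hNK hz)

variable {d}

lemma smul_top_le_cyc (J : Ideal A) (i : ℕ) : (J • ⊤ : Submodule A (P i)) ≤ cyc d J i := by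
  cases i with
  | zero => exact le_top
  | succ i =>
    rw [Submodule.smul_le]
    intro a ha n _
    change d i (a • n) ∈ (J • ⊤ : Submodule A (P i))
    rw [map_smul]
    exact Submodule.smul_mem_smul ha trivial

lemma bdry_le_cyc (hd : ∀ i x, d i (d (i + 1) x) = 0) (J : Ideal A) (i : ℕ) :
    bdry d J i ≤ cyc d J i := by
  refine sup_le (smul_top_le_cyc J i) ?_
  rintro _ ⟨x, rfl⟩
  cases i with
  | zero => trivial
  | succ i =>
    change d i (d (i + 1) x) ∈ (J • ⊤ : Submodule A (P i))
    rw [hd]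
    exact Submodule.zero_mem _

lemma smul_top_mono {J J' : Ideal A} (h : J ≤ J') (i : ℕ) :
    (J • ⊤ : Submodule A (P i)) ≤ J' • ⊤ := Submodule.smul_mono_left h

lemma mem_sup_span_smul_top {J : Ideal A} {x : A} {M : Type*} [AddCommGroup M] [Module A M]
    {m : M} (hm : m ∈ ((J ⊔ Ideal.span {x}) • ⊤ : Submodule A M)) :
    ∃ j ∈ (J • ⊤ : Submodule A M), ∃ p, m = j + x • p := by
  rw [Submodule.sup_smul, Submodule.ideal_span_singleton_smul] at hm
  obtain ⟨j, hj, q, ⟨p, _, rfl⟩, rfl⟩ := Submodule.mem_sup.1 hm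
  exact ⟨j, hj, p, rfl⟩

/-- The exact sequence `Hᵢ₊₁(P / J P) → Hᵢ₊₁(P / (J, x) P) → Hᵢ(P / J P)` for a nonzerodivisor
`x`, in terms of generators of the last term. -/
lemma cyc_sup_span_le (hd : ∀ i x, d i (d (i + 1) x) = 0) {J : Ideal A} {x : A} (i : ℕ)
    (hreg : ∀ i (p : P i), x • p ∈ (J • ⊤ : Submodule A (P i)) → p ∈ (J • ⊤ : Submodule A (P i)))
    (t : Finset (P i)) (ht : ∀ p ∈ t, x • p ∈ bdry d J i)
    (hK : ∀ p ∈ cyc d J i, x • p ∈ bdry d J i → p ∈ Submodule.span A (t : Set (P i)) ⊔ bdry d J i) :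
    ∃ S : Submodule A (P (i + 1)), S.FG ∧ (t = ∅ → S = ⊥) ∧
      cyc d (J ⊔ Ideal.span {x}) (i + 1) ≤
        S ⊔ cyc d J (i + 1) ⊔ bdry d (J ⊔ Ideal.span {x}) (i + 1) := by
  -- A class `p` of `Hᵢ(P / J P)` killed by `x` lifts along the connecting map: if `x p = d y`
  -- modulo `J`, then `y` is a cycle modulo `(J, x)`.
  have h1 : ∀ p : t, ∃ y, x • p.1 - d i y ∈ (J • ⊤ : Submodule A (P i)) := by
    intro p
    obtain ⟨j, hj, _, ⟨y, rfl⟩, h⟩ := Submodule.mem_sup.1 (ht p.1 p.2)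
    exact ⟨y, by rw [← h]; simpa using hj⟩
  choose y hy using h1
  let S : Submodule A (P (i + 1)) := Submodule.span A (Set.range y)
  have h2 : ∀ p ∈ Submodule.span A (t : Set (P i)),
      ∃ w ∈ S, x • p - d i w ∈ (J • ⊤ : Submodule A (P i)) := by
    intro p hp
    induction hp using Submodule.span_induction with
    | mem p hp => exact ⟨y ⟨p, hp⟩, Submodule.subset_span ⟨_, rfl⟩, hy ⟨p, hp⟩⟩
    | zero => exact ⟨0, S.zero_mem, by simp⟩
    | add p q _ _ hp hq =>
      obtain ⟨v, hv, hv'⟩ := hp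
      obtain ⟨w, hw, hw'⟩ := hq
      refine ⟨v + w, S.add_mem hv hw, ?_⟩
      have := Submodule.add_mem _ hv' hw'
      rwa [show x • (p + q) - d i (v + w) = x • p - d i v + (x • q - d i w) by
        rw [smul_add, map_add]; abel]
    | smul a p _ hp =>
      obtain ⟨v, hv, hv'⟩ := hp
      refine ⟨a • v, S.smul_mem a hv, ?_⟩
      have := Submodule.smul_mem _ a hv'
      rwa [smul_sub, smul_comm a x p, ← map_smul] at this
  refine ⟨S, ⟨(Set.finite_range y).toFinset, by simp [S]⟩, fun h => ?_, ?_⟩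
  · subst h
    have : Set.range y = ∅ := Set.range_eq_empty_iff.2 ⟨fun p => Finset.notMem_empty _ p.2⟩
    simp [S, this]
  intro z hz
  obtain ⟨j, hj, p, hp⟩ := mem_sup_span_smul_top
    (show d i z ∈ ((J ⊔ Ideal.span {x}) • ⊤ : Submodule A (P i)) from hz)
  -- Applying `d` to `d z = j + x p` puts `x • d p` in `J P`, and `x` is regular there.
  have hpZ : p ∈ cyc d J i := by
    cases i with
    | zero => trivial
    | succ i =>
      have h3 := congrArg (d i) hp
      rw [hd, map_add, map_smul] at h3
      refine hreg _ _ ?_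
      rw [← neg_eq_of_add_eq_zero_right h3.symm]
      exact Submodule.neg_mem _ (smul_top_le_cyc (d := d) J (i + 1) hj)
  have hpB : x • p ∈ bdry d J i := by
    rw [show x • p = -j + d i z by rw [hp]; abel]
    exact Submodule.add_mem_sup (Submodule.neg_mem _ hj) ⟨z, rfl⟩
  obtain ⟨q, hq, b, hb, rfl⟩ := Submodule.mem_sup.1 (hK p hpZ hpB)
  obtain ⟨w, hw, hw'⟩ := h2 q hq
  obtain ⟨j', hj', _, ⟨v, rfl⟩, rfl⟩ := Submodule.mem_sup.1 hb
  -- With `p = q + j' + d v` and `x q = d w` modulo `J`, one gets `d z = d (w + x v)` modulo `J`. So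
  -- `z` is a lifted class, a cycle modulo `J`, and the multiple `x v`, which vanishes modulo `(J,
  -- x)`.
  have h4 : z - w - x • v ∈ cyc d J (i + 1) := by
    change d i (z - w - x • v) ∈ (J • ⊤ : Submodule A (P i))
    rw [map_sub, map_sub, map_smul, hp, show j + x • (q + (j' + d i v)) - d i w - x • d i v =
      j + x • j' + (x • q - d i w) by rw [smul_add, smul_add]; abel]
    exact Submodule.add_mem _ (Submodule.add_mem _ hj (Submodule.smul_mem _ _ hj')) hw'
  have h5 : x • v ∈ bdry d (J ⊔ Ideal.span {x}) (i + 1) :=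
    Submodule.mem_sup_left (Submodule.smul_mem_smul
      (Ideal.mem_sup_right (Ideal.mem_span_singleton_self x)) trivial)
  rw [show z = w + (z - w - x • v) + x • v by abel]
  exact Submodule.add_mem_sup (Submodule.add_mem_sup hw h4) h5

lemma bdry_mono {J J' : Ideal A} (h : J ≤ J') (i : ℕ) : bdry d J i ≤ bdry d J' i :=
  sup_le_sup_right (smul_top_mono h i) _

/-- The homology of `P / J P` is finitely generated and vanishes in degrees above the number of
generators of `J`, for `P` a resolution of a finitely generated module by free modules and `J` an
ideal generated by variables. -/
lemma relFG_cyc_bdry {σ k : Type*} [CommRing k] [IsNoetherianRing k] [Finite σ] [DecidableEq σ]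
    {P : ℕ → Type*} [∀ i, AddCommGroup (P i)] [∀ i, Module (MvPolynomial σ k) (P i)]
    [∀ i, Module.Free (MvPolynomial σ k) (P i)] {d : ∀ i, P (i + 1) →ₗ[MvPolynomial σ k] P i}
    (hex : ∀ i, Function.Exact (d (i + 1)) (d i)) (h0 : RelFG ⊤ (LinearMap.range (d 0)))
    (s : Finset σ) : ∀ i,
      RelFG (cyc d (Ideal.span (MvPolynomial.X '' (s : Set σ))) i)
        (bdry d (Ideal.span (MvPolynomial.X '' (s : Set σ))) i) ∧
      (s.card < i → cyc d (Ideal.span (MvPolynomial.X '' (s : Set σ))) i ≤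
        bdry d (Ideal.span (MvPolynomial.X '' (s : Set σ))) i) := by
  have hd : ∀ i x, d i (d (i + 1) x) = 0 := fun i x => (hex i).apply_apply_eq_zero x
  induction s using Finset.induction_on with
  | empty =>
    intro i
    cases i with
    | zero =>
      obtain ⟨S, hS, hle⟩ := h0
      exact ⟨⟨S, hS, hle.trans (sup_le_sup_left le_sup_right _)⟩, fun h => by simp at h⟩
    | succ i =>
      -- For `J = 0` this is exactness of the resolution in positive degrees.
      have : cyc d (Ideal.span (MvPolynomial.X '' ((∅ : Finset σ) : Set σ))) (i + 1) ≤
          bdry d (Ideal.span (MvPolynomial.X '' ((∅ : Finset σ) : Set σ))) (i + 1) := by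
        intro z hz
        have hz' : d i z = 0 := by
          simpa [cyc] using hz
        exact Submodule.mem_sup_right ((hex i z).1 hz')
      exact ⟨⟨⊥, Submodule.fg_bot, this.trans le_sup_right⟩, fun _ => this⟩
  | insert a s ha ih =>
    set J : Ideal (MvPolynomial σ k) := Ideal.span (MvPolynomial.X '' (s : Set σ)) with hJ
    have hJ' : Ideal.span (MvPolynomial.X '' ((insert a s : Finset σ) : Set σ)) =
        J ⊔ Ideal.span {(MvPolynomial.X a : MvPolynomial σ k)} := by
      rw [Finset.coe_insert, Set.image_insert_eq, Ideal.span_insert, sup_comm]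
    rw [hJ']
    have hreg : ∀ i (p : P i), (MvPolynomial.X a : MvPolynomial σ k) • p ∈
        (J • ⊤ : Submodule _ (P i)) → p ∈ (J • ⊤ : Submodule _ (P i)) :=
      fun i p hp => mem_of_X_smul_mem (fun h => ha (by simpa using h)) hp
    intro i
    cases i with
    | zero =>
      obtain ⟨S, hS, hle⟩ := (ih 0).1
      exact ⟨⟨S, hS, hle.trans (sup_le_sup_left (bdry_mono le_sup_left 0) _)⟩,
        fun h => by simp at h⟩
    | succ i =>
      constructor
      -- Here `K` represents the classes in `Hᵢ(P / J P)` annihilated by `X a`, the target of the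
      -- connecting map.
      · obtain ⟨t, ht, hle⟩ := (ih i).1.exists_span
          (K := cyc d J i ⊓ (bdry d J i).comap
            (LinearMap.lsmul (MvPolynomial σ k) (P i) (MvPolynomial.X a)))
          (le_inf (bdry_le_cyc hd J i) fun b hb => (bdry d J i).smul_mem _ hb) inf_le_left
        obtain ⟨S, hS, -, hS'⟩ := cyc_sup_span_le hd i hreg t (fun p hp => (ht p hp).2)
          (fun p hp hp' => hle ⟨hp, hp'⟩)
        obtain ⟨S', hS1, hS2⟩ := (ih (i + 1)).1
        refine ⟨S ⊔ S', hS.sup hS1, hS'.trans (sup_le (sup_le ?_ ?_) le_sup_right)⟩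
        · exact le_sup_left.trans le_sup_left
        · exact hS2.trans (sup_le_sup le_sup_right (bdry_mono le_sup_left _))
      · intro hi
        rw [Finset.card_insert_of_notMem ha] at hi
        -- Since `s.card < i`, both `Hᵢ` and `Hᵢ₊₁` of `P / J P` vanish, so no lifted classes are
        -- needed and `t = ∅` works.
        have hB := (ih i).2 (by omega)
        obtain ⟨S, -, hS, hS'⟩ := cyc_sup_span_le hd i hreg ∅ (by simp)
          (fun p hp _ => Submodule.mem_sup_right (hB hp))
        rw [hS rfl, bot_sup_eq] at hS'
        refine hS'.trans (sup_le ?_ le_rfl)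
        exact ((ih (i + 1)).2 (by omega)).trans (bdry_mono le_sup_left _)

end Koszul

/-! ### Rational representations and their subquotients -/

section Rational

variable {n : ℕ} {k : Type u} [Field k] {V W : Type u} [AddCommGroup V] [Module k V]
  [AddCommGroup W] [Module k W] {ρ : Representation k (Grp n k) V}
  {σ : Representation k (Grp n k) W}

lemma IsRational.of_finset {v : V} {ι : Type*} (s : Finset ι) (f : ι → Grp n k → k) (w : ι → V)
    (hf : ∀ i ∈ s, f i ∈ regularFunctions n k) (h : ∀ g, ρ g v = ∑ i ∈ s, f i g • w i) :
    ∃ (m : ℕ) (f : Fin m → Grp n k → k) (w : Fin m → V),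
      (∀ i, f i ∈ regularFunctions n k) ∧ ∀ g, ρ g v = ∑ i, f i g • w i := by
  refine ⟨s.card, fun i => f (s.equivFin.symm i), fun i => w (s.equivFin.symm i),
    fun i => hf _ (s.equivFin.symm i).2, fun g => ?_⟩
  rw [h, s.equivFin.symm.sum_comp (fun i : s => f i g • w i), Finset.sum_coe_sort s
    (fun i => f i g • w i)]

lemma IsRational.subrepresentation (hρ : IsRational ρ) (N : Submodule k V)
    (hN : ∀ g, N ≤ N.comap (ρ g)) : IsRational (ρ.subrepresentation N hN) := by
  intro v
  obtain ⟨m, f, w, hf, hv⟩ := hρ v.1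
  -- The coaction vectors `w i` need not lie in `N`; a `k`-linear retraction onto `N`, not
  -- necessarily equivariant, moves them there without changing the orbit map.
  obtain ⟨p, hp⟩ := N.subtype.exists_leftInverse_of_injective N.ker_subtype
  refine ⟨m, f, fun i => p (w i), hf, fun g => ?_⟩
  have h1 : p (ρ g v.1) = ρ.subrepresentation N hN g v :=
    LinearMap.congr_fun hp (ρ.subrepresentation N hN g v)
  rw [← h1, hv, map_sum]
  simp

lemma IsRational.of_surjective (hρ : IsRational ρ) (p : V →ₗ[k] W)
    (hp : ∀ g x, p (ρ g x) = σ g (p x)) (hsurj : Function.Surjective p) : IsRational σ := by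
  intro v
  obtain ⟨v, rfl⟩ := hsurj v
  obtain ⟨m, f, w, hf, hv⟩ := hρ v
  exact ⟨m, f, fun i => p (w i), hf, fun g => by rw [← hp, hv]; simp⟩

lemma IsRational.tprod (hρ : IsRational ρ) (hσ : IsRational σ) : IsRational (ρ.tprod σ) := by
  intro x
  induction x using TensorProduct.induction_on with
  | zero => exact ⟨0, Fin.elim0, Fin.elim0, fun i => i.elim0, fun g => by simp⟩
  | tmul v w =>
    obtain ⟨m, f, a, hf, hv⟩ := hρ v
    obtain ⟨m', f', a', hf', hw⟩ := hσ w
    refine IsRational.of_finset Finset.univ (fun p : Fin m × Fin m' => f p.1 * f' p.2)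
      (fun p => a p.1 ⊗ₜ[k] a' p.2) (fun p _ => Subalgebra.mul_mem _ (hf _) (hf' _)) fun g => ?_
    rw [Representation.tprod_apply, TensorProduct.map_tmul, hv, hw, TensorProduct.sum_tmul,
      Fintype.sum_prod_type]
    refine Finset.sum_congr rfl fun i _ => ?_
    rw [TensorProduct.tmul_sum]
    refine Finset.sum_congr rfl fun j _ => ?_
    rw [TensorProduct.smul_tmul_smul]
    rfl
  | add x y hx hy =>
    obtain ⟨m, f, a, hf, hv⟩ := hx
    obtain ⟨m', f', a', hf', hw⟩ := hy
    refine IsRational.of_finset Finset.univ (Sum.elim f f') (Sum.elim a a') ?_ fun g => ?_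
    · rintro (i | i) -
      exacts [hf i, hf' i]
    · rw [map_add, hv, hw, Fintype.sum_sum_type]
      rfl

/-- The coordinate ring is a rational representation. -/
lemma isRational_ringRep_coordAct : IsRational (ringRep (coordAct n k)) := by
  have hentry : ∀ (g : Grp n k) (l : Fin 2) (i j : Fin n), coordAct n k g (.X (l, i, j)) =
      ∑ p : Fin n × Fin n, ((((scal g l)⁻¹ : kˣ) : k) *
        (((g.1⁻¹ : Matrix.GeneralLinearGroup (Fin n) k) : Matrix (Fin n) (Fin n) k) i p.1 *
        (g.1 : Matrix (Fin n) (Fin n) k) p.2 j)) •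
          (MvPolynomial.X (l, p.1, p.2) : CoordRing n k) := by
    intro g l i j
    change translate g _ = _
    rw [translate, MvPolynomial.aeval_X, movedMat, Matrix.smul_apply, Matrix.mul_apply,
      Fintype.sum_prod_type, smul_eq_mul, Finset.mul_sum, Finset.sum_comm]
    refine Finset.sum_congr rfl fun b _ => ?_
    rw [Matrix.mul_apply, Finset.sum_mul, Finset.mul_sum]
    refine Finset.sum_congr rfl fun a _ => ?_
    simp only [Matrix.map_apply, genMat, Matrix.of_apply, MvPolynomial.smul_eq_C_mul, map_mul]
    ring
  intro x
  induction x using MvPolynomial.induction_on with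
  | C a =>
    refine IsRational.of_finset {()} (fun _ => 1) (fun _ => MvPolynomial.C a)
      (fun _ _ => Subalgebra.one_mem _) fun g => ?_
    rw [Finset.sum_singleton, Pi.one_apply, one_smul]
    exact (coordAct n k g).commutes a
  | add x y hx hy =>
    obtain ⟨m, f, a, hf, hv⟩ := hx
    obtain ⟨m', f', a', hf', hw⟩ := hy
    refine IsRational.of_finset Finset.univ (Sum.elim f f') (Sum.elim a a') ?_ fun g => ?_
    · rintro (i | i) -
      exacts [hf i, hf' i]
    · rw [map_add, hv, hw, Fintype.sum_sum_type]
      rfl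
  | mul_X x p hx =>
    obtain ⟨m, f, a, hf, hv⟩ := hx
    obtain ⟨l, i, j⟩ := p
    refine IsRational.of_finset Finset.univ
      (fun q : Fin m × (Fin n × Fin n) => f q.1 * ((fun g => (((scal g l)⁻¹ : kˣ) : k)) *
        ((fun g => ((g.1⁻¹ : Matrix.GeneralLinearGroup (Fin n) k) :
          Matrix (Fin n) (Fin n) k) i q.2.1) *
        (fun g => (g.1 : Matrix (Fin n) (Fin n) k) q.2.2 j))))
      (fun q => a q.1 * MvPolynomial.X (l, q.2.1, q.2.2)) ?_ fun g => ?_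
    · intro q _
      refine Subalgebra.mul_mem _ (hf _) (Subalgebra.mul_mem _ ?_ (Subalgebra.mul_mem _ ?_ ?_))
      · exact Algebra.subset_adjoin (Or.inr (Or.inr (Or.inr ⟨l, rfl⟩)))
      · exact Algebra.subset_adjoin (Or.inr (Or.inl ⟨_, _, rfl⟩))
      · exact Algebra.subset_adjoin (Or.inl ⟨_, _, rfl⟩)
    · have h1 : ringRep (coordAct n k) g (x * MvPolynomial.X (l, i, j)) =
          ringRep (coordAct n k) g x * coordAct n k g (.X (l, i, j)) := map_mul (coordAct n k g) _ _
      rw [h1, hv, hentry, Finset.sum_mul_sum, Fintype.sum_prod_type]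
      refine Finset.sum_congr rfl fun a _ => Finset.sum_congr rfl fun b _ => ?_
      rw [smul_mul_smul_comm]
      rfl

lemma EqMod.isRational_free {M : EqMod (coordAct n k)} (hM : IsRational M.ρ) :
    IsRational M.free.ρ :=
  isRational_ringRep_coordAct.tprod hM

lemma EqMod.isRational_syz {M : EqMod (coordAct n k)} (hM : IsRational M.ρ) :
    IsRational M.syz.ρ :=
  IsRational.subrepresentation (EqMod.isRational_free hM) _ _

lemma EqMod.isRational_syzIter {M : EqMod (coordAct n k)} (hM : IsRational M.ρ) (i : ℕ) :
    IsRational (M.syzIter i).ρ := by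
  induction i with
  | zero => exact hM
  | succ i ih => exact EqMod.isRational_syz ih

/-! ### Classes of subquotients -/

/-- A subspace stable under the action of the group. -/
def Stable (ρ : Representation k (Grp n k) V) (N : Submodule k V) : Prop :=
  ∀ g, N ≤ N.comap (ρ g)

lemma Stable.sup {N N' : Submodule k V} (h : Stable ρ N) (h' : Stable ρ N') :
    Stable ρ (N ⊔ N') := fun g =>
  sup_le ((h g).trans (Submodule.comap_mono le_sup_left))
    ((h' g).trans (Submodule.comap_mono le_sup_right))

lemma Stable.map {N : Submodule k V} (h : Stable ρ N) {f : V →ₗ[k] W}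
    (hf : ∀ g x, f (ρ g x) = σ g (f x)) : Stable σ (N.map f) := by
  rintro g _ ⟨x, hx, rfl⟩
  exact ⟨ρ g x, h g hx, hf g x⟩

lemma Stable.comap {N : Submodule k W} (h : Stable σ N) {f : V →ₗ[k] W}
    (hf : ∀ g x, f (ρ g x) = σ g (f x)) : Stable ρ (N.comap f) := by
  intro g x hx
  change f (ρ g x) ∈ N
  rw [hf]
  exact h g hx

/-- The representation on the subquotient `Z / (B ∩ Z)`. -/
abbrev subquotRep (ρ : Representation k (Grp n k) V) {Z B : Submodule k V} (hZ : Stable ρ Z)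
    (hB : Stable ρ B) : Representation k (Grp n k) (Z ⧸ B.submoduleOf Z) :=
  (ρ.subrepresentation Z hZ).quotient (B.submoduleOf Z) fun g _ hx => hB g hx

lemma IsRational.subquotRep (hρ : IsRational ρ) {Z B : Submodule k V} (hZ : Stable ρ Z)
    (hB : Stable ρ B) : IsRational (subquotRep ρ hZ hB) :=
  IsRational.of_surjective (hρ.subrepresentation Z hZ) (Submodule.mkQ _) (fun _ _ => rfl)
    (Submodule.mkQ_surjective _)

/-- A finite dimensional subquotient `Z / (B ∩ Z)` of a rational representation. -/
noncomputable abbrev subquot (hρ : IsRational ρ) {Z B : Submodule k V} (hZ : Stable ρ Z)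
    (hB : Stable ρ B) (hfin : Module.Finite k (Z ⧸ B.submoduleOf Z)) : RatRep n k where
  carrier := Z ⧸ B.submoduleOf Z
  ρ := WheelComm.subquotRep ρ hZ hB
  rational := hρ.subquotRep hZ hB

open Classical in
/-- The class of the subquotient `Z / (B ∩ Z)`, if it is finite dimensional. -/
noncomputable def clq (hρ : IsRational ρ) (Z B : Submodule k V) : RepGroup n k :=
  if h : Stable ρ Z ∧ Stable ρ B ∧ Module.Finite k (Z ⧸ B.submoduleOf Z) then
    (subquot hρ h.1 h.2.1 h.2.2).cls else 0

lemma clq_eq (hρ : IsRational ρ) {Z B : Submodule k V} (hZ : Stable ρ Z)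
    (hB : Stable ρ B) (hfin : Module.Finite k (Z ⧸ B.submoduleOf Z)) :
    clq hρ Z B = (subquot hρ hZ hB hfin).cls :=
  dif_pos ⟨hZ, hB, hfin⟩

lemma RatRep.cls_add {V' V V'' : RatRep n k} (h : RatRep.ShortExact V' V V'') :
    V.cls = V'.cls + V''.cls :=
  (QuotientAddGroup.eq_iff_sub_mem).2 (AddSubgroup.subset_closure ⟨V', V, V'', h, rfl⟩)

/-- The map of subquotients induced by a linear map. -/
def subquotMap {Z B : Submodule k V} {Z' B' : Submodule k W} (f : V →ₗ[k] W)
    (hZ : ∀ z ∈ Z, f z ∈ Z') (hB : ∀ z ∈ Z, z ∈ B → f z ∈ B') :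
    (Z ⧸ B.submoduleOf Z) →ₗ[k] (Z' ⧸ B'.submoduleOf Z') :=
  Submodule.mapQ _ _ (f.restrict hZ) fun x hx => hB x.1 x.2 hx

lemma subquotMap_injective {Z B : Submodule k V} {Z' B' : Submodule k W} {f : V →ₗ[k] W}
    {hZ : ∀ z ∈ Z, f z ∈ Z'} {hB : ∀ z ∈ Z, z ∈ B → f z ∈ B'}
    (h : ∀ z ∈ Z, f z ∈ B' → z ∈ B) : Function.Injective (subquotMap f hZ hB) := by
  rw [injective_iff_map_eq_zero]
  intro x hx
  obtain ⟨x, rfl⟩ := Submodule.mkQ_surjective _ x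
  have h1 := (Submodule.Quotient.mk_eq_zero _).1 hx
  exact (Submodule.Quotient.mk_eq_zero _).2 (h x.1 x.2 h1)

lemma subquotMap_surjective {Z B : Submodule k V} {Z' B' : Submodule k W} {f : V →ₗ[k] W}
    {hZ : ∀ z ∈ Z, f z ∈ Z'} {hB : ∀ z ∈ Z, z ∈ B → f z ∈ B'}
    (h : Z' ≤ Z.map f ⊔ B') : Function.Surjective (subquotMap f hZ hB) := by
  intro y
  obtain ⟨y, rfl⟩ := Submodule.mkQ_surjective _ y
  obtain ⟨_, ⟨z, hz, rfl⟩, b, hb, hy⟩ := Submodule.mem_sup.1 (h y.2)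
  refine ⟨Submodule.mkQ _ ⟨z, hz⟩, ?_⟩
  refine (Submodule.Quotient.eq _).2 ?_
  change f z - y.1 ∈ B'
  rw [← hy, sub_add_cancel_left]
  exact B'.neg_mem hb

lemma finite_subquot_of_le {Z Z' B B' : Submodule k V}
    (h : Module.Finite k (Z ⧸ B.submoduleOf Z)) (hZ : Z' ≤ Z) (hB : B ≤ B') :
    Module.Finite k (Z' ⧸ B'.submoduleOf Z') := by
  have h1 : Module.Finite k (Z' ⧸ B.submoduleOf Z') :=
    Module.Finite.of_injective _ (subquotMap_injective (f := LinearMap.id) (Z := Z') (B := B)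
      (hZ := fun z hz => hZ hz) (hB := fun _ _ hb => hb) fun _ _ hb => hb)
  exact Module.Finite.of_surjective _ (subquotMap_surjective (f := LinearMap.id) (Z := Z') (B := B)
    (B' := B') (hZ := fun z hz => hz) (hB := fun _ _ hb => hB hb)
    (le_sup_of_le_left (by simp)))

/-- The third isomorphism theorem, read as the short exact sequence `0 → Y/B → Z/B → Z/Y → 0`. -/
lemma clq_add (hρ : IsRational ρ) {B Y Z : Submodule k V} (hB : Stable ρ B) (hY : Stable ρ Y)
    (hZ : Stable ρ Z) (hBY : B ≤ Y) (hYZ : Y ≤ Z)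
    (hfin : Module.Finite k (Z ⧸ B.submoduleOf Z)) :
    clq hρ Z B = clq hρ Y B + clq hρ Z Y := by
  rw [clq_eq hρ hZ hB hfin, clq_eq hρ hY hB (finite_subquot_of_le hfin hYZ le_rfl),
    clq_eq hρ hZ hY (finite_subquot_of_le hfin le_rfl hBY)]
  refine RatRep.cls_add ⟨subquotMap LinearMap.id (fun z hz => hYZ hz) (fun _ _ hb => hb),
    subquotMap LinearMap.id (fun z hz => hz) (fun _ _ hb => hBY hb), ?_, ?_,
    subquotMap_injective fun _ _ hb => hb, ?_,
    subquotMap_surjective (le_sup_of_le_left (by simp))⟩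
  · rintro g ⟨x⟩
    rfl
  · rintro g ⟨x⟩
    rfl
  · rintro ⟨x⟩
    constructor
    · intro hx
      have h1 : x.1 ∈ Y := (Submodule.Quotient.mk_eq_zero (Y.submoduleOf Z) (x := x)).1 hx
      exact ⟨Submodule.Quotient.mk ⟨x.1, h1⟩, rfl⟩
    · rintro ⟨⟨y⟩, hy⟩
      rw [← hy]
      exact (Submodule.Quotient.mk_eq_zero _).2 y.2

/-- The hypotheses say exactly that `f` induces a bijection of subquotients. No finiteness is
required: if one side is infinite dimensional then so is the other, and both classes take the
default value `0`. -/
lemma clq_congr (hρ : IsRational ρ) (hσ : IsRational σ) {Z B : Submodule k V}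
    {Z' B' : Submodule k W} (hZ : Stable ρ Z) (hB : Stable ρ B) (hZ' : Stable σ Z')
    (hB' : Stable σ B') (f : V →ₗ[k] W) (hf : ∀ g x, f (ρ g x) = σ g (f x))
    (h1 : ∀ z ∈ Z, f z ∈ Z') (h2 : ∀ z ∈ Z, f z ∈ B' ↔ z ∈ B) (h3 : Z' ≤ Z.map f ⊔ B') :
    clq hρ Z B = clq hσ Z' B' := by
  have e := LinearEquiv.ofBijective (subquotMap f h1 fun z hz => (h2 z hz).2)
    ⟨subquotMap_injective fun z hz => (h2 z hz).1, subquotMap_surjective h3⟩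
  by_cases hfin : Module.Finite k (Z ⧸ B.submoduleOf Z)
  · have hfin' : Module.Finite k (Z' ⧸ B'.submoduleOf Z') := Module.Finite.equiv e
    rw [clq_eq hρ hZ hB hfin, clq_eq hσ hZ' hB' hfin']
    refine RatRep.cls_eq_of_iso
      (LinearEquiv.ofBijective (subquotMap f h1 fun z hz => (h2 z hz).2)
        ⟨subquotMap_injective fun z hz => (h2 z hz).1, subquotMap_surjective h3⟩) ?_
    rintro g ⟨x⟩
    exact congrArg (Submodule.Quotient.mk (p := B'.submoduleOf Z')) (Subtype.ext (hf g x.1))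
  · have hfin' : ¬ Module.Finite k (Z' ⧸ B'.submoduleOf Z') := fun h =>
      hfin (Module.Finite.equiv e.symm)
    rw [clq, clq, dif_neg fun h => hfin h.2.2, dif_neg fun h => hfin' h.2.2]

lemma clq_self (hρ : IsRational ρ) {Z B : Submodule k V} (h : Z ≤ B) : clq hρ Z B = 0 := by
  unfold clq
  split_ifs with hh
  · refine RatRep.cls_eq_zero (Submodule.Quotient.subsingleton_iff.2 ?_)
    exact Submodule.submoduleOf_eq_top.2 h
  · rfl

end Rational

/-! ### Functoriality of the standard resolution -/

section Functoriality

variable {n : ℕ} {k : Type u} [Field k] {A : Type u} [CommRing A] [Algebra k A]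
  {act : Grp n k →* (A →ₐ[k] A)}

/-- Equivariant `A`-linear maps. -/
structure EqHom (M N : EqMod act) where
  lin : M.carrier →ₗ[A] N.carrier
  equivariant : ∀ g x, lin (M.ρ g x) = N.ρ g (lin x)

variable {M' M M'' : EqMod act}

/-- The map `A ⊗ₖ M → A ⊗ₖ N` induced by an equivariant map. -/
noncomputable def EqHom.free (f : EqHom M' M) : EqHom M'.free M.free where
  lin := (f.lin.restrictScalars k).baseChange A
  equivariant g x := by
    change A ⊗[k] M'.carrier at x
    induction x using TensorProduct.induction_on with
    | zero => exact (map_zero (((f.lin.restrictScalars k).baseChange A).restrictScalars k ∘ₗ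
        M'.free.ρ g)).trans (map_zero (M.free.ρ g ∘ₗ
          ((f.lin.restrictScalars k).baseChange A).restrictScalars k)).symm
    | tmul a m => exact congrArg (fun y => (act g a) ⊗ₜ[k] y) (f.equivariant g m)
    | add x y hx hy =>
      exact (map_add (((f.lin.restrictScalars k).baseChange A).restrictScalars k ∘ₗ
        M'.free.ρ g) x y).trans ((congrArg₂ (· + ·) hx hy).trans (map_add (M.free.ρ g ∘ₗ
          ((f.lin.restrictScalars k).baseChange A).restrictScalars k) x y).symm)

lemma EqHom.counit_free (f : EqHom M' M) (x : M'.free.carrier) :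
    M.counit (f.free.lin x) = f.lin (M'.counit x) := by
  have : M.counit ∘ₗ f.free.lin = f.lin ∘ₗ M'.counit := by
    refine TensorProduct.AlgebraTensorModule.curry_injective ?_
    ext m
    change (LinearMap.liftBaseChange A (LinearMap.id : M.carrier →ₗ[k] M.carrier))
      ((1 : A) ⊗ₜ f.lin m) = f.lin ((LinearMap.liftBaseChange A
        (LinearMap.id : M'.carrier →ₗ[k] M'.carrier)) ((1 : A) ⊗ₜ m))
    simp
  exact LinearMap.congr_fun this x

/-- The map of syzygies induced by an equivariant map. -/
noncomputable def EqHom.syz (f : EqHom M' M) : EqHom M'.syz M.syz where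
  lin := f.free.lin.restrict (p := LinearMap.ker M'.counit) (q := LinearMap.ker M.counit)
    fun x hx => by
      rw [LinearMap.mem_ker] at hx ⊢
      rw [f.counit_free, hx, map_zero]
  equivariant g x := Subtype.ext (f.free.equivariant g x.1)

/-- The map of iterated syzygies induced by an equivariant map. -/
noncomputable def EqHom.syzIter (f : EqHom M' M) : ∀ i, EqHom (M'.syzIter i) (M.syzIter i)
  | 0 => f
  | i + 1 => (f.syzIter i).syz

/-- The map of resolutions induced by an equivariant map. -/
noncomputable abbrev EqHom.res (f : EqHom M' M) (i : ℕ) : EqHom (M'.res i) (M.res i) :=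
  (f.syzIter i).free

lemma EqHom.diff_res (f : EqHom M' M) (i : ℕ) (x : (M'.res (i + 1)).carrier) :
    M.diff i ((f.res (i + 1)).lin x) = (f.res i).lin (M'.diff i x) :=
  congrArg Subtype.val ((f.syzIter (i + 1)).counit_free x)

/-- The sequence `0 → M' → M → M'' → 0` is exact. -/
structure EqHom.Exact (f : EqHom M' M) (g : EqHom M M'') : Prop where
  injective : Function.Injective f.lin
  exact : Function.Exact f.lin g.lin
  surjective : Function.Surjective g.lin

/-- Over a field `A ⊗ₖ -` is exact, so the standard construction turns a short exact sequence of
sheaves into one of resolutions, with no choice of lifts. -/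
lemma EqHom.Exact.free {f : EqHom M' M} {g : EqHom M M''} (h : f.Exact g) :
    f.free.Exact g.free where
  injective := Module.Flat.lTensor_preserves_injective_linearMap
    (M := A) (f.lin.restrictScalars k) h.injective
  exact := lTensor_exact A (f := f.lin.restrictScalars k) (g := g.lin.restrictScalars k)
    h.exact h.surjective
  surjective := LinearMap.lTensor_surjective A (g := g.lin.restrictScalars k) h.surjective

/-- Syzygies are kernels of the surjections `A ⊗ₖ M → M`. Surjectivity on kernels is the snake
lemma: the error of a lift comes from `M'`, and is corrected because `M'.counit` is onto. -/
lemma EqHom.Exact.syz {f : EqHom M' M} {g : EqHom M M''} (h : f.Exact g) :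
    f.syz.Exact g.syz where
  injective x y hxy := Subtype.ext (h.free.injective (congrArg Subtype.val hxy))
  exact := by
    intro x
    constructor
    · intro hx
      obtain ⟨y, hy⟩ := (h.free.exact x.1).1 (congrArg Subtype.val hx)
      refine ⟨⟨y, h.injective ?_⟩, Subtype.ext hy⟩
      rw [← f.counit_free, hy, map_zero]
      exact x.2
    · rintro ⟨y, rfl⟩
      exact Subtype.ext ((h.free.exact _).2 ⟨y.1, rfl⟩)
  surjective := by
    intro z
    obtain ⟨x, hx⟩ := h.free.surjective z.1
    have h1 : g.lin (M.counit x) = 0 := by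
      rw [← g.counit_free, hx]
      exact z.2
    obtain ⟨m, hm⟩ := (h.exact _).1 h1
    obtain ⟨y, rfl⟩ := M'.counit_surjective m
    refine ⟨⟨x - f.free.lin y, ?_⟩, Subtype.ext ?_⟩
    · change M.counit (x - f.free.lin y) = 0
      rw [map_sub, f.counit_free, hm, sub_self]
    · change g.free.lin (x - f.free.lin y) = z.1
      rw [map_sub, hx, (h.free.exact _).2 ⟨y, rfl⟩, sub_zero]

lemma EqHom.Exact.syzIter {f : EqHom M' M} {g : EqHom M M''} (h : f.Exact g) :
    ∀ i, (f.syzIter i).Exact (g.syzIter i)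
  | 0 => h
  | i + 1 => (h.syzIter i).syz

/-- A `k`-linear retraction of `f` extends to an `A`-linear retraction of `A ⊗ₖ f`, so this map
stays injective modulo every ideal `J`. The retraction need not be equivariant. -/
lemma EqHom.mem_smul_top_of_free (f : EqHom M' M) (hf : Function.Injective f.lin) (J : Ideal A)
    {x : M'.free.carrier} (hx : f.free.lin x ∈ (J • ⊤ : Submodule A M.free.carrier)) :
    x ∈ (J • ⊤ : Submodule A M'.free.carrier) := by
  obtain ⟨r, hr⟩ := (f.lin.restrictScalars k).exists_leftInverse_of_injective
    (LinearMap.ker_eq_bot.2 hf)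
  let R : M.free.carrier →ₗ[A] M'.free.carrier := r.baseChange A
  have h1 : R (f.free.lin x) = x := by
    have : R ∘ₗ f.free.lin = LinearMap.id := by
      refine TensorProduct.AlgebraTensorModule.curry_injective ?_
      ext m
      exact congrArg (fun y => (1 : A) ⊗ₜ[k] y) (LinearMap.congr_fun hr m)
    exact LinearMap.congr_fun this x
  rw [← h1]
  have h2 := Submodule.mem_map_of_mem (f := R) hx
  rw [Submodule.map_smul''] at h2
  exact Submodule.smul_mono le_rfl le_top h2

lemma EqHom.mem_smul_top (f : EqHom M' M) (J : Ideal A)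
    {x : M'.carrier} (hx : x ∈ (J • ⊤ : Submodule A M'.carrier)) :
    f.lin x ∈ (J • ⊤ : Submodule A M.carrier) := by
  have h2 := Submodule.mem_map_of_mem (f := f.lin) hx
  rw [Submodule.map_smul''] at h2
  exact Submodule.smul_mono le_rfl le_top h2

lemma EqHom.exists_mem_smul_top (f : EqHom M' M) (hf : Function.Surjective f.lin) (J : Ideal A)
    {y : M.carrier} (hy : y ∈ (J • ⊤ : Submodule A M.carrier)) :
    ∃ x ∈ (J • ⊤ : Submodule A M'.carrier), f.lin x = y := by
  rw [← LinearMap.range_eq_top.2 hf, LinearMap.range_eq_map, ← Submodule.map_smul''] at hy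
  exact hy

end Functoriality

/-! ### The Euler characteristic of a short exact sequence of complexes -/

section Snake

variable {n : ℕ} {k : Type u} [Field k] {V' V V'' : Type u} [AddCommGroup V'] [Module k V']
  [AddCommGroup V] [Module k V] [AddCommGroup V''] [Module k V'']
  {ρ' : Representation k (Grp n k) V'} {ρ : Representation k (Grp n k) V}
  {ρ'' : Representation k (Grp n k) V''}

/-- The failure of additivity of homology in one degree of an exact sequence of complexes. -/
lemma clq_add_defect (hρ' : IsRational ρ') (hρ : IsRational ρ) (hρ'' : IsRational ρ'')
    {Z' B' : Submodule k V'} {Z B : Submodule k V} {Z'' B'' : Submodule k V''}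
    (hZ' : Stable ρ' Z') (hB' : Stable ρ' B') (hZ : Stable ρ Z) (hB : Stable ρ B)
    (hZ'' : Stable ρ'' Z'') (hB'' : Stable ρ'' B'')
    (f' : Module.Finite k (Z' ⧸ B'.submoduleOf Z')) (f : Module.Finite k (Z ⧸ B.submoduleOf Z))
    (f'' : Module.Finite k (Z'' ⧸ B''.submoduleOf Z''))
    (a : V' →ₗ[k] V) (b : V →ₗ[k] V'') (ha : ∀ g x, a (ρ' g x) = ρ g (a x))
    (hb : ∀ g x, b (ρ g x) = ρ'' g (b x)) (hab : ∀ x, b (a x) = 0)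
    (hBZ : B ≤ Z) (haZ : Z'.map a ≤ Z) (haB : B'.map a ≤ B) (hbZ : Z.map b ≤ Z'')
    (hbB : B.map b = B'') (haX : B.comap a ≤ Z')
    (hex : ∀ z ∈ Z, b z ∈ B'' → z ∈ B ⊔ Z'.map a) :
    clq hρ Z B + clq hρ' (B.comap a) B' + clq hρ'' Z'' (Z.map b) =
      clq hρ' Z' B' + clq hρ'' Z'' B'' := by
  -- The three terms on the left are the middle homology, the kernel of `H(C') → H(C)` and the
  -- cokernel of `H(C) → H(C'')`. The subspace `B ⊔ Z'.map a` splits `H(C) = Z/B` into the image of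
  -- `H(C')` and the image of `H(C)` in `H(C'')`.
  have hY : Stable ρ (B ⊔ Z'.map a) := hB.sup (hZ'.map ha)
  have hBY : B ⊔ Z'.map a ≤ Z := sup_le hBZ haZ
  rw [clq_add hρ hB hY hZ le_sup_left hBY f,
    clq_add hρ' hB' (hB.comap ha) hZ' (Submodule.map_le_iff_le_comap.1 haB) haX f',
    clq_add hρ'' hB'' (hZ.map hb) hZ'' (hbB ▸ Submodule.map_mono hBZ) hbZ f'']
  have e1 : clq hρ' Z' (B.comap a) = clq hρ (B ⊔ Z'.map a) B :=
    clq_congr hρ' hρ hZ' (hB.comap ha) hY hB a ha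
      (fun z hz => Submodule.mem_sup_right ⟨z, hz, rfl⟩) (fun z _ => Iff.rfl)
      (sup_comm B (Z'.map a)).le
  have e2 : clq hρ Z (B ⊔ Z'.map a) = clq hρ'' (Z.map b) B'' := by
    refine clq_congr hρ hρ'' hZ hY (hZ.map hb) hB'' b hb (fun z hz => ⟨z, hz, rfl⟩)
      (fun z hz => ⟨hex z hz, fun h => ?_⟩) le_sup_left
    obtain ⟨y, hy, _, ⟨x, _, rfl⟩, rfl⟩ := Submodule.mem_sup.1 h
    rw [map_add, hab, add_zero, ← hbB]
    exact ⟨y, hy, rfl⟩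
  rw [e1, e2]
  abel

variable {U' U U'' : Type u} [AddCommGroup U'] [Module k U']
  [AddCommGroup U] [Module k U] [AddCommGroup U''] [Module k U'']
  {τ' : Representation k (Grp n k) U'} {τ : Representation k (Grp n k) U}
  {τ'' : Representation k (Grp n k) U''}

/-- The connecting isomorphism, from the cokernel of `H₁(C) → H₁(C'')` to the kernel of
`H₀(C') → H₀(C)`. -/
lemma clq_connecting (hτ : IsRational τ) (hτ'' : IsRational τ'') (hρ' : IsRational ρ')
    (hρ : IsRational ρ) {N' : Submodule k V'} {N : Submodule k V} {Z'' : Submodule k U''}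
    (hN' : Stable ρ' N') (hN : Stable ρ N) (hZ'' : Stable τ'' Z'')
    (d' : U' →ₗ[k] V') (d : U →ₗ[k] V) (a₁ : U' →ₗ[k] U) (b₁ : U →ₗ[k] U'') (a₀ : V' →ₗ[k] V)
    (hd' : ∀ g x, d' (τ' g x) = ρ' g (d' x)) (hd : ∀ g x, d (τ g x) = ρ g (d x))
    (ha₁ : ∀ g x, a₁ (τ' g x) = τ g (a₁ x)) (hb₁ : ∀ g x, b₁ (τ g x) = τ'' g (b₁ x))
    (ha₀ : ∀ g x, a₀ (ρ' g x) = ρ g (a₀ x)) (hda : ∀ x, d (a₁ x) = a₀ (d' x))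
    (hex : Function.Exact a₁ b₁) (hsurj : Function.Surjective b₁)
    (haN : N.comap a₀ = N')
    (hS : Z''.comap b₁ = (N ⊔ LinearMap.range a₀).comap d) :
    clq hτ'' Z'' ((N.comap d).map b₁) =
      clq hρ' ((N ⊔ LinearMap.range d).comap a₀) (N' ⊔ LinearMap.range d') := by
  have sZ : Stable τ (N.comap d) := hN.comap hd
  have sr' : Stable ρ' (LinearMap.range d') := by
    rintro g _ ⟨x, rfl⟩
    exact ⟨τ' g x, hd' g x⟩
  have sr : Stable ρ (LinearMap.range d) := by
    rintro g _ ⟨x, rfl⟩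
    exact ⟨τ g x, hd g x⟩
  have sa : Stable τ (LinearMap.range a₁) := by
    rintro g _ ⟨x, rfl⟩
    exact ⟨τ' g x, ha₁ g x⟩
  have sB' := hN'.sup sr'
  have sX := (hN.sup sr).comap ha₀
  have hNle : N' ≤ N.comap a₀ := haN.ge
  -- The connecting map is realized as a zigzag of isomorphisms. First, the cokernel is pulled back
  -- along `b₁` to a subquotient of the middle term `U`.
  have e1 : clq hτ (Z''.comap b₁) (N.comap d ⊔ LinearMap.range a₁) =
      clq hτ'' Z'' ((N.comap d).map b₁) := by
    refine clq_congr hτ hτ'' (hZ''.comap hb₁) (sZ.sup sa) hZ'' (sZ.map hb₁) b₁ hb₁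
      (fun z hz => hz) (fun z hz => ⟨?_, ?_⟩) ?_
    · rintro ⟨y, hy, hyz⟩
      obtain ⟨x, hx⟩ := (hex (z - y)).1 (by rw [map_sub, hyz, sub_self])
      rw [← add_sub_cancel y z, ← hx]
      exact Submodule.add_mem_sup hy ⟨x, rfl⟩
    · intro h
      obtain ⟨y, hy, _, ⟨x, rfl⟩, rfl⟩ := Submodule.mem_sup.1 h
      exact ⟨y, hy, by rw [map_add, (hex _).2 ⟨x, rfl⟩, add_zero]⟩
    · intro z hz
      obtain ⟨y, rfl⟩ := hsurj z
      exact Submodule.mem_sup_left ⟨y, hz, rfl⟩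
  -- Next, `d` carries this subquotient into `V`: by `hS`, an element of `Z''.comap b₁` has
  -- differential in `N ⊔ range a₀`, and its `a₀`-part automatically lies in the image of the kernel
  -- of `H₀(C') → H₀(C)`.
  have e2 : clq hτ (Z''.comap b₁) (N.comap d ⊔ LinearMap.range a₁) =
      clq hρ (N ⊔ ((N ⊔ LinearMap.range d).comap a₀).map a₀)
        (N ⊔ (N' ⊔ LinearMap.range d').map a₀) := by
    refine clq_congr hτ hρ (hZ''.comap hb₁) (sZ.sup sa) (hN.sup (sX.map ha₀))
      (hN.sup (sB'.map ha₀)) d hd ?_ ?_ ?_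
    · intro z hz
      rw [hS] at hz
      obtain ⟨j, hj, _, ⟨x, rfl⟩, hx⟩ := Submodule.mem_sup.1 hz
      rw [← hx]
      refine Submodule.add_mem_sup hj ⟨x, ?_, rfl⟩
      change a₀ x ∈ N ⊔ LinearMap.range d
      rw [show a₀ x = -j + d z by rw [← hx]; abel]
      exact Submodule.add_mem_sup (N.neg_mem hj) ⟨z, rfl⟩
    · intro z hz
      constructor
      · intro h
        obtain ⟨j, hj, _, ⟨x, hx, rfl⟩, h⟩ := Submodule.mem_sup.1 h
        obtain ⟨j', hj', _, ⟨q, rfl⟩, rfl⟩ := Submodule.mem_sup.1 hx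
        rw [← sub_add_cancel z (a₁ q)]
        refine Submodule.add_mem_sup ?_ ⟨q, rfl⟩
        change d (z - a₁ q) ∈ N
        rw [map_sub, hda, ← h, map_add, ← add_assoc, add_sub_cancel_right]
        exact N.add_mem hj (hNle hj')
      · intro h
        obtain ⟨y, hy, _, ⟨q, rfl⟩, rfl⟩ := Submodule.mem_sup.1 h
        rw [map_add, hda]
        exact Submodule.add_mem_sup hy ⟨d' q, Submodule.mem_sup_right ⟨q, rfl⟩, rfl⟩
    · rintro y hy
      obtain ⟨j, hj, _, ⟨x, hx, rfl⟩, rfl⟩ := Submodule.mem_sup.1 hy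
      obtain ⟨j', hj', _, ⟨p, rfl⟩, hp⟩ := Submodule.mem_sup.1 hx
      rw [← hp, ← add_assoc, add_comm]
      refine Submodule.add_mem_sup ⟨p, ?_, rfl⟩ (Submodule.mem_sup_left (N.add_mem hj hj'))
      rw [hS]
      change d p ∈ N ⊔ LinearMap.range a₀
      rw [show d p = -j' + a₀ x by rw [← hp]; abel]
      exact Submodule.add_mem_sup (N.neg_mem hj') ⟨x, rfl⟩
  -- Finally, `a₀` identifies that kernel with the same subquotient of `V`, since `a₀` is injective
  -- modulo `N'` and `N` by `haN`.
  have e3 : clq hρ' ((N ⊔ LinearMap.range d).comap a₀) (N' ⊔ LinearMap.range d') =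
      clq hρ (N ⊔ ((N ⊔ LinearMap.range d).comap a₀).map a₀)
        (N ⊔ (N' ⊔ LinearMap.range d').map a₀) := by
    refine clq_congr hρ' hρ sX sB' (hN.sup (sX.map ha₀)) (hN.sup (sB'.map ha₀)) a₀ ha₀
      (fun z hz => Submodule.mem_sup_right ⟨z, hz, rfl⟩) (fun z _ => ⟨?_, ?_⟩) ?_
    · intro h
      obtain ⟨j, hj, _, ⟨x, hx, rfl⟩, h⟩ := Submodule.mem_sup.1 h
      rw [← sub_add_cancel z x]
      refine Submodule.add_mem _ (Submodule.mem_sup_left ?_) hx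
      rw [← haN]
      change a₀ (z - x) ∈ N
      rwa [map_sub, ← h, add_sub_cancel_right]
    · exact fun h => Submodule.mem_sup_right ⟨z, h, rfl⟩
    · refine sup_le (le_sup_of_le_right le_sup_left) le_sup_left
  rw [← e1, e2, e3]

end Snake

/-! ### The Gysin pull-back to the origin -/

section Gysin

variable {n : ℕ} {k : Type u} [Field k]

lemma originIdeal_eq_span : originIdeal n k =
    Ideal.span (MvPolynomial.X '' ((Finset.univ : Finset (Fin 2 × Fin n × Fin n)) : Set _)) := by
  apply le_antisymm
  · intro f hf
    rw [MvPolynomial.mem_ideal_span_X_image]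
    intro m hm
    have h0 : MvPolynomial.coeff 0 f = 0 := by
      have : MvPolynomial.aeval (fun _ => (0 : k)) f = 0 := hf
      rwa [MvPolynomial.aeval_zero', Algebra.algebraMap_self, RingHom.id_apply] at this
    have hm0 : m ≠ 0 := by
      rintro rfl
      exact MvPolynomial.mem_support_iff.1 hm h0
    obtain ⟨i, hi⟩ := Finsupp.ne_iff.1 hm0
    exact ⟨i, by simp, hi⟩
  · rw [Ideal.span_le]
    rintro _ ⟨i, -, rfl⟩
    simp [originIdeal, RingHom.mem_ker]

lemma exists_sub_algebraMap_mem_originIdeal (a : CoordRing n k) :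
    ∃ c : k, a - algebraMap k _ c ∈ originIdeal n k := by
  refine ⟨MvPolynomial.aeval (fun _ => (0 : k)) a, ?_⟩
  change MvPolynomial.aeval (fun _ => (0 : k)) (a - algebraMap k _ _) = 0
  rw [map_sub, AlgHom.commutes, Algebra.algebraMap_self, RingHom.id_apply, sub_self]

lemma finite_subquot_of_le_sup {V : Type*} [AddCommGroup V] [Module k V] {Z B S : Submodule k V}
    [Module.Finite k S] (hS : S ≤ Z) (hZ : Z ≤ S ⊔ B) : Module.Finite k (Z ⧸ B.submoduleOf Z) := by
  refine Module.Finite.of_surjective ((B.submoduleOf Z).mkQ ∘ₗ Submodule.inclusion hS) fun y => ?_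
  obtain ⟨y, rfl⟩ := Submodule.mkQ_surjective _ y
  obtain ⟨s, hs, b, hb, h⟩ := Submodule.mem_sup.1 (hZ y.2)
  refine ⟨⟨s, hs⟩, (Submodule.Quotient.eq _).2 ?_⟩
  change s - y.1 ∈ B
  rw [← h, sub_add_cancel_left]
  exact B.neg_mem hb

/-- A finitely generated subquotient killed by the ideal of the origin is spanned over `k` by a
finite set. -/
lemma exists_finset_span {M : Type*} [AddCommGroup M] [Module (CoordRing n k) M]
    [Module k M] [IsScalarTower k (CoordRing n k) M] {Z B : Submodule (CoordRing n k) M}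
    (h : RelFG Z B) (hBZ : B ≤ Z) (hJ : ∀ a ∈ originIdeal n k, ∀ z ∈ Z, a • z ∈ B) :
    ∃ t : Finset M, Submodule.span k (t : Set M) ≤ Z.restrictScalars k ∧
      Z.restrictScalars k ≤ Submodule.span k (t : Set M) ⊔ B.restrictScalars k := by
  obtain ⟨t, ht, hle⟩ := h.exists_span hBZ le_rfl
  have hS : Submodule.span k (t : Set M) ≤ Z.restrictScalars k := Submodule.span_le.2 ht
  refine ⟨t, hS, fun z hz => ?_⟩
  obtain ⟨p, hp, b, hb, rfl⟩ := Submodule.mem_sup.1 (hle hz)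
  refine Submodule.add_mem _ ?_ (Submodule.mem_sup_right hb)
  clear hz
  induction hp using Submodule.span_induction with
  | mem p hp => exact Submodule.mem_sup_left (Submodule.subset_span hp)
  | zero => exact Submodule.zero_mem _
  | add p q _ _ hp hq => exact Submodule.add_mem _ hp hq
  | smul a p _ hp =>
    obtain ⟨q, hq, b', hb', rfl⟩ := Submodule.mem_sup.1 hp
    obtain ⟨c, hc⟩ := exists_sub_algebraMap_mem_originIdeal a
    rw [show a • (q + b') = c • q + ((a - algebraMap k _ c) • q + a • b') by
      rw [sub_smul, algebraMap_smul, smul_add]; abel]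
    exact Submodule.add_mem_sup (Submodule.smul_mem _ _ hq)
      (B.add_mem (hJ _ hc _ (hS hq)) (B.smul_mem _ hb'))

lemma EqMod.torCycles_eq {A : Type u} [CommRing A] [Algebra k A]
    {act : Grp n k →* (A →ₐ[k] A)} (J : Ideal A) (M : EqMod act) (i : ℕ) :
    M.torCycles J i =
      (cyc (P := fun i => (M.res i).carrier) M.diff J i).restrictScalars k := by
  cases i <;> rfl

lemma EqMod.diff_diff {A : Type u} [CommRing A] [Algebra k A]
    {act : Grp n k →* (A →ₐ[k] A)} (M : EqMod act) (i : ℕ) (x : (M.res (i + 1 + 1)).carrier) :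
    M.diff i (M.diff (i + 1) x) = 0 :=
  (M.exact_diff i).apply_apply_eq_zero x

lemma EqMod.torBoundaries_le {A : Type u} [CommRing A] [Algebra k A]
    {act : Grp n k →* (A →ₐ[k] A)} (J : Ideal A) (M : EqMod act) (i : ℕ) :
    M.torBoundaries J i ≤ M.torCycles J i := by
  rw [M.torCycles_eq]
  exact bdry_le_cyc (P := fun i => (M.res i).carrier) (d := M.diff) M.diff_diff J i

lemma restrictScalars_sup_range {A P' P : Type*} [CommRing A] [Algebra k A] [AddCommGroup P']
    [AddCommGroup P] [Module A P'] [Module A P] [Module k P'] [Module k P] [IsScalarTower k A P']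
    [IsScalarTower k A P] (f : P' →ₗ[A] P) (N : Submodule A P) :
    (N ⊔ LinearMap.range f).restrictScalars k =
      N.restrictScalars k ⊔ LinearMap.range (f.restrictScalars k) :=
  Submodule.restrictScalars_sup _ _ _

lemma EqMod.torBoundaries_eq {A : Type u} [CommRing A] [Algebra k A]
    {act : Grp n k →* (A →ₐ[k] A)} (J : Ideal A) (M : EqMod act) (i : ℕ) :
    M.torBoundaries J i = (J • ⊤ : Submodule A (M.res i).carrier).restrictScalars k ⊔
      LinearMap.range ((M.diff i).restrictScalars k) :=
  restrictScalars_sup_range _ _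

/-- The origin is cut out by all the variables, so `relFG_cyc_bdry` applies with `s` the set of all
coordinates. Its hypothesis in degree zero holds because `P₀ / d P₁ = M` is finitely generated:
lifts to `P₀` of generators of `M` suffice. -/
lemma EqMod.relFG_tor (M : EqMod (coordAct n k)) (hM : Module.Finite (CoordRing n k) M.carrier)
    (i : ℕ) :
    RelFG (cyc (P := fun i => (M.res i).carrier) M.diff (originIdeal n k) i)
      (bdry (P := fun i => (M.res i).carrier) M.diff (originIdeal n k) i) ∧
    (Fintype.card (Fin 2 × Fin n × Fin n) < i →
      cyc (P := fun i => (M.res i).carrier) M.diff (originIdeal n k) i ≤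
      bdry (P := fun i => (M.res i).carrier) M.diff (originIdeal n k) i) := by
  have : ∀ i, Module.Free (MvPolynomial (Fin 2 × Fin n × Fin n) k) (M.res i).carrier :=
    M.res_free
  rw [originIdeal_eq_span]
  refine relFG_cyc_bdry (P := fun i => (M.res i).carrier) (d := M.diff) M.exact_diff ?_
    Finset.univ i
  obtain ⟨s, hs⟩ := hM.fg_top
  let c : (M.res 0).carrier →ₗ[CoordRing n k] M.carrier := M.counit
  have hc : ∀ m, ∃ y, c y = m := M.counit_surjective
  choose y hy using hc
  refine ⟨Submodule.span _ (y '' s), ⟨(s.finite_toSet.image y).toFinset, by simp⟩, fun x _ => ?_⟩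
  have h1 : c x ∈ (Submodule.span (CoordRing n k) (y '' s)).map c := by
    rw [Submodule.map_span, Set.image_image]
    simp only [hy, Set.image_id']
    rw [hs]
    trivial
  obtain ⟨w, hw, hw'⟩ := h1
  obtain ⟨z, hz⟩ := (M.exact_diff_zero (x - w)).1 (show c (x - w) = 0 by rw [map_sub, hw', sub_self])
  rw [← add_sub_cancel w x, ← hz]
  exact Submodule.add_mem_sup hw ⟨z, rfl⟩

/-- The homology is finitely generated over the coordinate ring and killed by the origin ideal,
whose residue field is `k`. -/
lemma EqCoh.finite_tor (F : EqCoh (coordAct n k)) (i : ℕ) :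
    Module.Finite k (F.TorSpace (originIdeal n k) i) := by
  obtain ⟨t, h1, h2⟩ := exists_finset_span (F.toEqMod.relFG_tor F.finite i).1
    (bdry_le_cyc (P := fun i => (F.toEqMod.res i).carrier) (d := F.toEqMod.diff)
      F.toEqMod.diff_diff _ i)
    (fun a ha z _ => Submodule.mem_sup_left (Submodule.smul_mem_smul ha trivial))
  rw [← F.toEqMod.torCycles_eq] at h1 h2
  have := FiniteDimensional.span_finset k t
  exact finite_subquot_of_le_sup h1 h2

lemma EqCoh.torCycles_le (F : EqCoh (coordAct n k)) {i : ℕ}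
    (hi : Fintype.card (Fin 2 × Fin n × Fin n) < i) :
    F.torCycles (originIdeal n k) i ≤ F.torBoundaries (originIdeal n k) i := by
  rw [F.toEqMod.torCycles_eq]
  exact (F.toEqMod.relFG_tor F.finite i).2 hi

lemma EqCoh.isRational_res (F : EqCoh (coordAct n k)) (i : ℕ) :
    IsRational (F.toEqMod.res i).ρ :=
  EqMod.isRational_free (EqMod.isRational_syzIter F.rational i)

/-- `Tor_i(k, F)` as a finite dimensional rational representation. -/
noncomputable def EqCoh.tor (F : EqCoh (coordAct n k)) (i : ℕ) : RatRep n k :=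
  subquot (F.isRational_res i) (F.torCycles_stable originIdeal_stable i)
    (F.torBoundaries_stable originIdeal_stable i) (F.finite_tor i)

lemma EqCoh.isTor_tor (F : EqCoh (coordAct n k)) (i : ℕ) :
    IsTor originIdeal_stable F.toEqMod i (F.tor i) :=
  ⟨LinearEquiv.refl k _, fun _ _ => rfl⟩

lemma EqCoh.subsingleton_tor (F : EqCoh (coordAct n k)) {i : ℕ}
    (hi : Fintype.card (Fin 2 × Fin n × Fin n) < i) : Subsingleton (F.tor i).carrier :=
  Submodule.Quotient.subsingleton_iff.2 (Submodule.submoduleOf_eq_top.2 (F.torCycles_le hi))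

lemma EqCoh.cls_tor (F : EqCoh (coordAct n k)) (i : ℕ) :
    (F.tor i).cls = clq (F.isRational_res i) (F.torCycles (originIdeal n k) i)
      (F.torBoundaries (originIdeal n k) i) :=
  (clq_eq _ _ _ _).symm

/-- `∑ᵢ (-1)ⁱ [Tor_i(k, F)]`. -/
noncomputable def EqCoh.eulerTor (F : EqCoh (coordAct n k)) : RepGroup n k :=
  ∑ i ∈ Finset.range (Fintype.card (Fin 2 × Fin n × Fin n) + 2), (-1 : ℤ) ^ i • (F.tor i).cls

/-! ### Additivity of the alternating sum of `Tor` on short exact sequences -/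

section Additivity

variable {F' F F'' : EqCoh (coordAct n k)} (f : EqHom F'.toEqMod F.toEqMod)
  (g : EqHom F.toEqMod F''.toEqMod)

lemma EqHom.res_comp_eq_zero {f : EqHom F'.toEqMod F.toEqMod} {g : EqHom F.toEqMod F''.toEqMod}
    (h : f.Exact g) (i : ℕ) (x : (F'.toEqMod.res i).carrier) :
    (g.res i).lin ((f.res i).lin x) = 0 :=
  ((h.syzIter i).free.exact _).2 ⟨x, rfl⟩

/-- Exactness of `P' / J P' → P / J P → P'' / J P''` in the middle, phrased inside `P`: an element
mapping into `J P''` can be corrected by an element of `J P` with the same image. -/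
lemma EqHom.mem_smul_top_iff_sup {f : EqHom F'.toEqMod F.toEqMod}
    {g : EqHom F.toEqMod F''.toEqMod} (h : f.Exact g) (J : Ideal (CoordRing n k)) (i : ℕ)
    (x : (F.toEqMod.res i).carrier) :
    (g.res i).lin x ∈ (J • ⊤ : Submodule (CoordRing n k) (F''.toEqMod.res i).carrier) ↔
      x ∈ (J • ⊤ : Submodule (CoordRing n k) (F.toEqMod.res i).carrier) ⊔
        LinearMap.range (f.res i).lin := by
  constructor
  · intro hx
    obtain ⟨y, hy, hyx⟩ := (g.res i).exists_mem_smul_top (h.syzIter i).free.surjective J hx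
    obtain ⟨z, hz⟩ := ((h.syzIter i).free.exact (x - y)).1 (by
      change (g.res i).lin (x - y) = 0
      rw [map_sub, hyx, sub_self])
    rw [← add_sub_cancel y x, ← hz]
    exact Submodule.add_mem_sup hy ⟨z, rfl⟩
  · intro hx
    obtain ⟨y, hy, _, ⟨z, rfl⟩, rfl⟩ := Submodule.mem_sup.1 hx
    rw [map_add, EqHom.res_comp_eq_zero h, add_zero]
    exact (g.res i).mem_smul_top J hy

variable {f g}

lemma EqHom.map_torCycles_le {M N : EqMod (coordAct n k)} (f : EqHom M N)
    (J : Ideal (CoordRing n k)) (i : ℕ) {x : (M.res i).carrier} (hx : x ∈ M.torCycles J i) :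
    (f.res i).lin x ∈ N.torCycles J i := by
  cases i with
  | zero => trivial
  | succ i =>
    change N.diff i ((f.res (i + 1)).lin x) ∈ (J • ⊤ : Submodule (CoordRing n k) (N.res i).carrier)
    rw [f.diff_res]
    exact (f.res i).mem_smul_top J hx

lemma EqHom.map_torBoundaries_le {M N : EqMod (coordAct n k)} (f : EqHom M N)
    (J : Ideal (CoordRing n k)) (i : ℕ) {x : (M.res i).carrier} (hx : x ∈ M.torBoundaries J i) :
    (f.res i).lin x ∈ N.torBoundaries J i := by
  obtain ⟨y, hy, _, ⟨w, rfl⟩, rfl⟩ := Submodule.mem_sup.1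
    (show x ∈ (J • ⊤ : Submodule (CoordRing n k) (M.res i).carrier) ⊔ LinearMap.range (M.diff i) from hx)
  rw [map_add, ← f.diff_res]
  exact Submodule.add_mem_sup ((f.res i).mem_smul_top J hy) ⟨_, rfl⟩

lemma EqHom.Exact.exists_torBoundaries (h : f.Exact g) (J : Ideal (CoordRing n k)) (i : ℕ)
    {x : (F''.toEqMod.res i).carrier} (hx : x ∈ F''.torBoundaries J i) :
    ∃ y ∈ F.torBoundaries J i, (g.res i).lin y = x := by
  obtain ⟨y, hy, _, ⟨w, rfl⟩, rfl⟩ := Submodule.mem_sup.1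
    (show x ∈ (J • ⊤ : Submodule (CoordRing n k) (F''.toEqMod.res i).carrier) ⊔
      LinearMap.range (F''.toEqMod.diff i) from hx)
  obtain ⟨y, hy', rfl⟩ := (g.res i).exists_mem_smul_top (h.syzIter i).free.surjective J hy
  obtain ⟨w, rfl⟩ := (h.syzIter (i + 1)).free.surjective w
  refine ⟨y + F.toEqMod.diff i w, Submodule.add_mem_sup hy' ⟨w, rfl⟩, ?_⟩
  rw [map_add, ← g.diff_res]

/-- The class of the kernel of `Hᵢ(C') → Hᵢ(C)`. -/
noncomputable def EqHom.Exact.kerClass (_ : f.Exact g) (i : ℕ) : RepGroup n k :=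
  clq (F'.isRational_res i) ((F.torBoundaries (originIdeal n k) i).comap
    ((f.res i).lin.restrictScalars k)) (F'.torBoundaries (originIdeal n k) i)

/-- The class of the cokernel of `Hᵢ(C) → Hᵢ(C'')`. -/
noncomputable def EqHom.Exact.cokerClass (_ : f.Exact g) (i : ℕ) : RepGroup n k :=
  clq (F''.isRational_res i) (F''.torCycles (originIdeal n k) i)
    ((F.torCycles (originIdeal n k) i).map ((g.res i).lin.restrictScalars k))

lemma EqHom.Exact.cls_tor_add_defect (h : f.Exact g) (i : ℕ) :
    (F.tor i).cls + h.kerClass i + h.cokerClass i = (F'.tor i).cls + (F''.tor i).cls := by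
  set J := originIdeal n k
  rw [kerClass, cokerClass]
  rw [F.cls_tor, F'.cls_tor, F''.cls_tor]
  have hinj : ∀ x : (F'.toEqMod.res i).carrier,
      (f.res i).lin x ∈ (J • ⊤ : Submodule (CoordRing n k) (F.toEqMod.res i).carrier) →
      x ∈ (J • ⊤ : Submodule (CoordRing n k) (F'.toEqMod.res i).carrier) :=
    fun x hx => (f.syzIter i).mem_smul_top_of_free (h.syzIter i).injective J hx
  have hcyc : ∀ x : (F'.toEqMod.res i).carrier,
      (f.res i).lin x ∈ F.torCycles J i → x ∈ F'.torCycles J i := by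
    intro x hx
    cases i with
    | zero => trivial
    | succ i =>
      have hx' : F.toEqMod.diff i ((f.res (i + 1)).lin x) ∈
        (J • ⊤ : Submodule (CoordRing n k) (F.toEqMod.res i).carrier) := hx
      rw [f.diff_res] at hx'
      exact (f.syzIter i).mem_smul_top_of_free (h.syzIter i).injective J hx'
  refine clq_add_defect (F'.isRational_res i) (F.isRational_res i) (F''.isRational_res i)
    (F'.torCycles_stable originIdeal_stable i) (F'.torBoundaries_stable originIdeal_stable i)
    (F.torCycles_stable originIdeal_stable i) (F.torBoundaries_stable originIdeal_stable i)
    (F''.torCycles_stable originIdeal_stable i) (F''.torBoundaries_stable originIdeal_stable i)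
    (F'.finite_tor i) (F.finite_tor i) (F''.finite_tor i) ((f.res i).lin.restrictScalars k) ((g.res i).lin.restrictScalars k)
    (f.res i).equivariant (g.res i).equivariant (EqHom.res_comp_eq_zero h i)
    (F.toEqMod.torBoundaries_le J i) ?_ ?_ ?_ ?_ ?_ ?_
  · rintro _ ⟨x, hx, rfl⟩
    exact f.map_torCycles_le J i hx
  · rintro _ ⟨x, hx, rfl⟩
    exact f.map_torBoundaries_le J i hx
  · rintro _ ⟨x, hx, rfl⟩
    exact g.map_torCycles_le J i hx
  · apply le_antisymm
    · rintro _ ⟨x, hx, rfl⟩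
      exact g.map_torBoundaries_le J i hx
    · exact fun x hx => h.exists_torBoundaries J i hx
  · exact fun x hx => hcyc x (F.toEqMod.torBoundaries_le J i hx)
  -- Exactness of homology in the middle. If `g z` is a boundary, subtract a lift `d w` of its
  -- boundary part; the difference maps to `J P''`, so it is `j + f x`. Then `f x` is a cycle, being
  -- `z` minus a boundary, and injectivity modulo `J` makes `x` a cycle.
  · intro z hz hbz
    obtain ⟨y, hy, _, ⟨w, rfl⟩, hyw⟩ := Submodule.mem_sup.1
      (show (g.res i).lin z ∈ (J • ⊤ : Submodule (CoordRing n k) (F''.toEqMod.res i).carrier) ⊔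
        LinearMap.range (F''.toEqMod.diff i) from hbz)
    obtain ⟨w, rfl⟩ := (h.syzIter (i + 1)).free.surjective w
    have h1 : (g.res i).lin (z - F.toEqMod.diff i w) ∈
        (J • ⊤ : Submodule (CoordRing n k) (F''.toEqMod.res i).carrier) := by
      rw [map_sub, ← hyw, ← g.diff_res]
      simpa using hy
    obtain ⟨j, hj, _, ⟨x, rfl⟩, hx⟩ :=
      Submodule.mem_sup.1 ((EqHom.mem_smul_top_iff_sup h J i _).1 h1)
    have h2 : j + F.toEqMod.diff i w ∈ F.torBoundaries J i := Submodule.add_mem_sup hj ⟨w, rfl⟩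
    have h3 : z = (j + F.toEqMod.diff i w) + (f.res i).lin x := by
      rw [add_right_comm, hx, sub_add_cancel]
    refine h3 ▸ Submodule.add_mem_sup h2 ⟨x, hcyc x ?_, rfl⟩
    rw [show (f.res i).lin x = z - (j + F.toEqMod.diff i w) by rw [h3]; abel]
    exact Submodule.sub_mem _ hz (F.toEqMod.torBoundaries_le J i h2)

/-- The connecting homomorphism identifies the cokernel of `Hᵢ₊₁(C) → Hᵢ₊₁(C'')` with the kernel of
`Hᵢ(C') → Hᵢ(C)`. -/
lemma EqHom.Exact.cokerClass_succ (h : f.Exact g) (i : ℕ) :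
    h.cokerClass (i + 1) = h.kerClass i := by
  set J := originIdeal n k
  have hst : ∀ M : EqMod (coordAct n k), Stable M.ρ
      ((J • ⊤ : Submodule (CoordRing n k) M.carrier).restrictScalars k) :=
    fun M g x hx => M.smul_top_stable originIdeal_stable g hx
  rw [kerClass, cokerClass, EqMod.torBoundaries_eq, EqMod.torBoundaries_eq]
  refine clq_connecting (F.isRational_res (i + 1)) (F''.isRational_res (i + 1))
    (F'.isRational_res i) (F.isRational_res i) (hst _) (hst _)
    (F''.torCycles_stable originIdeal_stable (i + 1))
    ((F'.toEqMod.diff i).restrictScalars k) ((F.toEqMod.diff i).restrictScalars k)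
    ((f.res (i + 1)).lin.restrictScalars k)
    ((g.res (i + 1)).lin.restrictScalars k) ((f.res i).lin.restrictScalars k) (F'.toEqMod.diff_equivariant i)
    (F.toEqMod.diff_equivariant i) (f.res (i + 1)).equivariant (g.res (i + 1)).equivariant
    (f.res i).equivariant (f.diff_res i) (h.syzIter (i + 1)).free.exact
    (h.syzIter (i + 1)).free.surjective ?_ ?_
  · ext x
    exact ⟨fun hx => (f.syzIter i).mem_smul_top_of_free (h.syzIter i).injective J hx,
      fun hx => (f.res i).mem_smul_top J hx⟩
  · rw [← restrictScalars_sup_range]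
    ext x
    refine Iff.trans ?_ (EqHom.mem_smul_top_iff_sup h J i (F.toEqMod.diff i x))
    rw [← g.diff_res]
    rfl

/-- The defects of additivity in consecutive degrees cancel through `cokerClass_succ`, so their
alternating sum telescopes. What remains are the bottom cokernel and the top kernel, and both
vanish. -/
lemma EqHom.Exact.eulerTor_eq (h : f.Exact g) :
    F.eulerTor = F'.eulerTor + F''.eulerTor := by
  set J := originIdeal n k
  -- In degree zero everything is a cycle, and `P₀ → P₀''` is onto.
  have hμ : h.cokerClass 0 = 0 := clq_self _ fun x _ => by
    obtain ⟨y, rfl⟩ := (h.syzIter 0).free.surjective x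
    exact ⟨y, trivial, rfl⟩
  set N := Fintype.card (Fin 2 × Fin n × Fin n)
  -- This kernel is the cokernel in degree `N + 2`, where every cycle of `C''` is a boundary and
  -- boundaries lift to `C`.
  have hκ : h.kerClass (N + 1) = 0 := by
    rw [← h.cokerClass_succ]
    refine clq_self _ ((F''.torCycles_le (by omega)).trans fun x hx => ?_)
    obtain ⟨y, hy, rfl⟩ := h.exists_torBoundaries J _ hx
    exact ⟨y, F.toEqMod.torBoundaries_le J _ hy, rfl⟩
  have htel : ∀ m, ∑ i ∈ Finset.range (m + 1), (-1 : ℤ) ^ i • (h.kerClass i + h.cokerClass i) =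
      (-1 : ℤ) ^ m • h.kerClass m := by
    intro m
    induction m with
    | zero => simp [hμ]
    | succ m ih =>
      rw [Finset.sum_range_succ, ih, h.cokerClass_succ, pow_succ, smul_add, mul_neg_one, neg_smul, neg_smul]
      abel
  have hsum := htel (N + 1)
  rw [hκ, smul_zero] at hsum
  unfold EqCoh.eulerTor
  rw [← Finset.sum_add_distrib, ← add_zero (Finset.sum _ _), ← hsum, ← Finset.sum_add_distrib]
  refine Finset.sum_congr rfl fun i _ => ?_
  rw [← smul_add, ← smul_add, ← h.cls_tor_add_defect, add_assoc]

end Additivity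

/-- The Gysin pull-back to the origin. -/
noncomputable def originPullback (n : ℕ) (k : Type u) [Field k] :
    EqK (coordAct n k) →+ RepGroup n k :=
  QuotientAddGroup.lift _ (FreeAbelianGroup.lift fun F : EqCoh (coordAct n k) => F.eulerTor) (by
    rw [AddSubgroup.closure_le]
    rintro x ⟨F', F, F'', ⟨i, p, hi, hp, h1, h2, h3⟩, rfl⟩
    have h : F.eulerTor = F'.eulerTor + F''.eulerTor :=
      EqHom.Exact.eulerTor_eq (f := ⟨i, hi⟩) (g := ⟨p, hp⟩) ⟨h1, h2, h3⟩
    simp [h])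

lemma originPullback_cls (F : EqCoh (coordAct n k)) :
    originPullback n k F.cls = F.eulerTor :=
  FreeAbelianGroup.lift_apply_of _ F

lemma isOriginPullback_originPullback : IsOriginPullback n k (originPullback n k) := fun F =>
  ⟨F.tor, _, F.isTor_tor, fun _ hi => F.subsingleton_tor (by omega), originPullback_cls F⟩

end Gysin

/-! ### Weight projections and homogeneous subspaces -/

lemma finrank_map_add_finrank_inf_ker {k V W : Type*} [Field k] [AddCommGroup V] [Module k V]
    [AddCommGroup W] [Module k W] (f : V →ₗ[k] W) (S : Submodule k V) [Module.Finite k S] :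
    Module.finrank k (S.map f) + Module.finrank k (S ⊓ LinearMap.ker f : Submodule k V) =
      Module.finrank k S := by
  have h := LinearMap.finrank_range_add_finrank_ker (f.domRestrict S)
  rw [LinearMap.range_domRestrict] at h
  rw [← h]
  congr 1
  have : LinearMap.ker (f.domRestrict S) =
      (S ⊓ LinearMap.ker f : Submodule k V).submoduleOf S := by
    ext x
    exact ⟨fun hx => ⟨x.2, hx⟩, fun hx => hx.2⟩
  rw [this]
  exact (Submodule.submoduleOfEquivOfLe inf_le_left).finrank_eq.symm

section Weights

variable {n : ℕ} {k : Type u} [Field k] {V W : Type u} [AddCommGroup V] [Module k V]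
  [AddCommGroup W] [Module k W] {ρ : Representation k (Grp n k) V}
  {σ : Representation k (Grp n k) W}

/-- The weight is written `w + 0` so that equivariant maps are the case `c = 0` of the lemmas on
maps that shift weights by `c`. -/
lemma mem_wtSpace_of_equivariant {f : V →ₗ[k] W} (hf : ∀ g x, f (ρ g x) = σ g (f x)) (w : Wt n)
    (x : V) (hx : x ∈ wtSpace ρ w) : f x ∈ wtSpace σ (w + 0) := by
  rw [add_zero]
  intro t
  rw [← hf, hx t, map_smul]

/-- The character of a subspace, as a function on the character lattice. -/
noncomputable def chr (ρ : Representation k (Grp n k) V) (N : Submodule k V) : Wt n → ℤ :=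
  fun w => Module.finrank k (N ⊓ wtSpace ρ w : Submodule k V)

lemma chr_bot : chr ρ ⊥ = 0 := by
  funext w
  simp [chr]

lemma chr_eq_zero {w : Wt n} (h : wtSpace ρ w = ⊥) (N : Submodule k V) : chr ρ N w = 0 := by
  rw [chr, h, inf_bot_eq, finrank_bot, Nat.cast_zero]

variable [Infinite k]

/-- Independence is the linear independence of distinct characters of the torus; spanning is
rationality. -/
lemma isInternal_wtSpace (hρ : IsRational ρ) : DirectSum.IsInternal (wtSpace ρ) := by
  refine (DirectSum.isInternal_submodule_iff_iSupIndep_and_iSup_eq_top _).2 ⟨?_, ?_⟩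
  · rw [iSupIndep_iff_finsetSum_eq_zero_imp_eq_zero]
    intro s v hv h0
    refine wt_indep (k := k) s v fun t => ?_
    have := congrArg (ρ (torus n k t)) h0
    rw [map_sum, map_zero] at this
    rw [← this]
    exact Finset.sum_congr rfl fun a ha => (hv a ha t).symm
  · rw [eq_top_iff]
    intro v _
    obtain ⟨s, u, hu, rfl⟩ := exists_wt_decomp hρ v
    exact Submodule.sum_mem _ fun w hw => Submodule.mem_iSup_of_mem w (hu w hw)

/-- The projection to a weight space of a rational representation. -/
noncomputable def wtProj (hρ : IsRational ρ) (w : Wt n) : V →ₗ[k] V :=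
  (wtSpace ρ w).subtype ∘ₗ DirectSum.component k _ _ w ∘ₗ
    (LinearEquiv.ofBijective (DirectSum.coeLinearMap (wtSpace ρ))
      (isInternal_wtSpace hρ)).symm.toLinearMap

lemma wtProj_mem (hρ : IsRational ρ) (w : Wt n) (x : V) : wtProj hρ w x ∈ wtSpace ρ w :=
  Subtype.prop _

lemma wtProj_same (hρ : IsRational ρ) {w : Wt n} {x : V} (hx : x ∈ wtSpace ρ w) :
    wtProj hρ w x = x :=
  congrArg Subtype.val ((isInternal_wtSpace hρ).ofBijective_coeLinearMap_of_mem hx)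

lemma wtProj_ne (hρ : IsRational ρ) {v w : Wt n} (hvw : v ≠ w) {x : V} (hx : x ∈ wtSpace ρ v) :
    wtProj hρ w x = 0 :=
  congrArg Subtype.val ((isInternal_wtSpace hρ).ofBijective_coeLinearMap_of_mem_ne hvw hx)

lemma exists_eq_sum_wtProj (hρ : IsRational ρ) (x : V) :
    ∃ s : Finset (Wt n), x = ∑ w ∈ s, wtProj hρ w x ∧ ∀ w ∉ s, wtProj hρ w x = 0 := by
  obtain ⟨s, u, hu, hx⟩ := exists_wt_decomp hρ x
  have h1 : ∀ w, wtProj hρ w x = if w ∈ s then u w else 0 := by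
    intro w
    rw [hx, map_sum]
    split_ifs with hw
    · rw [Finset.sum_eq_single w (fun v hv hvw => wtProj_ne hρ hvw (hu v hv))
        (fun h => absurd hw h), wtProj_same hρ (hu w hw)]
    · exact Finset.sum_eq_zero fun v hv =>
        wtProj_ne hρ (v := v) (w := w) (fun h => hw (h ▸ hv)) (hu v hv)
  refine ⟨s, ?_, fun w hw => by rw [h1, if_neg hw]⟩
  conv_lhs => rw [hx]
  exact Finset.sum_congr rfl fun w hw => by rw [h1, if_pos hw]

lemma wtProj_map (hρ : IsRational ρ) (hσ : IsRational σ) {f : V →ₗ[k] W} {c : Wt n}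
    (hf : ∀ w, ∀ x ∈ wtSpace ρ w, f x ∈ wtSpace σ (w + c)) (w : Wt n) (x : V) :
    wtProj hσ (w + c) (f x) = f (wtProj hρ w x) := by
  obtain ⟨s, u, hu, rfl⟩ := exists_wt_decomp hρ x
  rw [map_sum, map_sum, map_sum, map_sum]
  refine Finset.sum_congr rfl fun v hv => ?_
  by_cases hvw : v = w
  · subst hvw
    rw [wtProj_same hρ (hu v hv), wtProj_same hσ (hf v _ (hu v hv))]
  · rw [wtProj_ne hρ hvw (hu v hv), map_zero,
      wtProj_ne hσ (fun h => hvw (add_right_cancel h)) (hf v _ (hu v hv))]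

/-- A subspace spanned by weight vectors. -/
def Homog (hρ : IsRational ρ) (N : Submodule k V) : Prop :=
  ∀ w, ∀ x ∈ N, wtProj hρ w x ∈ N

lemma Homog.bot (hρ : IsRational ρ) : Homog hρ ⊥ := by
  rintro w x rfl
  simp

lemma Homog.top (hρ : IsRational ρ) : Homog hρ ⊤ := fun _ _ _ => trivial

lemma Homog.sup {hρ : IsRational ρ} {N N' : Submodule k V} (h : Homog hρ N) (h' : Homog hρ N') :
    Homog hρ (N ⊔ N') := by
  intro w x hx
  obtain ⟨y, hy, z, hz, rfl⟩ := Submodule.mem_sup.1 hx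
  rw [map_add]
  exact Submodule.add_mem_sup (h w y hy) (h' w z hz)

lemma Homog.inf {hρ : IsRational ρ} {N N' : Submodule k V} (h : Homog hρ N) (h' : Homog hρ N') :
    Homog hρ (N ⊓ N') := fun w x hx => ⟨h w x hx.1, h' w x hx.2⟩

lemma Homog.map {hρ : IsRational ρ} (hσ : IsRational σ) {N : Submodule k V} (h : Homog hρ N)
    {f : V →ₗ[k] W} {c : Wt n} (hf : ∀ w, ∀ x ∈ wtSpace ρ w, f x ∈ wtSpace σ (w + c)) :
    Homog hσ (N.map f) := by
  rintro w _ ⟨x, hx, rfl⟩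
  refine ⟨wtProj hρ (w - c) x, h _ x hx, ?_⟩
  rw [← wtProj_map hρ hσ hf, sub_add_cancel]

lemma Homog.comap (hρ : IsRational ρ) {hσ : IsRational σ} {N : Submodule k W} (h : Homog hσ N)
    {f : V →ₗ[k] W} {c : Wt n} (hf : ∀ w, ∀ x ∈ wtSpace ρ w, f x ∈ wtSpace σ (w + c)) :
    Homog hρ (N.comap f) := by
  intro w x hx
  change f (wtProj hρ w x) ∈ N
  rw [← wtProj_map hρ hσ hf]
  exact h _ _ hx

lemma Stable.wtProj_val {N : Submodule k V} (h : Stable ρ N) (hρ : IsRational ρ) (w : Wt n)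
    (x : N) : (wtProj (hρ.subrepresentation N h) w x : V) = wtProj hρ w x := by
  have := wtProj_map (hρ.subrepresentation N h) hρ (f := N.subtype)
    (mem_wtSpace_of_equivariant fun _ _ => rfl) w x
  rw [add_zero] at this
  exact this.symm

lemma Stable.homog {N : Submodule k V} (h : Stable ρ N) (hρ : IsRational ρ) : Homog hρ N := by
  intro w x hx
  rw [← h.wtProj_val hρ w ⟨x, hx⟩]
  exact Subtype.prop _

/-- Rank and nullity for weight spaces. -/
lemma chr_sub_chr (hρ : IsRational ρ) (hσ : IsRational σ)
    (hfρ : ∀ w, Module.Finite k (wtSpace ρ w)) (hfσ : ∀ w, Module.Finite k (wtSpace σ w))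
    {f : V →ₗ[k] W} {c : Wt n} (hf : ∀ w, ∀ x ∈ wtSpace ρ w, f x ∈ wtSpace σ (w + c))
    {N' : Submodule k V} {N : Submodule k W} (hN' : Homog hρ N') (hN : Homog hσ N) (w : Wt n) :
    chr ρ N' w - chr ρ (N' ⊓ N.comap f) w = chr σ (N'.map f ⊔ N) (w + c) - chr σ N (w + c) := by
  -- Both sides of the identity are the dimension of the weight `w + c` part of the image of `N'` in
  -- `W / N`. The rest reduces to `f` on `X` and to the subspace `Y`.
  set X := N' ⊓ wtSpace ρ w
  set Y := N ⊓ wtSpace σ (w + c)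
  have i1 : Module.Finite k X := Submodule.finiteDimensional_of_le inf_le_right
  have i2 : Module.Finite k Y := Submodule.finiteDimensional_of_le inf_le_right
  have e1 : N' ⊓ N.comap f ⊓ wtSpace ρ w = X ⊓ Y.comap f := by
    ext x
    exact ⟨fun h => ⟨⟨h.1.1, h.2⟩, h.1.2, hf w x h.2⟩, fun h => ⟨⟨h.1.1, h.2.1⟩, h.1.2⟩⟩
  have i3 : Module.Finite k (X ⊓ Y.comap f : Submodule k V) :=
    Submodule.finiteDimensional_of_le inf_le_left
  -- Here homogeneity is essential: a weight vector of a sum is the sum of the weight components of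
  -- the two summands.
  have e2 : (N'.map f ⊔ N) ⊓ wtSpace σ (w + c) = X.map f ⊔ Y := by
    apply le_antisymm
    · rintro y ⟨hy, hyw⟩
      obtain ⟨_, ⟨x, hx, rfl⟩, z, hz, rfl⟩ := Submodule.mem_sup.1 hy
      rw [← wtProj_same hσ hyw, map_add, wtProj_map hρ hσ hf]
      exact Submodule.add_mem_sup ⟨_, ⟨hN' w x hx, wtProj_mem hρ w x⟩, rfl⟩
        ⟨hN _ z hz, wtProj_mem hσ _ z⟩
    · refine sup_le ?_ (inf_le_inf_right _ le_sup_right)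
      rintro _ ⟨x, hx, rfl⟩
      exact ⟨Submodule.mem_sup_left ⟨x, hx.1, rfl⟩, hf w x hx.2⟩
  have e3 : (X ⊓ Y.comap f).map f = X.map f ⊓ Y := by
    ext y
    constructor
    · rintro ⟨x, hx, rfl⟩
      exact ⟨⟨x, hx.1, rfl⟩, hx.2⟩
    · rintro ⟨⟨x, hx, rfl⟩, hy⟩
      exact ⟨x, ⟨hx, hy⟩, rfl⟩
  have e4 : X ⊓ Y.comap f ⊓ LinearMap.ker f = X ⊓ LinearMap.ker f := by
    ext x
    refine ⟨fun h => ⟨h.1.1, h.2⟩, fun h => ⟨⟨h.1, ?_⟩, h.2⟩⟩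
    change f x ∈ Y
    rw [LinearMap.mem_ker.1 h.2]
    exact Y.zero_mem
  have f1 := finrank_map_add_finrank_inf_ker f X
  have f2 := finrank_map_add_finrank_inf_ker f (X ⊓ Y.comap f)
  have f3 := Submodule.finrank_sup_add_finrank_inf_eq (X.map f) Y
  rw [e4, e3] at f2
  change ((Module.finrank k X : ℕ) : ℤ) - Module.finrank k _ =
    (Module.finrank k _ : ℤ) - Module.finrank k Y
  rw [e1, e2]
  omega

/-- The weight multiplicities of a subquotient. -/
lemma finrank_wtSpace_subquotRep (hρ : IsRational ρ) (hfρ : ∀ w, Module.Finite k (wtSpace ρ w))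
    {Z B : Submodule k V} (hZ : Stable ρ Z) (hB : Stable ρ B) (hBZ : B ≤ Z) (w : Wt n) :
    (Module.finrank k (wtSpace (subquotRep ρ hZ hB) w) : ℤ) = chr ρ Z w - chr ρ B w := by
  have i1 : Module.Finite k (Z ⊓ wtSpace ρ w : Submodule k V) :=
    Submodule.finiteDimensional_of_le inf_le_right
  let g : (Z ⊓ wtSpace ρ w : Submodule k V) →ₗ[k] (Z ⧸ B.submoduleOf Z) :=
    (B.submoduleOf Z).mkQ ∘ₗ Submodule.inclusion inf_le_left
  have hker : LinearMap.ker g =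
      (B ⊓ wtSpace ρ w : Submodule k V).submoduleOf (Z ⊓ wtSpace ρ w) := by
    ext x
    rw [LinearMap.mem_ker]
    refine ((Submodule.Quotient.mk_eq_zero _).trans ?_)
    exact ⟨fun h => ⟨h, x.2.2⟩, fun h => h.1⟩
  have hrange : LinearMap.range g = wtSpace (subquotRep ρ hZ hB) w := by
    apply le_antisymm
    · rintro _ ⟨x, rfl⟩ t
      refine congrArg (B.submoduleOf Z).mkQ (Subtype.ext ?_ :
        ρ.subrepresentation Z hZ (torus n k t) (Submodule.inclusion inf_le_left x) =
          wtChar k w t • Submodule.inclusion inf_le_left x)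
      exact x.2.2 t
    -- A weight vector of the quotient lifts to a weight vector, namely the weight projection of any
    -- lift.
    · intro y hy
      obtain ⟨z, rfl⟩ := Submodule.mkQ_surjective _ y
      refine ⟨⟨wtProj hρ w z, hZ.homog hρ w z z.2, wtProj_mem hρ w z⟩, ?_⟩
      have h1 := wtProj_map (hρ.subrepresentation Z hZ) (hρ.subquotRep hZ hB)
        (f := (B.submoduleOf Z).mkQ) (mem_wtSpace_of_equivariant fun _ _ => rfl) w z
      rw [add_zero, wtProj_same _ hy] at h1
      rw [h1]
      exact congrArg (B.submoduleOf Z).mkQ (Subtype.ext (hZ.wtProj_val hρ w z).symm)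
  have h := LinearMap.finrank_range_add_finrank_ker g
  rw [hker, (Submodule.submoduleOfEquivOfLe (inf_le_inf_right _ hBZ)).finrank_eq, hrange] at h
  unfold chr
  omega

end Weights

/-! ### Convolution of Laurent polynomials with functions on the character lattice -/

section Convolution

variable {n : ℕ}

/-- The action of Laurent polynomials on functions on the character lattice by convolution. -/
noncomputable def conv (n : ℕ) : Laurent n →ₐ[ℤ] Module.End ℤ (Wt n → ℤ) :=
  AddMonoidAlgebra.lift ℤ _ (Wt n)
    { toFun := fun a => LinearMap.funLeft ℤ ℤ fun w => w - a.toAdd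
      map_one' := by
        ext φ w
        simp [LinearMap.funLeft_apply]
      map_mul' := fun a b => by
        refine LinearMap.ext fun φ => funext fun w => ?_
        simp only [LinearMap.funLeft_apply, Module.End.mul_apply, toAdd_mul]
        congr 1
        abel }

lemma conv_single (a : Wt n) (r : ℤ) (φ : Wt n → ℤ) (w : Wt n) :
    conv n (AddMonoidAlgebra.single a r) φ w = r * φ (w - a) := by
  simp [conv, AddMonoidAlgebra.lift_single, LinearMap.funLeft_apply]

/-- On finitely supported functions convolution is multiplication in the Laurent ring. This connects
characters of infinite support with genuine Laurent polynomials. -/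
lemma conv_coeff (f g : Laurent n) : conv n f g.coeff = (f * g).coeff := by
  induction f using AddMonoidAlgebra.induction_linear with
  | zero => rw [map_zero, zero_mul]; rfl
  | add f₁ f₂ h₁ h₂ =>
    rw [map_add, add_mul, LinearMap.add_apply, h₁, h₂]
    rfl
  | single a r =>
    induction g using AddMonoidAlgebra.induction_linear with
    | zero => rw [mul_zero]; exact map_zero _
    | add g₁ g₂ h₁ h₂ =>
      rw [mul_add]
      exact (map_add (conv n (AddMonoidAlgebra.single a r)) _ _).trans (congrArg₂ (· + ·) h₁ h₂)
    | single b s =>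
      rw [AddMonoidAlgebra.single_mul_single]
      funext w
      rw [conv_single]
      change r * (Finsupp.single b s) (w - a) = (Finsupp.single (a + b) (r * s)) w
      rw [Finsupp.single_apply, Finsupp.single_apply]
      simp only [eq_sub_iff_add_eq, add_comm b a]
      split_ifs <;> simp

/-- The factor `1 - e^c`. -/
noncomputable def oneSub (c : Wt n) : Laurent n := 1 - AddMonoidAlgebra.single c 1

lemma conv_oneSub (c : Wt n) (φ : Wt n → ℤ) (w : Wt n) :
    conv n (oneSub c) φ w = φ w - φ (w - c) := by
  rw [oneSub, map_sub, map_one, LinearMap.sub_apply, Pi.sub_apply, conv_single, one_mul]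
  rfl

end Convolution

/-! ### Weights of equivariant modules over `gl_n ⊕ gl_n` -/

section Degrees

variable {n : ℕ} {k : Type u} [Field k]

/-- The weight of a coordinate function. -/
def coordWt (a : Fin 2 × Fin n × Fin n) : Wt n :=
  (Pi.single a.2.2 1 - Pi.single a.2.1 1, if a.1 = 0 then -1 else 0, if a.1 = 0 then 0 else -1)

/-- The weight of a monomial. -/
noncomputable def monoWt (β : (Fin 2 × Fin n × Fin n) →₀ ℕ) : Wt n :=
  Finsupp.linearCombination ℕ coordWt β

/-- The degree of a weight, normalized such that the coordinate functions have degree one. -/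
def wtDeg : Wt n →+ ℤ where
  toFun w := -(w.2.1 + w.2.2)
  map_zero' := by simp
  map_add' v w := by simp; ring

lemma wtDeg_coordWt (a : Fin 2 × Fin n × Fin n) : wtDeg (coordWt a) = 1 := by
  by_cases h : a.1 = 0 <;> simp [wtDeg, coordWt, h]

lemma wtDeg_monoWt (β : (Fin 2 × Fin n × Fin n) →₀ ℕ) : wtDeg (monoWt β) = β.degree := by
  rw [monoWt, Finsupp.linearCombination_apply, Finsupp.sum, map_sum, Finsupp.degree_apply,
    Nat.cast_sum]
  refine Finset.sum_congr rfl fun a _ => ?_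
  rw [map_nsmul, wtDeg_coordWt]
  simp

/-- Functions are translated by `g⁻¹`, so the `(i, j)` entry of the matrix `l` is scaled by `t_l⁻¹
t_i⁻¹ t_j`, with inverse powers of the scalars. -/
lemma coordAct_torus_X (t : (Fin n → kˣ) × kˣ × kˣ) (a : Fin 2 × Fin n × Fin n) :
    coordAct n k (torus n k t) (MvPolynomial.X a) =
      wtChar k (coordWt a) t • (MvPolynomial.X a : CoordRing n k) := by
  obtain ⟨l, i, j⟩ := a
  change translate _ _ = _
  rw [translate, MvPolynomial.aeval_X, movedMat]
  have h1 : ((torus n k t).1⁻¹ : Matrix.GeneralLinearGroup (Fin n) k) = (torus n k t⁻¹).1 := by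
    rw [map_inv]; rfl
  have h2 : ((torus n k t).1 : Matrix (Fin n) (Fin n) k) =
      Matrix.diagonal fun i => (t.1 i : k) := rfl
  have h3 : ((torus n k t⁻¹).1 : Matrix (Fin n) (Fin n) k) =
      Matrix.diagonal fun i => ((t.1 i)⁻¹ : k) := by
    ext i j
    simp [torus, Matrix.diagonal_apply]
  rw [h1, h2, h3, Matrix.diagonal_map (map_zero _), Matrix.diagonal_map (map_zero _),
    Matrix.smul_apply, Matrix.mul_diagonal, Matrix.diagonal_mul]
  have h4 : wtChar k (coordWt (l, i, j)) t =
      (((scal (torus n k t) l)⁻¹ : kˣ) : k) * ((t.1 i)⁻¹ : k) * (t.1 j : k) := by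
    have h5 : ∏ a, t.1 a ^ (coordWt (l, i, j)).1 a = (t.1 i)⁻¹ * t.1 j := by
      simp only [coordWt, Pi.sub_apply, zpow_sub, Finset.prod_mul_distrib, Finset.prod_inv_distrib,
        Pi.single_apply]
      simp [mul_comm]
    change (((∏ a, t.1 a ^ (coordWt (l, i, j)).1 a) * _ * _ : kˣ) : k) = _
    rw [h5]
    by_cases hl : l = 0
    · simp [coordWt, scal, torus, hl]; ring
    · simp [coordWt, scal, torus, hl]; ring
  rw [h4, MvPolynomial.smul_eq_C_mul]
  simp only [genMat, Matrix.of_apply, map_mul, smul_eq_mul]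
  ring

variable {M : EqMod (coordAct n k)}

lemma X_smul_mem_wtSpace (a : Fin 2 × Fin n × Fin n) (w : Wt n) (x : M.carrier)
    (hx : x ∈ wtSpace M.ρ w) :
    (MvPolynomial.X a : CoordRing n k) • x ∈ wtSpace M.ρ (w + coordWt a) := by
  intro t
  rw [M.semilinear, coordAct_torus_X, hx t, wtChar_add, smul_assoc,
    smul_comm (MvPolynomial.X a : CoordRing n k), smul_smul, mul_comm]

lemma monomial_smul_mem_wtSpace (β : (Fin 2 × Fin n × Fin n) →₀ ℕ) :
    ∀ (w : Wt n), ∀ x ∈ wtSpace M.ρ w,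
      (MvPolynomial.monomial β 1 : CoordRing n k) • x ∈ wtSpace M.ρ (w + monoWt β) := by
  induction β using Finsupp.induction_linear with
  | zero =>
    intro w x hx
    have h : (MvPolynomial.monomial 0 1 : CoordRing n k) = 1 := rfl
    rw [h, one_smul]
    simpa [monoWt] using hx
  | add β γ hβ hγ =>
    intro w x hx
    have h : (MvPolynomial.monomial (β + γ) 1 : CoordRing n k) =
        MvPolynomial.monomial γ 1 * MvPolynomial.monomial β 1 := by
      rw [MvPolynomial.monomial_mul, one_mul, add_comm]
    rw [h, mul_smul, monoWt, map_add, ← add_assoc]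
    exact hγ _ _ (hβ _ _ hx)
  | single a m =>
    intro w x hx
    rw [monoWt, Finsupp.linearCombination_single, ← MvPolynomial.X_pow_eq_monomial]
    induction m with
    | zero => simpa using hx
    | succ m ih =>
      rw [pow_succ', mul_smul, succ_nsmul, ← add_assoc]
      exact X_smul_mem_wtSpace a _ _ ih

lemma EqMod.tmul_mem_wtSpace_free {w : Wt n} {x : M.carrier} (hx : x ∈ wtSpace M.ρ w) :
    ((1 : CoordRing n k) ⊗ₜ[k] x : M.free.carrier) ∈ wtSpace M.free.ρ w := by
  intro t
  change (coordAct n k (torus n k t) 1) ⊗ₜ[k] (M.ρ (torus n k t) x) =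
    wtChar k w t • ((1 : CoordRing n k) ⊗ₜ[k] x)
  rw [map_one, hx t, TensorProduct.tmul_smul]

lemma mem_wtSpace_syz {w : Wt n} (x : M.syz.carrier) :
    x ∈ wtSpace M.syz.ρ w ↔ (x.1 : M.free.carrier) ∈ wtSpace M.free.ρ w :=
  ⟨fun h t => congrArg Subtype.val (h t), fun h t => Subtype.ext (h t)⟩

/-- The weights of `M` have degree at least `d`. -/
def DegGE (M : EqMod (coordAct n k)) (d : ℤ) : Prop := ∀ w, wtDeg w < d → wtSpace M.ρ w = ⊥

/-- The weight spaces of `M` are finite dimensional. -/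
def WtFin (M : EqMod (coordAct n k)) : Prop := ∀ w, Module.Finite k (wtSpace M.ρ w)

lemma WtFin.syz (h : WtFin M.free) : WtFin M.syz := by
  intro w
  have := h w
  let f : wtSpace M.syz.ρ w →ₗ[k] wtSpace M.free.ρ w :=
    { toFun := fun x => ⟨x.1.1, (mem_wtSpace_syz x.1).1 x.2⟩
      map_add' := fun _ _ => rfl
      map_smul' := fun _ _ => rfl }
  refine Module.Finite.of_injective f fun x y hxy => Subtype.ext ?_
  have h1 : (x.1 : LinearMap.ker M.counit).1 = (y.1 : LinearMap.ker M.counit).1 :=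
    congrArg (fun z => z.1) hxy
  exact Subtype.ext h1

variable [Infinite k]

/-- The weight spaces of a module generated by weight vectors. -/
lemma wtSpace_le_span (hM : IsRational M.ρ) {ι : Type*} (m : ι → M.carrier) (v : ι → Wt n)
    (hm : ∀ i, m i ∈ wtSpace M.ρ (v i)) (hspan : Submodule.span (CoordRing n k) (Set.range m) = ⊤)
    (w : Wt n) : wtSpace M.ρ w ≤ Submodule.span k
      {x | ∃ i β, v i + monoWt β = w ∧ x = (MvPolynomial.monomial β 1 : CoordRing n k) • m i} := by
  have key : ∀ x : M.carrier, wtProj hM w x ∈ Submodule.span k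
      {x | ∃ i β, v i + monoWt β = w ∧
        x = (MvPolynomial.monomial β 1 : CoordRing n k) • m i} := by
    intro x
    have hx : x ∈ Submodule.span (CoordRing n k) (Set.range m) := hspan ▸ trivial
    rw [← Set.image_univ] at hx
    obtain ⟨c, -, rfl⟩ := (Finsupp.mem_span_image_iff_linearCombination _).1 hx
    rw [Finsupp.linearCombination_apply, Finsupp.sum, map_sum]
    refine Submodule.sum_mem _ fun i _ => ?_
    rw [(c i).as_sum, Finset.sum_smul, map_sum]
    refine Submodule.sum_mem _ fun β _ => ?_
    have h1 : (MvPolynomial.monomial β ((c i).coeff β) : CoordRing n k) =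
        (c i).coeff β • MvPolynomial.monomial β 1 := by
      rw [MvPolynomial.smul_monomial, smul_eq_mul, mul_one]
    rw [h1, smul_assoc, map_smul]
    refine Submodule.smul_mem _ _ ?_
    have h2 := monomial_smul_mem_wtSpace β _ _ (hm i)
    by_cases h : v i + monoWt β = w
    · rw [h] at h2
      rw [wtProj_same hM h2]
      exact Submodule.subset_span ⟨i, β, h, rfl⟩
    · rw [wtProj_ne hM h h2]
      exact Submodule.zero_mem _
  intro x hx
  rw [← wtProj_same hM hx]
  exact key x

/-- Replace finitely many generators by their weight components. A weight vector is then a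
combination of monomials times generators, where the degree of the monomial is determined by the
weight and the generator; this leaves finitely many possibilities and bounds the degree below. -/
lemma EqCoh.wtFin_degGE (F : EqCoh (coordAct n k)) :
    WtFin F.toEqMod ∧ ∃ d, DegGE F.toEqMod d := by
  classical
  obtain ⟨S, hS⟩ := F.finite.fg_top
  choose s hs _ using fun x => exists_eq_sum_wtProj F.rational x
  let T : Finset (Wt n × F.carrier) := S.biUnion fun x => (s x).image fun w => (w, x)
  let m : T → F.carrier := fun p => wtProj F.rational p.1.1 p.1.2
  let v : T → Wt n := fun p => p.1.1
  have hm : ∀ i, m i ∈ wtSpace F.ρ (v i) := fun i => wtProj_mem _ _ _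
  have hspan : Submodule.span (CoordRing n k) (Set.range m) = ⊤ := by
    rw [eq_top_iff, ← hS, Submodule.span_le]
    intro x hx
    rw [hs x]
    refine Submodule.sum_mem _ fun w hw => Submodule.subset_span ⟨⟨(w, x), ?_⟩, rfl⟩
    exact Finset.mem_biUnion.2 ⟨x, hx, Finset.mem_image_of_mem _ hw⟩
  have hle := wtSpace_le_span F.rational m v hm hspan
  constructor
  · intro w
    have hfin : {x | ∃ i β, v i + monoWt β = w ∧
        x = (MvPolynomial.monomial β 1 : CoordRing n k) • m i}.Finite := by
      refine (Set.finite_iUnion fun i : T =>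
        (Finsupp.finite_of_degree_le (wtDeg (w - v i)).toNat).image
          fun β => (MvPolynomial.monomial β 1 : CoordRing n k) • m i).subset ?_
      rintro _ ⟨i, β, h, rfl⟩
      refine Set.mem_iUnion.2 ⟨i, β, ?_, rfl⟩
      rw [← h, add_sub_cancel_left, wtDeg_monoWt]
      simp
    have := FiniteDimensional.span_of_finite k hfin
    exact Submodule.finiteDimensional_of_le (hle w)
  · obtain ⟨d, hd⟩ := (Set.finite_range fun i : T => wtDeg (v i)).bddBelow
    refine ⟨d, fun w hw => ?_⟩
    rw [eq_bot_iff]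
    refine (hle w).trans (Submodule.span_le.2 ?_)
    rintro _ ⟨i, β, h, rfl⟩
    exfalso
    have h1 : d ≤ wtDeg (v i) := hd ⟨i, rfl⟩
    rw [← h, map_add, wtDeg_monoWt] at hw
    omega

/-- The elements `1 ⊗ y` with `y` a weight vector of `M` generate `A ⊗ₖ M`, so `wtSpace_le_span`
applies, with a generating family that need not be finite. -/
lemma EqMod.wtSpace_free_le (hM : IsRational M.ρ) (w : Wt n) :
    wtSpace M.free.ρ w ≤ Submodule.span k {x | ∃ v β, v + monoWt β = w ∧ ∃ y ∈ wtSpace M.ρ v,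
      x = ((MvPolynomial.monomial β 1 : CoordRing n k) ⊗ₜ[k] y : CoordRing n k ⊗[k] M.carrier)} := by
  let m : (Σ w : Wt n, wtSpace M.ρ w) → M.free.carrier := fun p => (1 : CoordRing n k) ⊗ₜ[k] p.2.1
  have hspan : Submodule.span (CoordRing n k) (Set.range m) = ⊤ := by
    refine Submodule.eq_top_iff'.2 fun x => ?_
    change CoordRing n k ⊗[k] M.carrier at x
    induction x using TensorProduct.induction_on with
    | zero => exact Submodule.zero_mem _
    | tmul a y =>
      obtain ⟨s, u, hu, rfl⟩ := exists_wt_decomp hM y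
      rw [TensorProduct.tmul_sum]
      refine Submodule.sum_mem _ fun w hw => ?_
      have h1 : a ⊗ₜ[k] u w = a • ((1 : CoordRing n k) ⊗ₜ[k] u w) := by
        rw [TensorProduct.smul_tmul', smul_eq_mul, mul_one]
      exact h1 ▸ Submodule.smul_mem _ a (Submodule.subset_span ⟨⟨w, u w, hu w hw⟩, rfl⟩)
    | add x y hx hy => exact Submodule.add_mem _ hx hy
  refine (wtSpace_le_span (EqMod.isRational_free hM) m (fun p => p.1)
    (fun p => EqMod.tmul_mem_wtSpace_free p.2.2) hspan w).trans (Submodule.span_mono ?_)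
  rintro _ ⟨⟨v, y⟩, β, h, rfl⟩
  refine ⟨v, β, h, y.1, y.2, ?_⟩
  change (MvPolynomial.monomial β 1 : CoordRing n k) • ((1 : CoordRing n k) ⊗ₜ[k] y.1) = _
  rw [TensorProduct.smul_tmul', smul_eq_mul, mul_one]

lemma DegGE.free (hM : IsRational M.ρ) {d : ℤ} (h : DegGE M d) : DegGE M.free d := by
  intro w hw
  rw [eq_bot_iff]
  refine (EqMod.wtSpace_free_le hM w).trans (Submodule.span_le.2 ?_)
  rintro _ ⟨v, β, hv, y, hy, rfl⟩
  have h1 : wtDeg v < d := by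
    rw [← hv, map_add, wtDeg_monoWt] at hw
    omega
  rw [h v h1] at hy
  rw [(Submodule.mem_bot k).1 hy]
  exact TensorProduct.tmul_zero _ _

/-- The weight space of `w` in `A ⊗ₖ M` is assembled from `monomial β ⊗ M_v` with `v + monoWt β =
w`. The lower bound `d` on degrees in `M` bounds the degree of `β`, leaving finitely many `β`. -/
lemma WtFin.free (hM : IsRational M.ρ) {d : ℤ} (h : DegGE M d) (hf : WtFin M) :
    WtFin M.free := by
  intro w
  let e : ((Fin 2 × Fin n × Fin n) →₀ ℕ) → M.carrier →ₗ[k] (CoordRing n k ⊗[k] M.carrier) :=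
    fun β => TensorProduct.mk k _ _ (MvPolynomial.monomial β 1 : CoordRing n k)
  let s := {β : (Fin 2 × Fin n × Fin n) →₀ ℕ | β.degree ≤ (wtDeg w - d).toNat}
  have hs : Finite s := (Finsupp.finite_of_degree_le _).to_subtype
  let N : Submodule k (CoordRing n k ⊗[k] M.carrier) :=
    ⨆ β : s, (wtSpace M.ρ (w - monoWt β.1)).map (e β.1)
  have hfin : Module.Finite k N := by
    have : ∀ β : s, Module.Finite k (wtSpace M.ρ (w - monoWt β.1)) := fun β => hf _
    exact Submodule.finite_iSup _
  let N₀ : Submodule k (CoordRing n k ⊗[k] M.carrier) := wtSpace M.free.ρ w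
  suffices hle : N₀ ≤ N by
    have h1 : Module.Finite k N₀ := Submodule.finiteDimensional_of_le hle
    exact h1
  refine (EqMod.wtSpace_free_le hM w).trans (Submodule.span_le.2 ?_)
  rintro _ ⟨v, β, hv, y, hy, rfl⟩
  by_cases hd : wtDeg v < d
  · rw [h v hd] at hy
    rw [(Submodule.mem_bot k).1 hy, TensorProduct.tmul_zero]
    exact Submodule.zero_mem _
  · have hβ : β ∈ s := by
      change β.degree ≤ (wtDeg w - d).toNat
      rw [← hv, map_add, wtDeg_monoWt]
      omega
    refine Submodule.mem_iSup_of_mem ⟨β, hβ⟩ ⟨y, ?_, rfl⟩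
    rwa [← hv, add_sub_cancel_right]

/-- Passing to syzygies raises the degree. -/
lemma DegGE.syz (hM : IsRational M.ρ) {d : ℤ} (h : DegGE M d) : DegGE M.syz (d + 1) := by
  intro w hw
  rw [eq_bot_iff]
  intro x hx
  -- In degree at most `d` only the constant monomial contributes to `A ⊗ₖ M`, so such a vector is
  -- `1 ⊗ y`, and the counit sends it to `y`. A syzygy of this degree is therefore zero.
  have h1 : (x.1 : CoordRing n k ⊗[k] M.carrier) ∈
      LinearMap.range (TensorProduct.mk k (CoordRing n k) M.carrier 1) := by
    let N₀ : Submodule k (CoordRing n k ⊗[k] M.carrier) := wtSpace M.free.ρ w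
    suffices hle : N₀ ≤ LinearMap.range (TensorProduct.mk k (CoordRing n k) M.carrier 1) from
      hle ((mem_wtSpace_syz x).1 hx)
    refine (EqMod.wtSpace_free_le hM w).trans (Submodule.span_le.2 ?_)
    rintro _ ⟨v, β, hv, y, hy, rfl⟩
    by_cases hd : wtDeg v < d
    · rw [h v hd] at hy
      rw [(Submodule.mem_bot k).1 hy, TensorProduct.tmul_zero]
      exact Submodule.zero_mem _
    · have hβ : β = 0 := by
        rw [← Finsupp.degree_eq_zero_iff]
        rw [← hv, map_add, wtDeg_monoWt] at hw
        omega
      subst hβ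
      exact ⟨y, rfl⟩
  obtain ⟨y, hy⟩ := h1
  have h2 : M.counit x.1 = 0 := x.2
  have h3 : M.counit x.1 = y := by
    rw [← hy]
    change (LinearMap.liftBaseChange (CoordRing n k)
      (LinearMap.id : M.carrier →ₗ[k] M.carrier)) ((1 : CoordRing n k) ⊗ₜ[k] y) = y
    simp
  refine (Submodule.mem_bot k).2 (Subtype.ext ?_)
  rw [← hy, ← h3, h2]
  exact TensorProduct.tmul_zero _ _

lemma degGE_wtFin_syzIter (hM : IsRational M.ρ) {d : ℤ} (h : DegGE M d) (hf : WtFin M) (i : ℕ) :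
    DegGE (M.syzIter i) (d + i) ∧ WtFin (M.syzIter i) := by
  induction i with
  | zero => simpa using ⟨h, hf⟩
  | succ i ih =>
    have hr := EqMod.isRational_syzIter hM i
    refine ⟨?_, (ih.2.free hr ih.1).syz⟩
    have := ih.1.syz hr
    rwa [add_assoc] at this

end Degrees

/-! ### The character of `∑ᵢ (-1)ⁱ Tor_i(k, F)` -/

section Euler

variable {n : ℕ} {k : Type u} [Field k]

/-- The ideal generated by a set of coordinate functions. -/
noncomputable def coordIdeal (k : Type u) [Field k] (s : Finset (Fin 2 × Fin n × Fin n)) :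
    Ideal (CoordRing n k) :=
  Ideal.span (MvPolynomial.X '' (s : Set (Fin 2 × Fin n × Fin n)))

/-- Multiplication by a coordinate function. -/
noncomputable def mulX (M : EqMod (coordAct n k)) (a : Fin 2 × Fin n × Fin n) :
    M.carrier →ₗ[k] M.carrier :=
  (LinearMap.lsmul (CoordRing n k) M.carrier (MvPolynomial.X a)).restrictScalars k

variable {M : EqMod (coordAct n k)}

lemma smul_top_coordIdeal_insert (a : Fin 2 × Fin n × Fin n)
    (s : Finset (Fin 2 × Fin n × Fin n)) :
    (coordIdeal k (insert a s) • ⊤ : Submodule (CoordRing n k) M.carrier).restrictScalars k =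
      (⊤ : Submodule k M.carrier).map (mulX M a) ⊔
        (coordIdeal k s • ⊤ : Submodule (CoordRing n k) M.carrier).restrictScalars k := by
  rw [coordIdeal, Finset.coe_insert, Set.image_insert_eq, Ideal.span_insert, Submodule.sup_smul,
    Submodule.ideal_span_singleton_smul, Submodule.restrictScalars_sup]
  congr 1

variable [Infinite k]

lemma homog_smul_top_coordIdeal (hM : IsRational M.ρ) (s : Finset (Fin 2 × Fin n × Fin n)) :
    Homog hM ((coordIdeal k s • ⊤ :
      Submodule (CoordRing n k) M.carrier).restrictScalars k) := by
  induction s using Finset.induction_on with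
  | empty =>
    have : (coordIdeal k (∅ : Finset (Fin 2 × Fin n × Fin n)) • ⊤ :
        Submodule (CoordRing n k) M.carrier) = ⊥ := by simp [coordIdeal]
    rw [this]
    exact Homog.bot hM
  | insert a s _ ih =>
    rw [smul_top_coordIdeal_insert]
    exact ((Homog.top hM).map hM (X_smul_mem_wtSpace a)).sup ih

/-- The character of a free module modulo some of the coordinate functions. -/
lemma conv_prod_oneSub_chr_top (hM : IsRational M.ρ) (hf : WtFin M)
    [Module.Free (CoordRing n k) M.carrier] (s : Finset (Fin 2 × Fin n × Fin n)) :
    conv n (∏ a ∈ s, oneSub (coordWt a)) (chr M.ρ ⊤) = chr M.ρ ⊤ -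
      chr M.ρ ((coordIdeal k s • ⊤ :
        Submodule (CoordRing n k) M.carrier).restrictScalars k) := by
  induction s using Finset.induction_on with
  | empty =>
    have : (coordIdeal k (∅ : Finset (Fin 2 × Fin n × Fin n)) • ⊤ :
        Submodule (CoordRing n k) M.carrier) = ⊥ := by simp [coordIdeal]
    rw [this, Finset.prod_empty, map_one, Submodule.restrictScalars_bot, chr_bot, sub_zero]
    rfl
  | insert a s ha ih =>
    rw [Finset.prod_insert ha, map_mul, Module.End.mul_apply, ih]
    funext w
    rw [conv_oneSub]
    have h := chr_sub_chr hM hM hf hf (f := mulX M a) (c := coordWt a) (X_smul_mem_wtSpace a)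
      (Homog.top hM) (homog_smul_top_coordIdeal hM s) (w - coordWt a)
    -- `X a` is regular on `M` modulo the variables in `s`, so the kernel contributes nothing and
    -- passing to the quotient by `X a` multiplies the character by `1 - e^c`.
    have hcomap : (⊤ : Submodule k M.carrier) ⊓ ((coordIdeal k s • ⊤ :
        Submodule (CoordRing n k) M.carrier).restrictScalars k).comap (mulX M a) =
        (coordIdeal k s • ⊤ : Submodule (CoordRing n k) M.carrier).restrictScalars k := by
      ext x
      refine ⟨fun hx => mem_of_X_smul_mem (a := a) (fun h => ha (by simpa using h)) hx.2,
        fun hx => ⟨trivial, ?_⟩⟩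
      exact Submodule.smul_mem (coordIdeal k s • ⊤ : Submodule (CoordRing n k) M.carrier)
        (MvPolynomial.X a) hx
    rw [hcomap, ← smul_top_coordIdeal_insert, sub_add_cancel] at h
    simp only [Pi.sub_apply]
    linarith

/-- The product of the factors `1 - e^c` over all weights of coordinate functions. -/
noncomputable def koszulFactor (n : ℕ) : Laurent n := ∏ a, oneSub (coordWt a)

/-- Coordinate weights have degree one, so convolution with these factors never moves support to
lower degree. -/
lemma conv_prod_oneSub_eq_zero (s : Finset (Fin 2 × Fin n × Fin n)) (φ : Wt n → ℤ) (e : ℤ)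
    (hφ : ∀ w, wtDeg w ≤ e → φ w = 0) :
    ∀ w, wtDeg w ≤ e → conv n (∏ a ∈ s, oneSub (coordWt a)) φ w = 0 := by
  induction s using Finset.induction_on with
  | empty => simpa using hφ
  | insert a s ha ih =>
    intro w hw
    rw [Finset.prod_insert ha, map_mul, Module.End.mul_apply, conv_oneSub, ih w hw, ih, sub_zero]
    rw [map_sub, wtDeg_coordWt]
    omega

/-- Additivity of characters for `0 → Ω M → A ⊗ₖ M → M → 0`. -/
lemma chr_free (hM : IsRational M.ρ) (hf : WtFin M) (hf' : WtFin M.free) :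
    chr M.free.ρ ⊤ = chr M.ρ ⊤ + chr M.syz.ρ ⊤ := by
  funext w
  have h := chr_sub_chr (EqMod.isRational_free hM) hM hf' hf (f := M.counit.restrictScalars k)
    (c := 0) (mem_wtSpace_of_equivariant M.counit_equivariant) (Homog.top _) (Homog.bot hM) w
  have h1 : (⊤ : Submodule k M.carrier) = (⊤ : Submodule k M.free.carrier).map
      (M.counit.restrictScalars k) ⊔ ⊥ := by
    rw [sup_bot_eq, Submodule.map_top]
    exact (LinearMap.range_eq_top_of_surjective
      (M.counit.restrictScalars k) M.counit_surjective).symm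
  rw [← h1, chr_bot, add_zero] at h
  have h2 : chr M.free.ρ (⊤ ⊓ (⊥ : Submodule k M.carrier).comap (M.counit.restrictScalars k)) w =
      chr M.syz.ρ ⊤ w := by
    unfold chr
    congr 1
    let f : wtSpace M.syz.ρ w →ₗ[k] M.free.carrier :=
      { toFun := fun x => x.1.1
        map_add' := fun _ _ => rfl
        map_smul' := fun _ _ => rfl }
    have hinj : Function.Injective f := by
      intro x y hxy
      have h1 : (x.1 : LinearMap.ker M.counit) = y.1 := Subtype.ext hxy
      exact Subtype.ext h1
    have hr : LinearMap.range f =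
        ⊤ ⊓ (⊥ : Submodule k M.carrier).comap (M.counit.restrictScalars k) ⊓
          wtSpace M.free.ρ w := by
      ext x
      constructor
      · rintro ⟨y, rfl⟩
        exact ⟨⟨trivial, y.1.2⟩, (mem_wtSpace_syz y.1).1 y.2⟩
      · rintro ⟨⟨-, hx⟩, hxw⟩
        exact ⟨⟨(⟨x, hx⟩ : LinearMap.ker M.counit), (mem_wtSpace_syz (M := M) ⟨x, hx⟩).2 hxw⟩, rfl⟩
    rw [← hr, LinearMap.finrank_range_of_inj hinj, top_inf_eq]
  rw [h2] at h
  simp only [Pi.add_apply, Pi.zero_apply] at h ⊢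
  linarith

lemma coeff_ch_apply (V : RatRep n k) (w : Wt n) :
    V.ch.coeff w = Module.finrank k (wtSpace V.ρ w) := rfl

lemma charHom_cls (V : RatRep n k) : charHom n k V.cls = V.ch :=
  FreeAbelianGroup.lift_apply_of _ V

/-- The character of `∑ᵢ (-1)ⁱ Tor_i(k, F)` is the character of `F` multiplied by `1 - e^c` for
the weights `c` of all coordinate functions. -/
theorem EqCoh.coeff_charHom_eulerTor (F : EqCoh (coordAct n k)) :
    ((charHom n k F.eulerTor).coeff : Wt n → ℤ) = conv n (koszulFactor n) (chr F.ρ ⊤) := by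
  funext w
  obtain ⟨hfin, d, hdeg⟩ := F.wtFin_degGE
  have hrat := EqMod.isRational_syzIter F.rational
  have hrr := F.isRational_res
  have hsyz := degGE_wtFin_syzIter F.rational hdeg hfin
  have hres : ∀ i, WtFin (F.toEqMod.res i) := fun i => (hsyz i).2.free (hrat i) (hsyz i).1
  have hresd : ∀ i, DegGE (F.toEqMod.res i) (d + i) := fun i => (hsyz i).1.free (hrat i)
  set J := originIdeal n k with hJ
  -- Characters of the terms `Pᵢ` (`c`), their cycles (`z`) and boundaries (`b`) modulo `J`, the
  -- submodules `J Pᵢ` (`j`), and the iterated syzygies `Ωⁱ F` (`o`).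
  let c : ℕ → Wt n → ℤ := fun i => chr (F.toEqMod.res i).ρ ⊤
  let z : ℕ → Wt n → ℤ := fun i => chr (F.toEqMod.res i).ρ (F.torCycles J i)
  let b : ℕ → Wt n → ℤ := fun i => chr (F.toEqMod.res i).ρ (F.torBoundaries J i)
  let j : ℕ → Wt n → ℤ := fun i => chr (F.toEqMod.res i).ρ
    ((J • ⊤ : Submodule (CoordRing n k) (F.toEqMod.res i).carrier).restrictScalars k)
  let o : ℕ → Wt n → ℤ := fun i => chr (F.toEqMod.syzIter i).ρ ⊤
  have htor : ∀ i, (F.tor i).ch.coeff w = z i w - b i w := fun i =>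
    finrank_wtSpace_subquotRep (hrr i) (hres i) (F.torCycles_stable originIdeal_stable i)
      (F.torBoundaries_stable originIdeal_stable i) (F.toEqMod.torBoundaries_le J i) w
  have hz0 : z 0 = c 0 := rfl
  have hJhom : ∀ i, Homog (hrr i)
      ((J • ⊤ : Submodule (CoordRing n k) (F.toEqMod.res i).carrier).restrictScalars k) := by
    intro i
    rw [hJ, originIdeal_eq_span]
    exact homog_smul_top_coordIdeal (hrr i) Finset.univ
  -- Rank and nullity for `Pᵢ₊₁ → Pᵢ / J Pᵢ`, whose kernel is the cycles and whose image is the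
  -- boundaries modulo `J Pᵢ`.
  have hz : ∀ i, z (i + 1) w = c (i + 1) w - b i w + j i w := by
    intro i
    have h := chr_sub_chr (hrr (i + 1)) (hrr i) (hres (i + 1)) (hres i)
      (f := (F.toEqMod.diff i).restrictScalars k) (c := 0)
      (mem_wtSpace_of_equivariant (F.toEqMod.diff_equivariant i)) (Homog.top _) (hJhom i) w
    rw [add_zero, top_inf_eq, Submodule.map_top, sup_comm, ← EqMod.torBoundaries_eq] at h
    change c (i + 1) w - z (i + 1) w = b i w - j i w at h
    linarith
  have hcj : ∀ i, conv n (koszulFactor n) (c i) = c i - j i := by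
    intro i
    have := F.toEqMod.res_free i
    have h := conv_prod_oneSub_chr_top (hrr i) (hres i) Finset.univ
    rw [coordIdeal, ← originIdeal_eq_span] at h
    exact h
  have hco : ∀ i, c i = o i + o (i + 1) := fun i => chr_free (hrat i) (hsyz i).2 (hres i)
  -- The truncated Euler characteristic, with its error terms. By `hcj` and `hco`, the Koszul factor
  -- times `oᵢ + oᵢ₊₁` is the character of `Pᵢ / J Pᵢ`, and the alternating sum telescopes to `o 0`,
  -- the character of `F`.
  have hsum : ∀ m, ∑ i ∈ Finset.range (m + 1), (-1 : ℤ) ^ i * (z i w - b i w) =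
      conv n (koszulFactor n) (o 0) w + (-1) ^ m * conv n (koszulFactor n) (o (m + 1)) w -
        (-1) ^ m * (b m w - j m w) := by
    intro m
    have h1 : ∀ i, conv n (koszulFactor n) (o i) w + conv n (koszulFactor n) (o (i + 1)) w =
        c i w - j i w := by
      intro i
      have := congrFun (hcj i) w
      rw [hco i, map_add] at this
      rw [← Pi.add_apply, this, ← hco i]
      rfl
    induction m with
    | zero =>
      have := h1 0
      simp [hz0]
      linarith
    | succ m ih =>
      rw [Finset.sum_range_succ, ih, hz, pow_succ]
      have := h1 (m + 1)
      linear_combination (-1 : ℤ) ^ m * this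
  set N := Fintype.card (Fin 2 × Fin n × Fin n)
  -- Large enough to include every nonzero `Tor` and to make `d + m` exceed the degree of `w`, so
  -- that `P_m` has no vectors of weight `w` and the error terms vanish at `w`.
  let m := N + 2 + (wtDeg w - d).toNat
  have hlhs : (charHom n k F.eulerTor).coeff w =
      ∑ i ∈ Finset.range (m + 1), (-1 : ℤ) ^ i * (z i w - b i w) := by
    have h1 : (charHom n k F.eulerTor).coeff w =
        ∑ i ∈ Finset.range (N + 2), (-1 : ℤ) ^ i * (z i w - b i w) := by
      rw [EqCoh.eulerTor, map_sum, AddMonoidAlgebra.coeff_sum, Finsupp.finsetSum_apply]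
      refine Finset.sum_congr rfl fun i _ => ?_
      rw [map_zsmul, charHom_cls, ← htor]
      rfl
    rw [h1]
    refine Finset.sum_subset (Finset.range_mono (by omega)) fun i _ hi => ?_
    have hi' : N < i := by
      rw [Finset.mem_range] at hi
      omega
    have h2 : F.torCycles J i = F.torBoundaries J i :=
      le_antisymm (F.torCycles_le hi') (F.toEqMod.torBoundaries_le J i)
    simp only [z, b, h2, sub_self, mul_zero]
  have hbot : wtSpace (F.toEqMod.res m).ρ w = ⊥ := hresd m w (by omega)
  have hb : b m w = 0 := chr_eq_zero hbot _
  have hj : j m w = 0 := chr_eq_zero hbot _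
  have ho : conv n (koszulFactor n) (o (m + 1)) w = 0 := by
    refine conv_prod_oneSub_eq_zero Finset.univ (o (m + 1)) (wtDeg w) (fun v hv => ?_) w le_rfl
    exact chr_eq_zero ((hsyz (m + 1)).1 v (by push_cast; omega)) _
  rw [hlhs, hsum, hb, hj, ho, sub_self, mul_zero, sub_zero, add_zero]
  rfl

end Euler

/-! ### Sheaves supported on the commuting variety -/

/-- Modulo all coordinate functions except `X_ij` and `Y_jl`, the `(i, l)` entry of `XY - YX` is
`X_ij Y_jl`. -/
lemma commMat_sub_mem {n : ℕ} {k : Type u} [Field k] {i j l : Fin n} (hij : i ≠ j) :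
    commMat n k i l - MvPolynomial.X (0, i, j) * MvPolynomial.X (1, j, l) ∈
      Ideal.span (MvPolynomial.X '' {a | a ≠ (0, i, j) ∧ a ≠ (1, j, l)} :
        Set (CoordRing n k)) := by
  set I : Ideal (CoordRing n k) :=
    Ideal.span (MvPolynomial.X '' {a | a ≠ (0, i, j) ∧ a ≠ (1, j, l)})
  have hX : ∀ a, a ≠ (0, i, j) → a ≠ (1, j, l) → (MvPolynomial.X a : CoordRing n k) ∈ I :=
    fun a h h' => Ideal.subset_span ⟨a, ⟨h, h'⟩, rfl⟩
  have h1 : commMat n k i l - MvPolynomial.X (0, i, j) * MvPolynomial.X (1, j, l) =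
      ∑ m ∈ Finset.univ.erase j, (MvPolynomial.X (0, i, m) * MvPolynomial.X (1, m, l) :
        CoordRing n k) - ∑ m, MvPolynomial.X (1, i, m) * MvPolynomial.X (0, m, l) := by
    rw [commMat, Matrix.sub_apply, Matrix.mul_apply, Matrix.mul_apply,
      ← Finset.add_sum_erase _ _ (Finset.mem_univ j)]
    simp only [genMat, Matrix.of_apply]
    ring
  rw [h1]
  refine I.sub_mem (I.sum_mem fun m hm => ?_) (I.sum_mem fun m _ => ?_)
  · have hmj : m ≠ j := Finset.ne_of_mem_erase hm
    exact I.mul_mem_right _ (hX _ (by simp [hmj]) (by simp))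
  -- The factor `Y_im` of a term of `YX` is never the surviving `Y_jl`, because `i ≠ j`.
  · exact I.mul_mem_right _ (hX _ (by simp) (by simp [hij]))

section Support

variable {n : ℕ} {k : Type u} [Field k] [Infinite k]

/-- For all subquotients of `F` by homogeneous submodules killed by the coordinate functions
outside `s`, the character multiplied by the factors `1 - e^c` for `s` lies in `I`. -/
def CharMem (F : EqCoh (coordAct n k)) (I : Ideal (Laurent n))
    (s : Finset (Fin 2 × Fin n × Fin n)) : Prop :=
  ∀ N N' : Submodule (CoordRing n k) F.carrier, N ≤ N' →
    Homog F.rational (N.restrictScalars k) → Homog F.rational (N'.restrictScalars k) →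
    (∀ a ∉ s, ∀ x ∈ N', (MvPolynomial.X a : CoordRing n k) • x ∈ N) →
    ∃ f ∈ I, (f.coeff : Wt n → ℤ) = conv n (∏ a ∈ s, oneSub (coordWt a))
      (chr F.ρ (N'.restrictScalars k) - chr F.ρ (N.restrictScalars k))

variable {F : EqCoh (coordAct n k)} {I : Ideal (Laurent n)}

lemma homog_map_lsmul (a : Fin 2 × Fin n × Fin n) {N : Submodule (CoordRing n k) F.carrier}
    (hN : Homog F.rational (N.restrictScalars k)) :
    Homog F.rational ((N.map (LinearMap.lsmul (CoordRing n k) F.carrier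
      (MvPolynomial.X a))).restrictScalars k) :=
  Homog.map F.rational hN (f := mulX F.toEqMod a) (c := coordWt a) (X_smul_mem_wtSpace a)

lemma homog_comap_lsmul (a : Fin 2 × Fin n × Fin n) {N : Submodule (CoordRing n k) F.carrier}
    (hN : Homog F.rational (N.restrictScalars k)) :
    Homog F.rational ((N.comap (LinearMap.lsmul (CoordRing n k) F.carrier
      (MvPolynomial.X a))).restrictScalars k) :=
  Homog.comap F.rational hN (f := mulX F.toEqMod a) (c := coordWt a) (X_smul_mem_wtSpace a)

lemma Homog.restrictScalars_sup {N N' : Submodule (CoordRing n k) F.carrier}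
    (hN : Homog F.rational (N.restrictScalars k)) (hN' : Homog F.rational (N'.restrictScalars k)) :
    Homog F.rational ((N ⊔ N').restrictScalars k) := by
  rw [Submodule.restrictScalars_sup]
  exact hN.sup hN'

/-- Multiplication by `X a` on `N'/N` has cokernel `N' / (X_a N' + N)` and kernel `(N' ∩ X_a⁻¹ N) /
N`, both killed by `X a`, so the hypothesis for `s` applies to each. Rank and nullity give `(1 -
e^c) ch(N'/N) = ch(coker) - e^c ch(ker)`. -/
lemma CharMem.insert {s : Finset (Fin 2 × Fin n × Fin n)} {a : Fin 2 × Fin n × Fin n}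
    (ha : a ∉ s) (h : CharMem F I s) : CharMem F I (insert a s) := by
  intro N N' hle hN hN' hs
  let X := LinearMap.lsmul (CoordRing n k) F.carrier (MvPolynomial.X a)
  have hmap : N'.map X ≤ N' := by
    rintro _ ⟨x, hx, rfl⟩
    exact N'.smul_mem _ hx
  have hs' : ∀ b ∉ s, b ≠ a → ∀ x ∈ N', (MvPolynomial.X b : CoordRing n k) • x ∈ N :=
    fun b hb hba => hs b fun hb' => (Finset.mem_insert.1 hb').elim hba hb
  obtain ⟨f, hf, hfc⟩ := h (N'.map X ⊔ N) N' (sup_le hmap hle)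
    ((homog_map_lsmul a hN').restrictScalars_sup hN) hN' (by
      intro b hb x hx
      by_cases hba : b = a
      · subst hba
        exact Submodule.mem_sup_left ⟨x, hx, rfl⟩
      · exact Submodule.mem_sup_right (hs' b hb hba x hx))
  obtain ⟨g, hg, hgc⟩ := h N (N' ⊓ N.comap X) (le_inf hle fun x hx => N.smul_mem _ hx) hN
    (Homog.inf hN' (homog_comap_lsmul a hN)) (by
      intro b hb x hx
      by_cases hba : b = a
      · subst hba
        exact hx.2
      · exact hs' b hb hba x hx.1)
  refine ⟨f - AddMonoidAlgebra.single (coordWt a) 1 * g, I.sub_mem hf (I.mul_mem_left _ hg), ?_⟩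
  have hcoeff : ((f - AddMonoidAlgebra.single (coordWt a) 1 * g).coeff : Wt n → ℤ) =
      f.coeff - conv n (AddMonoidAlgebra.single (coordWt a) 1) g.coeff := by
    rw [conv_coeff]
    rfl
  rw [hcoeff, hfc, hgc, ← Module.End.mul_apply, ← map_mul,
    mul_comm (AddMonoidAlgebra.single (coordWt a) 1), map_mul, Module.End.mul_apply, ← map_sub,
    Finset.prod_insert ha, mul_comm (oneSub _), map_mul, Module.End.mul_apply]
  congr 1
  funext w
  have hr := chr_sub_chr F.rational F.rational F.wtFin_degGE.1 F.wtFin_degGE.1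
    (f := mulX F.toEqMod a) (c := coordWt a) (X_smul_mem_wtSpace a) hN' hN (w - coordWt a)
  rw [sub_add_cancel] at hr
  have e1 : (N'.map X ⊔ N).restrictScalars k =
      (N'.restrictScalars k).map (mulX F.toEqMod a) ⊔ N.restrictScalars k :=
    Submodule.restrictScalars_sup _ _ _
  have e2 : (N' ⊓ N.comap X).restrictScalars k =
      N'.restrictScalars k ⊓ (N.restrictScalars k).comap (mulX F.toEqMod a) := rfl
  rw [Pi.sub_apply, Pi.sub_apply, conv_oneSub, conv_single, one_mul, e1, e2]
  simp only [Pi.sub_apply]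
  linarith

lemma CharMem.mono {s t : Finset (Fin 2 × Fin n × Fin n)} (h : CharMem F I s) (hst : s ⊆ t) :
    CharMem F I t := by
  have : ∀ r, CharMem F I (s ∪ r) := by
    intro r
    induction r using Finset.induction_on with
    | empty => simpa using h
    | insert a r _ ih =>
      rw [Finset.union_insert]
      by_cases ha : a ∈ s ∪ r
      · rwa [Finset.insert_eq_of_mem ha]
      · exact ih.insert ha
  have h1 := this t
  rwa [Finset.union_eq_right.2 hst] at h1

/-- A finitely generated subquotient killed by all coordinates is finite dimensional, so its
character is a Laurent polynomial. -/
lemma charMem_empty (F : EqCoh (coordAct n k)) : CharMem F ⊤ ∅ := by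
  intro N N' hle hN hN' hs
  have := F.finite
  have hnoeth : IsNoetherian (CoordRing n k) F.carrier := inferInstance
  have hJ : ∀ a ∈ originIdeal n k, ∀ z ∈ N', a • z ∈ N := by
    intro a ha z hz
    rw [originIdeal_eq_span] at ha
    induction ha using Submodule.span_induction with
    | mem x hx =>
      obtain ⟨b, -, rfl⟩ := hx
      exact hs b (by simp) z hz
    | zero => rw [zero_smul]; exact N.zero_mem
    | add x y _ _ hx hy => rw [add_smul]; exact N.add_mem hx hy
    | smul c x _ hx => rw [smul_eq_mul, mul_smul]; exact N.smul_mem _ hx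
  obtain ⟨t, -, ht⟩ := exists_finset_span (Z := N') (B := N)
    ⟨N', IsNoetherian.noetherian N', le_sup_left⟩ hle hJ
  choose s _ hs' using fun x => exists_eq_sum_wtProj F.rational x
  have hsupp : (Function.support (chr F.ρ (N'.restrictScalars k) -
      chr F.ρ (N.restrictScalars k))).Finite := by
    classical
    refine (t.biUnion s).finite_toSet.subset fun w hw => ?_
    by_contra hwt
    have hwt' : ∀ x ∈ t, w ∉ s x := fun x hx h => hwt (Finset.mem_biUnion.2 ⟨x, hx, h⟩)
    apply hw
    have h0 : ∀ x ∈ Submodule.span k (t : Set F.carrier), wtProj F.rational w x = 0 := by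
      intro x hx
      have h1 : Submodule.span k (t : Set F.carrier) ≤ LinearMap.ker (wtProj F.rational w) :=
        Submodule.span_le.2 fun y hy => hs' y w (hwt' y hy)
      exact h1 hx
    -- Modulo `N`, the finite set `t` spans `N'`. At a weight that occurs in no element of `t`, the
    -- component of any element of `N'` already lies in `N`.
    have heq : N'.restrictScalars k ⊓ wtSpace F.ρ w = N.restrictScalars k ⊓ wtSpace F.ρ w := by
      apply le_antisymm
      · rintro x ⟨hx, hxw⟩
        refine ⟨?_, hxw⟩
        obtain ⟨y, hy, z, hz, rfl⟩ := Submodule.mem_sup.1 (ht hx)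
        rw [← wtProj_same F.rational hxw, map_add, h0 y hy, zero_add]
        exact hN w z hz
      · exact inf_le_inf_right _ hle
    exact sub_eq_zero.2 (congrArg (fun N : Submodule k F.carrier => (Module.finrank k N : ℤ)) heq)
  refine ⟨AddMonoidAlgebra.ofCoeff (Finsupp.ofSupportFinite _ hsupp), trivial, ?_⟩
  rw [Finset.prod_empty, map_one]
  rfl

/-- The weight of `X_ij` is `z_j / (q₁ z_i)`, so `1 - e^c` is a unit times the generator `z_j - q₁
z_i`. -/
lemma oneSub_coordWt_zero_mem {i j l : Fin n} : oneSub (coordWt (0, i, j)) ∈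
    Ideal.span {zVar l - q₂ n * zVar j, zVar j - q₁ n * zVar i} := by
  have h : oneSub (coordWt (0, i, j)) =
      -AddMonoidAlgebra.single (Pi.single i (-1), -1, 0) 1 * (zVar j - q₁ n * zVar i) := by
    rw [oneSub, zVar, zVar, q₁, AddMonoidAlgebra.single_mul_single, mul_sub, neg_mul, neg_mul,
      AddMonoidAlgebra.single_mul_single, AddMonoidAlgebra.single_mul_single, sub_neg_eq_add,
      neg_add_eq_sub, AddMonoidAlgebra.one_def]
    congr 2
    · ext a <;> simp [Pi.single_neg]
    · rw [coordWt, Prod.mk_add_mk, Pi.single_neg, neg_add_eq_sub]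
      simp
  rw [h]
  exact Ideal.mul_mem_left _ _ (Ideal.subset_span (by simp))

/-- The weight of `Y_jl` is `z_l / (q₂ z_j)`, so `1 - e^c` is a unit times the generator `z_l - q₂
z_j`. -/
lemma oneSub_coordWt_one_mem {i j l : Fin n} : oneSub (coordWt (1, j, l)) ∈
    Ideal.span {zVar l - q₂ n * zVar j, zVar j - q₁ n * zVar i} := by
  have h : oneSub (coordWt (1, j, l)) =
      -AddMonoidAlgebra.single (Pi.single j (-1), 0, -1) 1 * (zVar l - q₂ n * zVar j) := by
    rw [oneSub, zVar, zVar, q₂, AddMonoidAlgebra.single_mul_single, mul_sub, neg_mul, neg_mul,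
      AddMonoidAlgebra.single_mul_single, AddMonoidAlgebra.single_mul_single, sub_neg_eq_add,
      neg_add_eq_sub, AddMonoidAlgebra.one_def]
    congr 2
    · ext a <;> simp [Pi.single_neg]
    · rw [coordWt, Prod.mk_add_mk, Pi.single_neg, neg_add_eq_sub]
      simp
  rw [h]
  exact Ideal.mul_mem_left _ _ (Ideal.subset_span (by simp))

/-- For a sheaf supported on the commuting variety, the last two coordinates contribute an element
of the wheel ideal. -/
lemma charMem_pair (hF : ∀ c ∈ commIdeal n k, ∀ x : F.carrier, c • x = 0) {i j l : Fin n}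
    (hij : i ≠ j) :
    CharMem F (Ideal.span {zVar l - q₂ n * zVar j, zVar j - q₁ n * zVar i})
      {(0, i, j), (1, j, l)} := by
  intro N N' hle hN hN' hs
  let X := LinearMap.lsmul (CoordRing n k) F.carrier (MvPolynomial.X (0, i, j))
  -- The `(i, l)` entry of the commutator kills `F` and agrees with `X_ij Y_jl` up to coordinates
  -- that map `N'` into `N`.
  have hxy : ∀ p ∈ N', (MvPolynomial.X (1, j, l) : CoordRing n k) •
      (MvPolynomial.X (0, i, j) : CoordRing n k) • p ∈ N := by
    intro p hp
    have h1 : (commMat n k i l - MvPolynomial.X (0, i, j) * MvPolynomial.X (1, j, l)) • p ∈ N := by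
      have h2 := commMat_sub_mem (k := k) (l := l) hij
      generalize commMat n k i l - MvPolynomial.X (0, i, j) * MvPolynomial.X (1, j, l) = c at h2 ⊢
      induction h2 using Submodule.span_induction with
      | mem x hx =>
        obtain ⟨b, ⟨hb, hb'⟩, rfl⟩ := hx
        exact hs b (by simp [hb, hb']) p hp
      | zero => rw [zero_smul]; exact N.zero_mem
      | add x y _ _ hx hy => rw [add_smul]; exact N.add_mem hx hy
      | smul c x _ hx => rw [smul_eq_mul, mul_smul]; exact N.smul_mem _ hx
    rw [sub_smul, hF _ (Ideal.subset_span ⟨(i, l), rfl⟩), zero_sub] at h1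
    rw [← mul_smul, mul_comm]
    exact N.neg_mem_iff.1 h1
  have hmap : N'.map X ≤ N' := by
    rintro _ ⟨x, hx, rfl⟩
    exact N'.smul_mem _ hx
  -- The middle step `X_ij N' + N` of the filtration: above it only `Y_jl` can act nontrivially,
  -- below it only `X_ij`. One factor `1 - e^c` therefore makes each graded piece a Laurent
  -- polynomial, and the other factor remains to give membership in the ideal.
  have hN'' := (homog_map_lsmul (0, i, j) hN').restrictScalars_sup hN
  obtain ⟨f, -, hf⟩ := (charMem_empty F).insert (Finset.notMem_empty (1, j, l))
    (N'.map X ⊔ N) N' (sup_le hmap hle) hN'' hN' (by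
      intro b hb x hx
      by_cases hbx : b = (0, i, j)
      · subst hbx
        exact Submodule.mem_sup_left ⟨x, hx, rfl⟩
      · exact Submodule.mem_sup_right (hs b (by simpa [hbx] using hb) x hx))
  obtain ⟨g, -, hg⟩ := (charMem_empty F).insert (Finset.notMem_empty (0, i, j))
    N (N'.map X ⊔ N) le_sup_right hN hN'' (by
      intro b hb x hx
      by_cases hby : b = (1, j, l)
      · subst hby
        obtain ⟨_, ⟨y, hy, rfl⟩, z, hz, rfl⟩ := Submodule.mem_sup.1 hx
        rw [smul_add]
        exact N.add_mem (hxy y hy) (N.smul_mem _ hz)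
      · exact hs b (by simpa [hby] using hb) x (sup_le hmap hle hx))
  refine ⟨oneSub (coordWt (0, i, j)) * f + oneSub (coordWt (1, j, l)) * g,
    Ideal.add_mem _ (Ideal.mul_mem_right _ _ oneSub_coordWt_zero_mem)
      (Ideal.mul_mem_right _ _ oneSub_coordWt_one_mem), ?_⟩
  have hcoeff : ((oneSub (coordWt (0, i, j)) * f + oneSub (coordWt (1, j, l)) * g).coeff :
      Wt n → ℤ) = conv n (oneSub (coordWt (0, i, j))) f.coeff +
        conv n (oneSub (coordWt (1, j, l))) g.coeff := by
    rw [conv_coeff, conv_coeff]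
    rfl
  rw [hcoeff, hf, hg, Finset.prod_pair (by simp), Finset.prod_insert (Finset.notMem_empty _),
    Finset.prod_empty, mul_one, Finset.prod_insert (Finset.notMem_empty _), Finset.prod_empty,
    mul_one, ← Module.End.mul_apply, ← Module.End.mul_apply, ← map_mul, ← map_mul,
    mul_comm (oneSub (coordWt (1, j, l))), ← map_add, sub_add_sub_cancel]

/-- The character of the pull-back to the origin of a sheaf supported on the commuting variety lies
in the wheel ideal. -/
lemma charHom_eulerTor_mem_wheelIdeal (hF : ∀ c ∈ commIdeal n k, ∀ x : F.carrier, c • x = 0) :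
    charHom n k F.eulerTor ∈ wheelIdeal n := by
  simp only [wheelIdeal, Ideal.mem_iInf]
  rintro i j l ⟨hij, -, -⟩
  -- With `s` all coordinates the vanishing condition is vacuous, so `N = ⊥` and `N' = ⊤` are
  -- allowed, and the product is the full Koszul factor.
  obtain ⟨f, hf, hfc⟩ := (charMem_pair (l := l) hF hij).mono (Finset.subset_univ _) ⊥ ⊤ bot_le
    (Homog.bot _) (Homog.top _) (by simp)
  have h : charHom n k F.eulerTor = f := by
    apply AddMonoidAlgebra.coeff_injective
    apply DFunLike.coe_injective
    rw [F.coeff_charHom_eulerTor, hfc, Submodule.restrictScalars_bot, chr_bot, sub_zero]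
    rfl
  rwa [h]

end Support

/-! ### Symmetry of characters -/

section Symmetry

variable {n : ℕ} {k : Type u} [Field k]

/-- A permutation matrix as an element of the group. -/
def permGrp (k : Type u) [Field k] (σ : Equiv.Perm (Fin n)) : Grp n k :=
  (⟨σ⁻¹.permMatrix k, σ.permMatrix k, by rw [← Matrix.permMatrix_mul]; simp,
    by rw [← Matrix.permMatrix_mul]; simp⟩, 1)

/-- Permutation matrices normalize the torus; this records the direction in which the entries are
permuted. -/
lemma torus_mul_permGrp (σ : Equiv.Perm (Fin n)) (t : (Fin n → kˣ) × kˣ × kˣ) :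
    torus n k t * permGrp k σ = permGrp k σ * torus n k (t.1 ∘ σ, t.2) := by
  refine Prod.ext (Units.ext ?_) ((mul_one _).trans (one_mul _).symm)
  change (Matrix.diagonal fun i => (t.1 i : k)) * σ⁻¹.permMatrix k =
    σ⁻¹.permMatrix k * Matrix.diagonal fun i => (t.1 (σ i) : k)
  ext a b
  rw [Matrix.diagonal_mul, Matrix.mul_diagonal]
  by_cases h : σ⁻¹ a = b
  · subst h
    simp [mul_comm]
  · have h' : ¬σ.symm a = b := h
    simp [Equiv.Perm.permMatrix, PEquiv.toMatrix_apply, h']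

lemma wtChar_comp_perm (σ : Equiv.Perm (Fin n)) (w : Wt n) (t : (Fin n → kˣ) × kˣ × kˣ) :
    wtChar k w (t.1 ∘ σ, t.2) = wtChar k (w.1 ∘ σ.symm, w.2) t := by
  change (((∏ i, t.1 (σ i) ^ w.1 i) * _ * _ : kˣ) : k) =
    (((∏ i, t.1 i ^ w.1 (σ.symm i)) * _ * _ : kˣ) : k)
  rw [← Equiv.prod_comp σ fun i => t.1 i ^ w.1 (σ.symm i)]
  simp only [Equiv.symm_apply_apply]

/-- The permutation matrix of `σ` acts invertibly and carries the weight space of `w` onto that of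
the permuted weight. -/
lemma finrank_wtSpace_perm {V : Type u} [AddCommGroup V] [Module k V]
    (ρ : Representation k (Grp n k) V) (σ : Equiv.Perm (Fin n)) (w : Wt n) :
    Module.finrank k (wtSpace ρ (w.1 ∘ σ.symm, w.2)) = Module.finrank k (wtSpace ρ w) := by
  have hinv : ∀ x, ρ (permGrp k σ) (ρ (permGrp k σ)⁻¹ x) = x := fun x => by
    rw [← Module.End.mul_apply, ← map_mul, mul_inv_cancel, map_one]; rfl
  have hinj : Function.Injective (ρ (permGrp k σ)) :=
    Function.HasLeftInverse.injective ⟨ρ (permGrp k σ)⁻¹, fun x => by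
      rw [← Module.End.mul_apply, ← map_mul, inv_mul_cancel, map_one]; rfl⟩
  have hcomm : ∀ t x, ρ (torus n k t) (ρ (permGrp k σ) x) =
      ρ (permGrp k σ) (ρ (torus n k (t.1 ∘ σ, t.2)) x) := fun t x => by
    rw [← Module.End.mul_apply, ← map_mul, torus_mul_permGrp, map_mul, Module.End.mul_apply]
  have h : (wtSpace ρ w).map (ρ (permGrp k σ)) = wtSpace ρ (w.1 ∘ σ.symm, w.2) := by
    apply le_antisymm
    · rintro _ ⟨x, hx, rfl⟩ t
      rw [hcomm, hx, map_smul, wtChar_comp_perm]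
    · intro x hx
      refine ⟨ρ (permGrp k σ)⁻¹ x, fun t => hinj ?_, hinv x⟩
      have h1 := hcomm (t.1 ∘ σ.symm, t.2) (ρ (permGrp k σ)⁻¹ x)
      have h2 := wtChar_comp_perm σ w (t.1 ∘ σ.symm, t.2)
      simp only [Function.comp_assoc, Equiv.symm_comp_self, Function.comp_id] at h1 h2
      rw [← h1, hinv, map_smul, hinv, hx, ← h2]
  rw [← h]
  exact (Submodule.equivMapOfInjective _ hinj _).finrank_eq.symm

lemma permVars_ch [Infinite k] (V : RatRep n k) (σ : Equiv.Perm (Fin n)) :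
    permVars n σ V.ch = V.ch := by
  apply AddMonoidAlgebra.coeff_injective
  let e : Wt n → Wt n := fun w => (w.1 ∘ σ.symm, w.2)
  have he : Function.Injective e := by
    intro v w h
    refine Prod.ext (funext fun i => ?_) (Prod.ext_iff.1 h).2
    have := congrFun (congrArg Prod.fst h) (σ i)
    simpa [e] using this
  ext w
  obtain ⟨v, rfl⟩ : ∃ v, e v = w := ⟨(w.1 ∘ σ, w.2), by
    simp [e, Function.comp_assoc]⟩
  change (Finsupp.mapDomain e V.ch.coeff) (e v) = V.ch.coeff (e v)
  rw [Finsupp.mapDomain_apply he, coeff_ch_apply, coeff_ch_apply, finrank_wtSpace_perm]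

lemma permVars_charHom [Infinite k] (x : RepGroup n k) (σ : Equiv.Perm (Fin n)) :
    permVars n σ (charHom n k x) = charHom n k x := by
  have h : (permVars n σ).comp (charHom n k) = charHom n k := by
    refine QuotientAddGroup.addMonoidHom_ext _ (FreeAbelianGroup.lift_ext _ _ fun V => ?_)
    change permVars n σ (charHom n k V.cls) = charHom n k V.cls
    rw [charHom_cls, permVars_ch]
  exact DFunLike.congr_fun h x

end Symmetry

end WheelComm

/-! ### The main theorem -/

theorem mainTheorem4 (n : ℕ) (k : Type u) [Field k] [IsAlgClosed k] :
    ∃ r₀ : WheelComm.EqK (WheelComm.coordAct n k) →+ WheelComm.RepGroup n k,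
      WheelComm.IsOriginPullback n k r₀ ∧
      ((WheelComm.charHom n k).comp (r₀.comp (WheelComm.pushComm n k))).range ≤
        WheelComm.wheelIdealSym n := by
  refine ⟨WheelComm.originPullback n k, WheelComm.isOriginPullback_originPullback, ?_⟩
  rintro _ ⟨x, rfl⟩
  refine ⟨?_, fun σ => WheelComm.permVars_charHom _ σ⟩
  -- The wheel ideal is an additive subgroup, so it is enough to treat classes of single sheaves.
  obtain ⟨x, rfl⟩ := QuotientAddGroup.mk_surjective x
  change (WheelComm.charHom n k).comp ((WheelComm.originPullback n k).comp
    (WheelComm.pushComm n k)) (QuotientAddGroup.mk x) ∈ WheelComm.wheelIdeal n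
  induction x using FreeAbelianGroup.induction_on with
  | zero =>
    rw [QuotientAddGroup.mk_zero, map_zero]
    exact Ideal.zero_mem _
  | of F =>
    let F' : WheelComm.EqCoh (WheelComm.coordAct n k) :=
      WheelComm.pushObj (Ideal.Quotient.mkₐ k (WheelComm.commIdeal n k))
        (Ideal.Quotient.mkₐ_surjective k _) (fun _ _ => rfl) F
    have h : WheelComm.pushComm n k (QuotientAddGroup.mk (FreeAbelianGroup.of F)) = F'.cls :=
      FreeAbelianGroup.lift_apply_of _ F
    rw [AddMonoidHom.comp_apply, AddMonoidHom.comp_apply, h, WheelComm.originPullback_cls]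
    refine WheelComm.charHom_eulerTor_mem_wheelIdeal fun c hc x => ?_
    -- The push-forward acts through the quotient by `commIdeal n k`, so elements of this ideal act
    -- by zero.
    have h0 : ∀ y : F.carrier, Ideal.Quotient.mk (WheelComm.commIdeal n k) c • y = 0 := fun y =>
      (congrArg (· • y) (Ideal.Quotient.eq_zero_iff_mem.2 hc)).trans (zero_smul (_ ⧸ WheelComm.commIdeal n k) y)
    exact h0 x
  | neg F h =>
    rw [QuotientAddGroup.mk_neg, map_neg]
    exact neg_mem h
  | add x y hx hy =>
    rw [QuotientAddGroup.mk_add, map_add]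
    exact Ideal.add_mem _ hx hy
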